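/- Let $D\ge 3$. For every label $a$ in a set $I$ and every $N\ge 1$ let $T_a,\bar T_a$ be random tensors with entries $(T_a)_{i^1\dots i^D},(\bar T_a)_{j^1\dots j^D}\in\mathbb C$, $1\le i^c,j^c\le N$, all defined (for given $N$) on one probability space, with finite moments of all orders ($\bar T_a$ need not be the complex conjugate of $T_a$). **Trace-invariants and scaling.** A tuple $\boldsymbol\sigma=(\sigma_1,\dots,\sigma_D)\in S_n^D$ is viewed as a graph with white vertices $1,\dots,n$ and black vertices $\bar 1,\dots,\bar n$, with an edge of color $c$ from $s$ to $\overline{\sigma_c(s)}$; its connected components are called pure components. For labels $\vec x,\vec x'\in I^n$, put $T_{x_s}$ on $s$ and $\bar T_{x'_s}$ on $\bar s$; $\mathrm{Tr}_{\boldsymbol\sigma}(\vec x,\vec x')$ is obtained by identifying and summing, for each edge of color $c$, the two indices of color $c$ at its ends. Let $\Phi_{\boldsymbol\sigma}(\vec x,\vec x')$ be the classical cumulant of the trace-invariants of the pure components of $\boldsymbol\sigma$, let $|\nu|$ be the minimal number of transpositions with product $\nu$, and let $r(\boldsymbol\sigma)=n-\min_\eta\sum_c|\sigma_c\eta^{-1}|$,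 the minimum being over those $\eta\in S_n$ for which $(\eta,\sigma_1,\dots,\sigma_D)$ has one pure component. Assume that for all $n\ge1$, $\boldsymbol\sigma\in S_n^D$, $\vec x,\vec x'\in I^n$, the limit $\varphi_{\boldsymbol\sigma}(\vec x,\vec x')=\lim_{N\to\infty}N^{-r(\boldsymbol\sigma)}\Phi_{\boldsymbol\sigma}(\vec x,\vec x')$ exists and is finite. Let $\varphi_{\Pi_{\rm p}(\boldsymbol\sigma),\boldsymbol\sigma}$ be the product of the $\varphi$ of the pure components of $\boldsymbol\sigma$. **Free cumulants.** Write $\tau\preceq\sigma$ if $|\tau|+|\tau\sigma^{-1}|=|\sigma|$, and let $\mathsf M(\nu)$ be the product over the cycles of $\nu$ of $(-1)^{p-1}C_{p-1}$, with $p$ the length of the cycle and $C_k$ the Catalan numbers. A connected $\boldsymbol\sigma$ is *melonic with canonical pairing the identity* if it can be reduced to the graph with two vertices by recursively removing pairs $s,\bar s$ joined by exactly $D-1$ edges and joining the two pending half-edges, which have the same color. For such $\boldsymbol\sigma$, $$\kappa_{\boldsymbol\sigma}(\vec x,\vec x')=\sum_{\boldsymbol\tau\in S_n^D:\ \tau_c\preceq\sigma_c\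 \forall c}\varphi_{\Pi_{\rm p}(\boldsymbol\tau),\boldsymbol\tau}(\vec x,\vec x')\prod_c\mathsf M(\sigma_c\tau_c^{-1}).$$ **Paired tensors.** A paired tensor has $\mathcal D\ge 1$ inputs and $\mathcal D$ outputs, grouped in $\mathcal D$ pairs (one input and one output), each pair having a color in $\{1,\dots,D\}$. A graph $\mathsf g$ of paired tensors $H_1,\dots,H_q$ is a color-preserving permutation of the set of all pairs of the $H_\ell$; it joins by an edge the output of a pair $e$ to the input of the pair $\mathsf g(e)$, and $\mathrm{Tr}_{\mathsf g}(\vec H)$ is obtained by identifying and summing the indices along all edges. A connected $\mathsf g$ is *melonic* if either $q=1$ and each output is joined to the paired input, or $q\ge2$ and some $H_\ell$ has all but one of its outputs joined to the paired inputs, and removing $H_\ell$ and joining the two pending half-edges gives a connected melonic graph. $\mathrm{Tr}$ denotes the invariant of the melonic graph with $q=1$. The set $\mathcal G_a$ of paired tensors *generated by* $(T_a,\bar T_a)$ consists of the tensors obtained from $\mathrm{Tr}_{\boldsymbol\sigma}((a,\dots,a),(a,\dots,a))$, with $\boldsymbol\sigma\in S_n^D$, $n\ge1$, connected and melonic with canonical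 pairing the identity, by choosing for every $c$ one edge $(s,\overline{\sigma_c(s)})$ of color $c$ for each cycle of $\sigma_c$ and not summing over it: the output of color $c$ of $s$ and the input of color $c$ of $\overline{\sigma_c(s)}$ become a pair of free indices. For $H_\ell\in\mathcal G_{a_\ell}$ and $\mathsf g$ connected melonic, let $\phi_{\mathsf g}(\vec h)=\lim_{N\to\infty}\frac1N\mathbb E[\mathrm{Tr}_{\mathsf g}(\vec H)]$ and $\phi(h_\ell)=\lim_{N\to\infty}\frac1N\mathbb E[\mathrm{Tr}(H_\ell)]$; let $\phi_{\Pi(\mathsf h),\mathsf h}$ be the product of the $\phi$ of the connected components of $\mathsf h$, and $\varkappa_{\mathsf g}(\vec h)=\sum_{\mathsf h\preceq\mathsf g}\phi_{\Pi(\mathsf h),\mathsf h}(\vec h)\,\mathsf M(\mathsf h\mathsf g^{-1})$. For $H'_\ell=H_\ell-\phi(h_\ell)N^{1-\mathcal D_\ell}\,\mathbb 1^{\otimes\mathcal D_\ell}$, where $\mathcal D_\ell$ is the number of inputs of $H_\ell$, let $\phi_{\mathsf g}(\vec h')=\lim_{N\to\infty}\frac1N\mathbb E[\mathrm{Tr}_{\mathsf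 g}(\vec H')]$. The pair $(\mathsf g,\vec h)$ is *almost alternating* if at least one edge of $\mathsf g$ links some $H_\ell,H_{\ell'}$ with $a_\ell\ne a_{\ell'}$, and at most one edge links some $H_\ell,H_{\ell'}$ with $\ell\ne\ell'$ and $a_\ell=a_{\ell'}$. **Theorem.** The limits $\phi_{\mathsf g}(\vec h)$ and $\phi_{\mathsf g}(\vec h')$ exist, and the following statements are equivalent. 1. For all $n\ge1$, all connected $\boldsymbol\sigma\in S_n^D$ melonic with canonical pairing the identity, and all $\vec x,\vec x'\in I^n$: $\kappa_{\boldsymbol\sigma}(\vec x,\vec x')=0$ whenever $x_i\ne x_j$ or $x'_i\neq x'_j$ or $x_i\ne x'_j$ for some $i,j\in\{1,\dots,n\}$. 2. Both of the following hold. - For all $n\ge1$, $\boldsymbol\sigma$, $\vec x,\vec x'$ as in 1: $\kappa_{\boldsymbol\sigma}(\vec x,\vec x')=0$ whenever $x_i\ne x'_i$ for some $i$. - For all $q\ge2$, all $H_\ell\in\mathcal G_{a_\ell}$ with $a_\ell\in I$ ($1\le\ell\le q$), and all connected melonic graphs $\mathsf g$ of $\vec H$: $\varkappa_{\mathsf g}(\vec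 h)=0$ whenever $a_\ell\neq a_{\ell'}$ for some $\ell<\ell'$. 3. Both of the following hold. - For all $n\ge1$, $\boldsymbol\sigma$, $\vec x,\vec x'$ as in 1: $\varphi_{\boldsymbol\sigma}(\vec x,\vec x')=0$ whenever $x_i\ne x'_i$ for some $i$. - For all $q\ge2$, all $H_\ell\in\mathcal G_{a_\ell}$ with $a_\ell\in I$ ($1\le\ell\le q$), and all connected melonic graphs $\mathsf g$ of $\vec H$: $\phi_{\mathsf g}(\vec h')=0$ whenever $(\mathsf g,\vec h)$ is almost alternating. -/

import Mathlib

open MeasureTheory Filter Topology Equiv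

noncomputable section

namespace TensorFreeness

/-! ### Permutations -/

/-- The length `|σ|` of a permutation: the minimal number of transpositions whose product is `σ`,
that is, the sum of `p - 1` over the cycles of length `p` of `σ`. -/
def permLength {α : Type} [Fintype α] [DecidableEq α] (σ : Perm α) : ℕ :=
  (σ.cycleType.map (fun p => p - 1)).sum

/-- `τ ⪯ σ`: the permutation `τ` lies on a geodesic from the identity to `σ`. -/
def Precedes {α : Type} [Fintype α] [DecidableEq α] (τ σ : Perm α) : Prop :=
  permLength τ + permLength (τ * σ⁻¹) = permLength σ

/-- The Möbius function of the lattice of non-crossing partitions: the product over the cycles of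
`ν` of `(-1)^(p-1) C_(p-1)`, where `p` is the length of the cycle and `C` are the Catalan numbers
(fixed points contribute a factor `1`). -/
def moebius {α : Type} [Fintype α] [DecidableEq α] (ν : Perm α) : ℂ :=
  (ν.cycleType.map (fun p => (-1 : ℂ) ^ (p - 1) * (catalan (p - 1) : ℂ))).prod

/-! ### Pure trace-invariants -/

/-- A tuple of bijections `σ_c` from white to black vertices is a bipartite colored graph: the
vertex `s` is joined to `σ_c s` by an edge of color `c`. -/
inductive PureAdj {ι W B : Type} (σ : ι → W ≃ B) : W ⊕ B → W ⊕ B → Prop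
  | edge (c : ι) (s : W) : PureAdj σ (Sum.inl s) (Sum.inr (σ c s))

/-- The equivalence relation of lying in the same pure connected component. -/
def pureSetoid {ι W B : Type} (σ : ι → W ≃ B) : Setoid (W ⊕ B) :=
  Relation.EqvGen.setoid (PureAdj σ)

/-- The pure connected components, that is, the blocks of `Π_p(σ)`. -/
abbrev PureComponent {ι W B : Type} (σ : ι → W ≃ B) : Type :=
  Quotient (pureSetoid σ)

instance {ι W B : Type} [Finite W] [Finite B] (σ : ι → W ≃ B) : Fintype (PureComponent σ) :=
  Fintype.ofFinite _

/-- The white vertices of a pure connected component. -/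
abbrev White {ι W B : Type} (σ : ι → W ≃ B) (G : PureComponent σ) : Type :=
  {s : W // (Quotient.mk (pureSetoid σ) (Sum.inl s) : PureComponent σ) = G}

/-- The black vertices of a pure connected component. -/
abbrev Black {ι W B : Type} (σ : ι → W ≃ B) (G : PureComponent σ) : Type :=
  {t : B // (Quotient.mk (pureSetoid σ) (Sum.inr t) : PureComponent σ) = G}

instance {ι W B : Type} [Finite W] (σ : ι → W ≃ B) (G : PureComponent σ) :
    Fintype (White σ G) := Fintype.ofFinite _

instance {ι W B : Type} [Finite B] (σ : ι → W ≃ B) (G : PureComponent σ) :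
    Fintype (Black σ G) := Fintype.ofFinite _

theorem mk_white_eq_mk_black {ι W B : Type} (σ : ι → W ≃ B) (c : ι) (s : W) :
    (Quotient.mk (pureSetoid σ) (Sum.inl s) : PureComponent σ) =
      Quotient.mk (pureSetoid σ) (Sum.inr (σ c s)) :=
  Quotient.sound (Relation.EqvGen.rel _ _ (PureAdj.edge c s))

/-- The restriction of a trace-invariant to one of its pure connected components. -/
def pureRestrict {ι W B : Type} (σ : ι → W ≃ B) (G : PureComponent σ) :
    ι → White σ G ≃ Black σ G :=
  fun c => (σ c).subtypeEquiv (fun s => by rw [mk_white_eq_mk_black σ c s])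

/-- The trace-invariant `Tr_σ(X, X')`. The tensor `X s` sits on the white vertex `s` and has the
output indices `i s c`; the tensor `X' t` sits on the black vertex `t`, and its input index of
color `c` is identified with the output index of color `c` of the white vertex `s` such that
`σ_c s = t`. -/
def pureTrace {D N : ℕ} {W B : Type} [Fintype W] [DecidableEq W] [Fintype B]
    (σ : Fin D → W ≃ B) (X : W → (Fin D → Fin N) → ℂ) (X' : B → (Fin D → Fin N) → ℂ) : ℂ :=
  ∑ i : W → Fin D → Fin N, (∏ s, X s (i s)) * ∏ t, X' t (fun c => i ((σ c).symm t) c)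

/-- `d(σ, η) = ∑_c |σ_c η⁻¹|`. -/
def tupleDist {D : ℕ} {W B : Type} [Fintype B] [DecidableEq B] (σ : Fin D → W ≃ B) (η : W ≃ B) :
    ℕ :=
  ∑ c, permLength (η.symm.trans (σ c))

/-- The Gaussian scaling function `r(σ) = n - min d(σ, η)`, where the minimum is over the `η` such
that the `D + 1` bijections `(η, σ_1, …, σ_D)` have a single pure connected component. -/
def gaussianScaling {D : ℕ} {W B : Type} [Fintype W] [Fintype B] [DecidableEq B]
    (σ : Fin D → W ≃ B) : ℤ :=
  (Fintype.card W : ℤ) -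
    (sInf {d : ℕ | ∃ η : W ≃ B,
      Nat.card (PureComponent (fun o : Option (Fin D) => o.elim η σ)) = 1 ∧
        d = tupleDist σ η} : ℕ)

/-- The classical cumulant of a finite family of complex random variables. -/
def classicalCumulant {Ω : Type*} [MeasurableSpace Ω] (μ : Measure Ω) {κ : Type} [Fintype κ]
    [DecidableEq κ] (Y : κ → Ω → ℂ) : ℂ :=
  ∑ π : Finpartition (Finset.univ : Finset κ),
    (-1 : ℂ) ^ (π.parts.card - 1) * ((π.parts.card - 1).factorial : ℂ) *
      ∏ G ∈ π.parts, ∫ ω, ∏ k ∈ G, Y k ω ∂μ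

/-! ### Families of pure random tensors -/

/-- A family, indexed by labels `a : I`, of pairs `(T_a, T̄_a)` of random tensors with `D` indices
of size `N`, for every `N`. All pairs of the same size `N` are defined on the same probability
space, and their entries have finite moments of all orders. The tensor `T̄_a` need not be the complex
conjugate of `T_a`. -/
structure PureTensorFamily (D : ℕ) (I : Type*) where
  /-- the probability space carrying the tensors of size `N` -/
  Ω : ℕ → Type*
  /-- its σ-algebra -/
  mΩ : ∀ N, MeasurableSpace (Ω N)
  /-- its probability measure -/
  P : ∀ N, @Measure (Ω N) (mΩ N)
  isProb : ∀ N, IsProbabilityMeasure (P N)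
  /-- the tensors `T_a` -/
  T : I → ∀ N, Ω N → (Fin D → Fin N) → ℂ
  /-- the tensors `T̄_a` -/
  Tbar : I → ∀ N, Ω N → (Fin D → Fin N) → ℂ
  memLp_T : ∀ a N i (p : ℕ), MemLp (fun ω => T a N ω i) p (P N)
  memLp_Tbar : ∀ a N i (p : ℕ), MemLp (fun ω => Tbar a N ω i) p (P N)

attribute [instance] PureTensorFamily.mΩ PureTensorFamily.isProb

namespace PureTensorFamily

variable {D : ℕ} {I : Type*} (F : PureTensorFamily D I)

open scoped Classical in
/-- `Φ_σ[X, X']` at size `N`: the classical cumulant of the trace-invariants associated with the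
pure connected components of `σ`, where the white vertex `s` carries `T_(x s)` and the black
vertex `t` carries `T̄_(x' t)`. -/
def traceCumulant {W B : Type} [Fintype W] [Fintype B] (σ : Fin D → W ≃ B)
    (x : W → I) (x' : B → I) (N : ℕ) : ℂ :=
  classicalCumulant (F.P N) (fun (G : PureComponent σ) (ω : F.Ω N) =>
    pureTrace (pureRestrict σ G) (fun s => F.T (x s.1) N ω) (fun t => F.Tbar (x' t.1) N ω))

open scoped Classical in
/-- The rescaled cumulant `Φ_σ[X, X'] / N^(r(σ))`. -/
def rescaledTraceCumulant {W B : Type} [Fintype W] [Fintype B] (σ : Fin D → W ≃ B)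
    (x : W → I) (x' : B → I) (N : ℕ) : ℂ :=
  F.traceCumulant σ x x' N / (N : ℂ) ^ gaussianScaling σ

/-- The tensors scale like pure complex Gaussian tensors: for all `n ≥ 1` and `σ ∈ S_n^D`, and for
every choice of the tensors on the white and on the black vertices, `Φ_σ[X, X'] / N^(r(σ))` has
a finite limit. -/
def HasGaussianScaling : Prop :=
  ∀ n : ℕ, 1 ≤ n → ∀ (σ : Fin D → Perm (Fin n)) (x x' : Fin n → I),
    ∃ l : ℂ, Tendsto (F.rescaledTraceCumulant σ x x') atTop (𝓝 l)

/-- The asymptotic moment `φ_σ(x, x') = lim Φ_σ[X, X'] / N^(r(σ))`. -/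
def asympMoment {W B : Type} [Fintype W] [Fintype B] (σ : Fin D → W ≃ B)
    (x : W → I) (x' : B → I) : ℂ :=
  limUnder atTop (F.rescaledTraceCumulant σ x x')

/-- The multiplicative extension `φ_(Π_p(σ), σ)(x, x')`: the product of the asymptotic moments
of the pure connected components of `σ`. -/
def asympMomentMul {W B : Type} [Fintype W] [Fintype B] (σ : Fin D → W ≃ B)
    (x : W → I) (x' : B → I) : ℂ :=
  ∏ G : PureComponent σ, F.asympMoment (pureRestrict σ G) (fun s => x s.1) (fun t => x' t.1)

open scoped Classical in
/-- The first order free cumulant `κ_σ(x, x') = ∑_(τ ⪯ σ) φ_(Π_p(τ), τ)(x, x') M(σ τ⁻¹)`, for `σ`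
purely connected and melonic with canonical pairing the identity. -/
def freeCumulant {n : ℕ} (σ : Fin D → Perm (Fin n)) (x x' : Fin n → I) : ℂ :=
  ∑ τ : Fin D → Perm (Fin n) with ∀ c, Precedes (τ c) (σ c),
    F.asympMomentMul τ x x' * ∏ c, moebius (σ c * (τ c)⁻¹)

end PureTensorFamily

/-! ### Graphs of paired tensors

A paired tensor with set `S` of pairs of indices (each one consisting of an output and an input
that are paired) is a function `P i j` of the output indices `i : S → Fin N` and of the input
indices `j : S → Fin N`. A graph of paired tensors with set `V` of thick edges, the tensor on `v`
having the set `S v` of pairs of indices, is a permutation `γ` of `Σ v, S v`: the output `e` is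
joined by a colored edge to the input `γ e`. -/

/-- Every edge of the graph joins an output and an input of the same color. -/
def ColorPreserving {D : ℕ} {V : Type} {S : V → Type} (color : ∀ v, S v → Fin D)
    (γ : Perm (Σ v, S v)) : Prop :=
  ∀ e : Σ v, S v, color (γ e).1 (γ e).2 = color e.1 e.2

/-- `IsMelonicOn A γ`: the part of the graph `γ` carried by the thick edges in `A` is connected and
melonic, and all the thick edges outside `A` have been removed (by convention, each output of a
removed thick edge is joined to the paired input).

The graph with one thick edge, each output of which is joined to the paired input, is melonic. In
a connected melonic graph with more than one thick edge, there is a thick edge `v` all of whose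
outputs are joined to the paired inputs, with a single exception `⟨v, r⟩`, such that removing `v`
and reconnecting the two pending half-edges yields a connected melonic graph. -/
inductive IsMelonicOn {V : Type} [DecidableEq V] {S : V → Type} [∀ v, DecidableEq (S v)] :
    Finset V → Perm (Σ v, S v) → Prop
  | single (v : V) : IsMelonicOn {v} 1
  | insert (A : Finset V) (γ : Perm (Σ v, S v)) (v : V) (r : S v) (hv : v ∉ A)
      (hr : (γ ⟨v, r⟩).1 ∈ A) (hfix : ∀ r' : S v, r' ≠ r → γ ⟨v, r'⟩ = ⟨v, r'⟩)
      (hA : IsMelonicOn A (swap ⟨v, r⟩ (γ ⟨v, r⟩) * γ)) : IsMelonicOn (insert v A) γ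

/-- Connected melonic graphs of paired tensors, with thick edges on the canonical pairs. -/
def IsMelonic {V : Type} [Fintype V] [DecidableEq V] {S : V → Type} [∀ v, DecidableEq (S v)]
    (γ : Perm (Σ v, S v)) : Prop :=
  IsMelonicOn Finset.univ γ

/-- The graph of `σ ∈ S_n^D`, with a thick edge between the white vertex `s` and the black vertex
`s̄` for each `s`. -/
def tupleGraph {D n : ℕ} (σ : Fin D → Perm (Fin n)) : Perm (Σ _ : Fin n, Fin D) where
  toFun e := ⟨σ e.2 e.1, e.2⟩
  invFun e := ⟨(σ e.2).symm e.1, e.2⟩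
  left_inv e := by simp
  right_inv e := by simp

/-- `σ ∈ S_n^D` is purely connected and melonic with canonical pairing the identity: it can be
reduced to the graph with two vertices by recursively removing pairs of vertices `s`, `s̄` joined by
`D - 1` colored edges. -/
def IsMelonicTuple {D n : ℕ} (σ : Fin D → Perm (Fin n)) : Prop :=
  IsMelonic (tupleGraph σ)

/-- The trace-invariant `Tr_γ(P)` of paired tensors. -/
def pairedTrace {N : ℕ} {V : Type} [Fintype V] [DecidableEq V] {S : V → Type}
    [∀ v, Fintype (S v)] [∀ v, DecidableEq (S v)] (γ : Perm (Σ v, S v))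
    (P : ∀ v, (S v → Fin N) → (S v → Fin N) → ℂ) : ℂ :=
  ∑ i : (Σ v, S v) → Fin N, ∏ v, P v (fun s => i ⟨v, s⟩) (fun s => i (γ.symm ⟨v, s⟩))

/-- Adjacency of the thick edges of a graph of paired tensors. -/
inductive GraphAdj {V : Type} {S : V → Type} (γ : Perm (Σ v, S v)) : V → V → Prop
  | edge (e : Σ v, S v) : GraphAdj γ e.1 (γ e).1

/-- The equivalence relation of lying in the same connected component. -/
def graphSetoid {V : Type} {S : V → Type} (γ : Perm (Σ v, S v)) : Setoid V :=
  Relation.EqvGen.setoid (GraphAdj γ)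

/-- The connected components of a graph of paired tensors. -/
abbrev GraphComponent {V : Type} {S : V → Type} (γ : Perm (Σ v, S v)) : Type :=
  Quotient (graphSetoid γ)

instance {V : Type} [Finite V] {S : V → Type} (γ : Perm (Σ v, S v)) :
    Fintype (GraphComponent γ) := Fintype.ofFinite _

/-- The thick edges of a connected component. -/
abbrev Thick {V : Type} {S : V → Type} (γ : Perm (Σ v, S v)) (C : GraphComponent γ) : Type :=
  {v : V // (Quotient.mk (graphSetoid γ) v : GraphComponent γ) = C}

instance {V : Type} [Finite V] {S : V → Type} (γ : Perm (Σ v, S v)) (C : GraphComponent γ) :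
    Fintype (Thick γ C) := Fintype.ofFinite _

theorem mk_apply_eq {V : Type} {S : V → Type} (γ : Perm (Σ v, S v)) (e : Σ v, S v) :
    (Quotient.mk (graphSetoid γ) (γ e).1 : GraphComponent γ) = Quotient.mk (graphSetoid γ) e.1 :=
  (Quotient.sound (Relation.EqvGen.rel _ _ (GraphAdj.edge e))).symm

/-- The restriction of a graph of paired tensors to one of its connected components. -/
def graphRestrict {V : Type} {S : V → Type} (γ : Perm (Σ v, S v)) (C : GraphComponent γ) :
    Perm (Σ v : Thick γ C, S v.1) :=
  (subtypeSigmaEquiv S fun v => (Quotient.mk (graphSetoid γ) v : GraphComponent γ) = C).permCongr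
    (γ.subtypePerm fun e => by rw [mk_apply_eq γ e])

/-! ### Asymptotic moments and free cumulants of random paired tensors -/

namespace PureTensorFamily

variable {D : ℕ} {I : Type*} (F : PureTensorFamily D I)

/-- A random paired tensor for every size `N`, on the probability spaces of the family. -/
abbrev RandomPaired (S : Type) : Type _ :=
  ∀ N, F.Ω N → (S → Fin N) → (S → Fin N) → ℂ

open scoped Classical in
/-- `E[Tr_γ(H)] / N`. -/
def rescaledPairedMoment {V : Type} [Fintype V] {S : V → Type} [∀ v, Fintype (S v)]
    (γ : Perm (Σ v, S v)) (H : ∀ v, F.RandomPaired (S v)) (N : ℕ) : ℂ :=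
  (∫ ω, pairedTrace γ (fun v => H v N ω) ∂(F.P N)) / (N : ℂ)

/-- The asymptotic moment `φ_γ(h) = lim E[Tr_γ(H)] / N`, for a connected melonic graph `γ` of paired
tensors. -/
def pairedMoment {V : Type} [Fintype V] {S : V → Type} [∀ v, Fintype (S v)]
    (γ : Perm (Σ v, S v)) (H : ∀ v, F.RandomPaired (S v)) : ℂ :=
  limUnder atTop (F.rescaledPairedMoment γ H)

/-- The multiplicative extension of `φ` to non-connected melonic graphs: the product over the
connected components. -/
def pairedMomentMul {V : Type} [Fintype V] {S : V → Type} [∀ v, Fintype (S v)]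
    (γ : Perm (Σ v, S v)) (H : ∀ v, F.RandomPaired (S v)) : ℂ :=
  ∏ C : GraphComponent γ, F.pairedMoment (graphRestrict γ C) (fun v => H v.1)

open scoped Classical in
/-- The free cumulant `ϰ_γ(h) = ∑_(τ ⪯ γ) φ_(Π(τ), τ)(h) M(τ γ⁻¹)` of a connected melonic
graph `γ` of paired tensors. -/
def pairedCumulant {V : Type} [Fintype V] {S : V → Type} [∀ v, Fintype (S v)]
    (γ : Perm (Σ v, S v)) (H : ∀ v, F.RandomPaired (S v)) : ℂ :=
  ∑ τ : Perm (Σ v, S v) with Precedes τ γ, F.pairedMomentMul τ H * moebius (τ * γ⁻¹)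

/-- `φ(h) = lim E[Tr(H)] / N`, where `Tr(H)` is the trace-invariant given by the graph with the single
thick edge `H`, each output of which is joined to the paired input. -/
def phi {S : Type} [Fintype S] (H : F.RandomPaired S) : ℂ :=
  F.pairedMoment (V := Unit) (S := fun _ => S) 1 (fun _ => H)

open scoped Classical in
/-- The centered paired tensor `H - φ(h) 1_𝒟`, where `𝒟` is the number of inputs of `H` and `1_𝒟` is
the identity tensor divided by `N^(𝒟 - 1)`. -/
def centered {S : Type} [Fintype S] (H : F.RandomPaired S) : F.RandomPaired S :=
  fun N ω i j => H N ω i j - F.phi H * ((if i = j then 1 else 0) / (N : ℂ) ^ (Fintype.card S - 1))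

end PureTensorFamily

/-! ### Paired tensors generated by one pair of tensors -/

/-- The combinatorial data of a paired tensor generated by first order invariants: `σ ∈ S_n^D`
purely connected melonic with canonical pairing the identity, and a set `cut` of edges of its graph
(`(s, c)` stands for the edge of color `c` joining the white vertex `s` to the black vertex `σ_c s`)
which contains exactly one edge of each cycle alternating edges of a given color and canonical
pairs. -/
structure GeneratedShape (D : ℕ) where
  /-- the number of white vertices -/
  n : ℕ
  /-- the colored graph -/
  σ : Fin D → Perm (Fin n)
  melonic : IsMelonicTuple σ
  /-- the edges which are split open -/
  cut : Finset (Fin n × Fin D)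
  cut_spec : ∀ (c : Fin D) (s : Fin n), ∃! t : Fin n, (t, c) ∈ cut ∧ (σ c).SameCycle s t

namespace GeneratedShape

variable {D : ℕ} (G : GeneratedShape D)

/-- The pairs of free indices of the generated paired tensor: splitting open the edge `(s, c)`
creates the output of color `c` of `s` and the input of color `c` of `σ_c s`, which are paired. -/
abbrev Slot : Type := {e : Fin G.n × Fin D // e ∈ G.cut}

/-- The color of a pair of free indices. -/
def color (e : G.Slot) : Fin D := e.1.2

/-- The partial trace-invariant of the pair `(X, X')`: all the edges which are not split open are
summed over. -/
def tensor {N : ℕ} (X X' : (Fin D → Fin N) → ℂ) (i j : G.Slot → Fin N) : ℂ :=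
  ∑ k : {e : Fin G.n × Fin D // e ∉ G.cut} → Fin N,
    (∏ s, X (fun c => if h : (s, c) ∈ G.cut then i ⟨(s, c), h⟩ else k ⟨(s, c), h⟩)) *
      ∏ t, X' (fun c => if h : ((G.σ c).symm t, c) ∈ G.cut then j ⟨((G.σ c).symm t, c), h⟩
        else k ⟨((G.σ c).symm t, c), h⟩)

end GeneratedShape

/-- The random paired tensor of shape `G` generated by the pair `(T_a, T̄_a)`. For varying `G`, these
are the elements of the set generated by `(T_a, T̄_a)`. -/
def PureTensorFamily.generated {D : ℕ} {I : Type*} (F : PureTensorFamily D I)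
    (G : GeneratedShape D) (a : I) : F.RandomPaired G.Slot :=
  fun N ω => G.tensor (F.T a N ω) (F.Tbar a N ω)

/-- A graph of paired tensors, the one on `v` being generated by the pair labeled `a v`, is almost
alternating if at least one of its edges links paired tensors generated by different pairs, and at
most one of its edges links two distinct paired tensors generated by the same pair. -/
def AlmostAlternating {I V : Type*} {S : V → Type*} (a : V → I) (γ : Perm (Σ v, S v)) : Prop :=
  (∃ e, a e.1 ≠ a (γ e).1) ∧
    {e | e.1 ≠ (γ e).1 ∧ a e.1 = a (γ e).1}.Subsingleton

end TensorFreeness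

end

set_option linter.unusedSectionVars false

noncomputable section

namespace TensorFreeness

/-! ### Cutting a cycle -/

section Perm

variable {α : Type} [Fintype α] [DecidableEq α]

/-! A melonic graph is a tree, and once this is exploited everything is Möbius inversion on geodesic
intervals of permutations. A graph `γ` of paired tensors is a permutation of slots. Form the
bipartite graph with one vertex per thick edge, one per cycle of `γ`, and one edge per slot. Its
Euler characteristic is `|V| - |γ|`, so `|V| ≤ #components + |γ|`, with equality exactly for forests
(`IsForest`); melonic means connected forest (`isMelonic_iff`). Forests are stable under passing to
`τ ⪯ γ` and to components, so moments and cumulants are multiplicative. A melonic tuple `σ` is the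
special case of a graph of the paired tensors `T ⊗ T̄` (`freeCumulant_eq_pairedCumulant`).

The analytic input is that `r(σ) ≤ 1` always, with value 1 on connected melonic graphs. The cumulant
of `k ≥ 2` trace-invariants is thus negligible against `N ^ k`, and expectations factorize over
components (`tendsto_pairedMomentMul`). The signed Catalan weights invert the sums over `τ ⪯ γ`
(`sum_moebius`).

Two formulas carry the equivalence. The first is an analogue of free cumulants with products as
entries. Replacing each generated tensor by its pure graph embeds the interval below `g` into the
one below `glue G g`, and `ϰ_g` becomes the Möbius sum over the `h ⪯ glue G g` that agree with `glue
G g` off the cut edges. Expanded in cumulants `κ_k`, only those `k` whose join with the uncut edges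
is the whole graph contribute (`sum_agree_eq_moebiusTransform`). Uncut edges preserve labels, so a
label preserving `k` never reaches a mixed graph; if mixed cumulants of proper subgraphs vanish,
then `ϰ_g = κ_(glue g)`. The second is inclusion-exclusion over the subtracted identities: the
centered moment is the sum of `ϰ_τ` over the `τ ⪯ g` that isolate no tensor (`tendsto_centered`). A
label preserving such `τ` shares at least two same-label edges with `g`
(`exists_two_monochromatic_edges`), which almost alternation excludes. Hence the centered moment
equals `κ_(glue g)` as soon as the smaller mixed cumulants vanish
(`MixedCumulantsVanish.pairedMoment_centered`).

Statement 1 then gives 2 and 3. From 2 to 1, cut every edge, so that the generated tensors are the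
`T_a ⊗ T̄_a`. From 3 to 1, induct on the number of thick edges: a mixed graph with `x = x'` is a
glued alternating graph (`exists_alternating_glue`), obtained by merging along same-label edges as
long as possible; if `x_i ≠ x'_i` somewhere, the moment-cumulant expansion suffices. -/

theorem swap_mul_swap_rotate {a b c : α} (hab : a ≠ b) (hbc : c ≠ b) :
    swap a c * swap c b = swap a b * swap a c := by
  rw [Equiv.mul_swap_eq_swap_mul, swap_apply_right, swap_apply_of_ne_of_ne hab.symm hbc.symm]

/-- The basic surgery on cycles: a transposition of two points of one cycle cuts it in two. Every
later comparison of lengths or Möbius weights reduces to it. -/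
theorem formPerm_append_cons (a b : α) (l₁ l₂ : List α) (h : (a :: l₁ ++ b :: l₂).Nodup) :
    (a :: l₁ ++ b :: l₂).formPerm =
      swap a b * ((a :: l₁).formPerm * (b :: l₂).formPerm) := by
  induction l₁ generalizing a with
  | nil => simp
  | cons c l ih =>
    have h' : (c :: l ++ b :: l₂).Nodup := (List.nodup_cons.1 h).2
    have hab : a ≠ b := by
      rintro rfl; simp at h
    have hcb : c ≠ b := by
      rintro rfl; simp at h
    have := ih c h'
    simp only [List.cons_append] at this ⊢
    rw [List.formPerm_cons_cons, this, List.formPerm_cons_cons, ← mul_assoc,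
      swap_mul_swap_rotate hab hcb]
    simp only [mul_assoc]

/-- A weight multiplicative over cycles. -/
def cycleWeight {R : Type*} [CommMonoid R] (w : ℕ → R) (σ : Perm α) : R :=
  (σ.cycleType.map w).prod

theorem cycleWeight_disjoint {R : Type*} [CommMonoid R] (w : ℕ → R) {σ τ : Perm α}
    (h : σ.Disjoint τ) : cycleWeight w (σ * τ) = cycleWeight w σ * cycleWeight w τ := by
  simp [cycleWeight, h.cycleType_mul]

theorem cycleWeight_formPerm {R : Type*} [CommMonoid R] (w : ℕ → R) (hw : w 1 = 1)
    (a : α) (l : List α) (h : (a :: l).Nodup) :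
    cycleWeight w (a :: l).formPerm = w (l.length + 1) := by
  cases l with
  | nil => simp [cycleWeight, hw]
  | cons b l =>
    rw [cycleWeight, (List.isCycle_formPerm h (by simp)).cycleType,
      List.support_formPerm_of_nodup _ h (by simp), List.toFinset_card_of_nodup h]
    simp

theorem formPerm_disjoint {l : List α} {ρ : Perm α} (h : ∀ x ∈ l, ρ x = x) :
    l.formPerm.Disjoint ρ := by
  intro x
  by_cases hx : x ∈ l
  · exact Or.inr (h x hx)
  · exact Or.inl (List.formPerm_apply_of_notMem hx)

theorem cycleWeight_formPerm_mul {R : Type*} [CommMonoid R] (w : ℕ → R) (hw : w 1 = 1)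
    (a : α) (l : List α) (h : (a :: l).Nodup) (ρ : Perm α) (hρ : ∀ x ∈ a :: l, ρ x = x) :
    cycleWeight w ((a :: l).formPerm * ρ) = w (l.length + 1) * cycleWeight w ρ := by
  rw [cycleWeight_disjoint w (formPerm_disjoint hρ), cycleWeight_formPerm w hw a l h]

/-- The cycle of `e`, as a list starting with `e`, and the product of the other cycles. -/
theorem exists_cycle_list (ν : Perm α) (e : α) :
    ∃ (t : List α) (ρ : Perm α), (e :: t).Nodup ∧ (∀ x, x ∈ e :: t ↔ ν.SameCycle e x) ∧
      ν = (e :: t).formPerm * ρ ∧ ∀ x ∈ e :: t, ρ x = x := by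
  by_cases he : ν e = e
  · refine ⟨[], ν, by simp, fun x => ?_, by simp, by simpa using he⟩
    simp only [List.mem_singleton]
    constructor
    · rintro rfl; exact Perm.SameCycle.refl _ _
    · intro h
      exact (h.eq_of_left he).symm
  · have hes : e ∈ ν.support := by simpa using he
    have hne : ν.toList e ≠ [] := by simpa using he
    obtain ⟨a, t, hl⟩ := List.exists_cons_of_ne_nil hne
    have ha : a = e := by
      have := Perm.toList_getElem_zero ν _ hes
      simpa [hl] using this
    subst ha
    have hd := Perm.disjoint_mul_inv_of_mem_cycleFactorsFinset
      (Perm.cycleOf_mem_cycleFactorsFinset_iff.2 hes)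
    refine ⟨t, ν * (ν.cycleOf a)⁻¹, hl ▸ Perm.nodup_toList ν a, fun x => ?_, ?_, ?_⟩
    · rw [← hl, Perm.mem_toList_iff]
      exact and_iff_left hes
    · rw [← hl, Perm.formPerm_toList, ← hd.commute.eq, inv_mul_cancel_right]
    · intro x hx
      rw [← hl, Perm.mem_toList_iff] at hx
      refine (hd x).resolve_right ?_
      rw [hx.1.cycleOf_apply]
      intro hxx
      exact he ((hx.1.apply_eq_self_iff).2 hxx)

theorem swap_mul_formPerm_mul (e i : α) (l₁ l₂ : List α) (h : (e :: l₁ ++ i :: l₂).Nodup)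
    (ρ : Perm α) :
    swap e i * ((e :: l₁ ++ i :: l₂).formPerm * ρ) =
      (e :: l₁).formPerm * ((i :: l₂).formPerm * ρ) := by
  rw [formPerm_append_cons e i l₁ l₂ h]
  simp only [← mul_assoc, swap_mul_self, one_mul]

theorem cycleWeight_swap_mul {R : Type*} [CommMonoid R] (w : ℕ → R) (hw : w 1 = 1) (e i : α)
    (l₁ l₂ : List α) (h : (e :: l₁ ++ i :: l₂).Nodup) (ρ : Perm α)
    (hρ : ∀ x ∈ e :: l₁ ++ i :: l₂, ρ x = x) :
    cycleWeight w (swap e i * ((e :: l₁ ++ i :: l₂).formPerm * ρ)) =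
      w (l₁.length + 1) * (w (l₂.length + 1) * cycleWeight w ρ) := by
  rw [swap_mul_formPerm_mul e i l₁ l₂ h]
  have h2 := List.nodup_append.1 h
  have hd := formPerm_disjoint (l := e :: l₁) (ρ := (i :: l₂).formPerm * ρ) (fun x hx => by
    rw [Perm.mul_apply, hρ x (by simp only [List.mem_append]; exact Or.inl hx)]
    exact List.formPerm_apply_of_notMem fun hx2 => h2.2.2 x hx x hx2 rfl)
  rw [cycleWeight_disjoint w hd, cycleWeight_formPerm w hw e l₁ h2.1,
    cycleWeight_formPerm_mul w hw i l₂ h2.2.1 ρ (fun x hx => hρ x (by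
      simp only [List.mem_append]; exact Or.inr hx))]

theorem permLength_eq_cycleWeight (σ : Perm α) :
    permLength σ = (cycleWeight (R := Multiplicative ℕ)
      (fun p => Multiplicative.ofAdd (p - 1)) σ).toAdd := by
  unfold permLength cycleWeight
  generalize σ.cycleType = m
  induction m using Multiset.induction_on with
  | empty => rfl
  | cons a s ih =>
    rw [Multiset.map_cons, Multiset.map_cons, Multiset.sum_cons, Multiset.prod_cons, toAdd_mul, ih,
      toAdd_ofAdd]

theorem moebius_eq_cycleWeight (σ : Perm α) :
    moebius σ = cycleWeight (fun p => (-1 : ℂ) ^ (p - 1) * (catalan (p - 1) : ℂ)) σ := rfl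

/-! ### The length -/

theorem permLength_swap_mul_of_sameCycle {ν : Perm α} {e i : α} (hne : e ≠ i)
    (h : ν.SameCycle e i) : permLength (swap e i * ν) + 1 = permLength ν := by
  obtain ⟨t, ρ, hnd, hmem, hν, hρ⟩ := exists_cycle_list ν e
  have hi : i ∈ t := by
    have := (hmem i).2 h
    simpa [hne.symm] using this
  obtain ⟨l₁, l₂, rfl⟩ := List.append_of_mem hi
  have e1 := cycleWeight_swap_mul (R := Multiplicative ℕ)
      (fun p => Multiplicative.ofAdd (p - 1)) rfl e i l₁ l₂ hnd ρ hρ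
  have e2 := cycleWeight_formPerm_mul (R := Multiplicative ℕ)
      (fun p => Multiplicative.ofAdd (p - 1)) rfl e (l₁ ++ i :: l₂) hnd ρ hρ
  rw [← hν] at e2
  rw [List.cons_append, ← hν] at e1
  rw [permLength_eq_cycleWeight, permLength_eq_cycleWeight ν, e1, e2]
  simp only [toAdd_mul, toAdd_ofAdd, List.length_append, List.length_cons]
  omega

@[simp] theorem permLength_one : permLength (1 : Perm α) = 0 := by simp [permLength]

@[simp] theorem permLength_inv (σ : Perm α) : permLength σ⁻¹ = permLength σ := by
  simp [permLength]

theorem permLength_conj (σ τ : Perm α) : permLength (τ * σ * τ⁻¹) = permLength σ := by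
  simp [permLength]

theorem permLength_mul_comm (σ τ : Perm α) : permLength (σ * τ) = permLength (τ * σ) := by
  have := permLength_conj (σ * τ) τ
  rw [← this]; congr 1; group

theorem permLength_eq_zero {σ : Perm α} (h : permLength σ = 0) : σ = 1 := by
  by_contra hne
  obtain ⟨p, hp⟩ := Multiset.exists_mem_of_ne_zero (mt Perm.cycleType_eq_zero.1 hne)
  have h2 := Perm.two_le_of_mem_cycleType hp
  have := Multiset.le_sum_of_mem (Multiset.mem_map_of_mem (fun p => p - 1) hp)
  simp only [permLength] at h
  omega

/-- Follow the cycle of `e`: the product acts as `ν` up to the last point, whose image `e` is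
replaced by `i`. -/
theorem sameCycle_swap_mul_of_not {ν : Perm α} {e i : α}
    (h : ¬ ν.SameCycle e i) : (swap e i * ν).SameCycle e i := by
  obtain ⟨t, ρ, hnd, hmem, hν, hρ⟩ := exists_cycle_list ν e
  obtain ⟨t', ρ', hnd', hmem', hν', hρ'⟩ := exists_cycle_list ν i
  have hdisj : ∀ x ∈ e :: t, x ∉ i :: t' := fun x hx hx' =>
    h (((hmem x).1 hx).trans ((hmem' x).1 hx').symm)
  have key : ∀ n, n ≤ t.length → ∀ hn : n < (e :: t).length,
      (swap e i * ν).SameCycle e ((e :: t)[n]'hn) := by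
    intro n
    induction n with
    | zero => intro _ _; exact Perm.SameCycle.refl _ _
    | succ n ih =>
      intro hn hn'
      have h1 := ih (by omega) (by omega)
      have hx : ν ((e :: t)[n]'(by omega)) = (e :: t)[n + 1] := by
        conv_lhs => rw [hν]
        rw [Perm.mul_apply, hρ _ (List.getElem_mem _),
          List.formPerm_apply_lt_getElem _ hnd n hn']
      have h2 : (swap e i * ν) ((e :: t)[n]'(by omega)) = (e :: t)[n + 1] := by
        rw [Perm.mul_apply, hx, swap_apply_of_ne_of_ne]
        · intro h0
          have := (List.Nodup.getElem_inj_iff hnd (i := n + 1) (hi := hn') (j := 0)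
            (hj := by simp)).1 (by simpa using h0)
          omega
        · intro h0
          exact hdisj _ (List.getElem_mem hn') (by rw [h0]; simp)
      rw [← h2]
      exact Perm.sameCycle_apply_right.2 h1
  have hlast := key t.length le_rfl (by simp)
  have hx : ν ((e :: t)[t.length]'(by simp)) = e := by
    conv_lhs => rw [hν]
    rw [Perm.mul_apply, hρ _ (List.getElem_mem _), List.formPerm_apply_getElem_length]
  have : (swap e i * ν) ((e :: t)[t.length]'(by simp)) = i := by
    rw [Perm.mul_apply, hx, swap_apply_left]
  have h3 := Perm.sameCycle_apply_right.2 hlast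
  rwa [this] at h3

theorem permLength_swap_mul_of_not_sameCycle {ν : Perm α} {e i : α}
    (h : ¬ ν.SameCycle e i) : permLength (swap e i * ν) = permLength ν + 1 := by
  have hne : e ≠ i := by
    rintro rfl; exact h (Perm.SameCycle.refl _ _)
  have := permLength_swap_mul_of_sameCycle hne (sameCycle_swap_mul_of_not h)
  rw [← this, ← mul_assoc, swap_mul_self, one_mul]

theorem permLength_mul_swap_of_sameCycle {ν : Perm α} {e i : α} (hne : e ≠ i)
    (h : ν.SameCycle e i) : permLength (ν * swap e i) + 1 = permLength ν := by
  rw [permLength_mul_comm]; exact permLength_swap_mul_of_sameCycle hne h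

theorem permLength_mul_swap_of_not_sameCycle {ν : Perm α} {e i : α}
    (h : ¬ ν.SameCycle e i) : permLength (ν * swap e i) = permLength ν + 1 := by
  rw [permLength_mul_comm]; exact permLength_swap_mul_of_not_sameCycle h

theorem sameCycle_mul_swap_of_not {ν : Perm α} {e i : α}
    (h : ¬ ν.SameCycle e i) : (ν * swap e i).SameCycle e i := by
  by_contra h2
  have h3 := permLength_mul_swap_of_not_sameCycle h2
  have h4 := permLength_mul_swap_of_not_sameCycle h
  rw [mul_assoc, swap_mul_self, mul_one] at h3
  omega

theorem permLength_mul_swap_le (ν : Perm α) (e i : α) :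
    permLength (ν * swap e i) ≤ permLength ν + 1 := by
  by_cases hne : e = i
  · subst hne; simp [swap_self, ← Perm.one_def]
  by_cases h : ν.SameCycle e i
  · have := permLength_mul_swap_of_sameCycle hne h; omega
  · exact (permLength_mul_swap_of_not_sameCycle h).le

/-- A nontrivial permutation is a transposition times a shorter permutation. -/
theorem exists_swap_mul {τ : Perm α} {e : α} (he : τ e ≠ e) :
    permLength (swap e (τ e) * τ) + 1 = permLength τ :=
  permLength_swap_mul_of_sameCycle he.symm (Perm.sameCycle_apply_right.2 (Perm.SameCycle.refl _ _))

/-- The length is defined from the cycle type, so the triangle inequality is obtained by peeling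
transpositions off `τ`, each of which costs at most one on the left factor. -/
theorem permLength_mul_le (σ τ : Perm α) :
    permLength (σ * τ) ≤ permLength σ + permLength τ := by
  induction hn : permLength τ generalizing σ τ with
  | zero => rw [permLength_eq_zero hn]; simp
  | succ n ih =>
    have hτ : τ ≠ 1 := by rintro rfl; simp at hn
    obtain ⟨e, he⟩ : ∃ e, τ e ≠ e := by
      by_contra hcon; push Not at hcon; exact hτ (Perm.ext hcon)
    have h1 := exists_swap_mul he
    have h2 := ih (σ * swap e (τ e)) (swap e (τ e) * τ) (by omega)
    rw [mul_assoc, ← mul_assoc (swap e (τ e)), swap_mul_self, one_mul] at h2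
    have h3 := permLength_mul_swap_le σ e (τ e)
    omega

theorem card_support_le (σ : Perm α) : σ.support.card ≤ 2 * permLength σ := by
  rw [← Perm.sum_cycleType, permLength]
  have h : ∀ p ∈ σ.cycleType, 2 ≤ p := fun p hp => Perm.two_le_of_mem_cycleType hp
  revert h
  generalize σ.cycleType = m
  induction m using Multiset.induction_on with
  | empty => simp
  | cons a s ih =>
    intro h
    have h1 := ih fun p hp => h p (Multiset.mem_cons_of_mem hp)
    have h2 := h a (Multiset.mem_cons_self a s)
    simp only [Multiset.sum_cons, Multiset.map_cons]
    omega

theorem permLength_lt_card_support {σ : Perm α} (hσ : σ ≠ 1) :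
    permLength σ + 1 ≤ σ.support.card := by
  rw [← Perm.sum_cycleType, permLength]
  have h : ∀ p ∈ σ.cycleType, 2 ≤ p := fun p hp => Perm.two_le_of_mem_cycleType hp
  have h0 : σ.cycleType ≠ 0 := mt Perm.cycleType_eq_zero.1 hσ
  revert h h0
  generalize σ.cycleType = m
  have key : ∀ s : Multiset ℕ, (s.map fun p => p - 1).sum ≤ s.sum := by
    intro s
    induction s using Multiset.induction_on with
    | empty => simp
    | cons a s ih => simp only [Multiset.sum_cons, Multiset.map_cons]; omega
  induction m using Multiset.induction_on with
  | empty => simp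
  | cons a s ih =>
    intro h _
    have h2 := h a (Multiset.mem_cons_self a s)
    have := key s
    simp only [Multiset.sum_cons, Multiset.map_cons]
    omega

/-! ### The Möbius function -/

@[simp] theorem moebius_one : moebius (1 : Perm α) = 1 := by simp [moebius]

@[simp] theorem moebius_inv (σ : Perm α) : moebius σ⁻¹ = moebius σ := by simp [moebius]

theorem moebius_conj (σ τ : Perm α) : moebius (τ * σ * τ⁻¹) = moebius σ := by simp [moebius]

theorem moebius_mul_comm (σ τ : Perm α) : moebius (σ * τ) = moebius (τ * σ) := by
  rw [← moebius_conj (σ * τ) τ]; congr 1; group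

theorem catalan_sign_convolution (n : ℕ) :
    ∑ j ∈ Finset.range (n + 1), ((-1 : ℂ) ^ j * (catalan j : ℂ)) *
      ((-1 : ℂ) ^ (n - j) * (catalan (n - j) : ℂ)) = -((-1 : ℂ) ^ (n + 1) * catalan (n + 1)) := by
  rw [catalan_succ, pow_succ]
  push_cast
  rw [Finset.sum_range, Finset.mul_sum, ← Finset.sum_neg_distrib]
  refine Finset.sum_congr rfl fun j _ => ?_
  have : (-1 : ℂ) ^ (j : ℕ) * (-1) ^ (n - (j : ℕ)) = (-1) ^ n := by
    rw [← pow_add]; congr 1; have := j.2; omega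
  rw [← this]; ring

/-- If the cycle of `e` has length `n + 2`, then as `i` runs over its other points, the cycle is cut
into lengths `j + 1` and `n - j + 1`, once for each `j ≤ n`. The Catalan recursion sums the weights;
the sign flips because the total length drops by one. -/
theorem sum_moebius_swap_mul (ν : Perm α) (e : α) (he : ν e ≠ e) :
    ∑ i with ν.SameCycle e i ∧ i ≠ e, moebius (swap e i * ν) = -moebius ν := by
  obtain ⟨t, ρ, hnd, hmem, hν, hρ⟩ := exists_cycle_list ν e
  have het : e ∉ t := (List.nodup_cons.1 hnd).1
  have htn : t.Nodup := (List.nodup_cons.1 hnd).2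
  have hset : (Finset.univ.filter fun i => ν.SameCycle e i ∧ i ≠ e) = t.toFinset := by
    ext i
    simp only [Finset.mem_filter, Finset.mem_univ, true_and, List.mem_toFinset, ← hmem]
    constructor
    · rintro ⟨h1, h2⟩; simpa [h2] using h1
    · intro h; exact ⟨List.mem_cons_of_mem _ h, fun h' => het (h' ▸ h)⟩
  obtain ⟨n, hn⟩ : ∃ n, t.length = n + 1 := by
    refine Nat.exists_eq_succ_of_ne_zero fun h0 => he ?_
    rw [List.length_eq_zero_iff] at h0
    subst h0
    rw [hν]; simpa using hρ e (by simp)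
  have hsum : ∑ i ∈ t.toFinset, moebius (swap e i * ν) =
      ∑ j ∈ Finset.range (n + 1), ((-1 : ℂ) ^ j * (catalan j : ℂ)) *
      ((-1 : ℂ) ^ (n - j) * (catalan (n - j) : ℂ)) *
        cycleWeight (fun p => (-1 : ℂ) ^ (p - 1) * (catalan (p - 1) : ℂ)) ρ := by
    rw [List.sum_toFinset _ htn, ← Fin.sum_univ_fun_getElem, ← Fin.sum_univ_eq_sum_range
      (fun j => ((-1 : ℂ) ^ j * (catalan j : ℂ)) *
      ((-1 : ℂ) ^ (n - j) * (catalan (n - j) : ℂ)) *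
        cycleWeight (fun p => (-1 : ℂ) ^ (p - 1) * (catalan (p - 1) : ℂ)) ρ)]
    refine Fintype.sum_equiv (finCongr hn) _ _ fun j => ?_
    have hj := j.2
    have hsplit : t = t.take j ++ t[(j : ℕ)] :: t.drop (j + 1) := by
      rw [← List.drop_eq_getElem_cons, List.take_append_drop]
    have h1 : (e :: t.take j ++ t[(j : ℕ)] :: t.drop (j + 1)).Nodup := by
      rw [List.cons_append, ← hsplit]; exact hnd
    have := cycleWeight_swap_mul (fun p => (-1 : ℂ) ^ (p - 1) * (catalan (p - 1) : ℂ)) (by simp)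
      e t[(j : ℕ)] _ _ h1 ρ (by rw [List.cons_append, ← hsplit]; exact hρ)
    rw [List.cons_append, ← hsplit, ← hν, ← moebius_eq_cycleWeight] at this
    change moebius (swap e t[(j : ℕ)] * ν) = _
    rw [this]
    have h2 : (t.take j).length = j := by rw [List.length_take]; omega
    have h3 : (t.drop (j + 1)).length = n - j := by rw [List.length_drop]; omega
    simp only [h2, h3, Nat.add_sub_cancel, finCongr_apply, Fin.val_cast]
    ring
  rw [hset, hsum, ← Finset.sum_mul, catalan_sign_convolution]
  have h4 := cycleWeight_formPerm_mul (fun p => (-1 : ℂ) ^ (p - 1) * (catalan (p - 1) : ℂ))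
    (by simp) e t hnd ρ hρ
  rw [← hν, ← moebius_eq_cycleWeight, hn] at h4
  rw [h4]
  simp only [Nat.add_sub_cancel]
  ring

end Perm

end TensorFreeness

end

noncomputable section

namespace TensorFreeness

/-! ### Geodesics from the identity -/

section Geodesic

variable {α : Type} [Fintype α] [DecidableEq α]

theorem permLength_inv_mul_comm (σ τ : Perm α) :
    permLength (τ⁻¹ * σ) = permLength (τ * σ⁻¹) := by
  rw [← permLength_inv, permLength_mul_comm]; simp

theorem moebius_mul_inv_eq (σ τ : Perm α) : moebius (τ * σ⁻¹) = moebius (τ⁻¹ * σ) := by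
  rw [← moebius_inv, moebius_mul_comm τ⁻¹ σ]; simp

theorem precedes_iff {τ σ : Perm α} :
    Precedes τ σ ↔ permLength τ + permLength (τ⁻¹ * σ) = permLength σ := by
  rw [Precedes, permLength_inv_mul_comm]

theorem precedes_iff_le {τ σ : Perm α} :
    Precedes τ σ ↔ permLength τ + permLength (τ⁻¹ * σ) ≤ permLength σ := by
  rw [precedes_iff]
  have := permLength_mul_le τ (τ⁻¹ * σ)
  rw [mul_inv_cancel_left] at this
  omega

theorem Precedes.eq {τ σ : Perm α} (h : Precedes τ σ) :
    permLength τ + permLength (τ⁻¹ * σ) = permLength σ := precedes_iff.1 h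

theorem Precedes.refl (σ : Perm α) : Precedes σ σ := by simp [precedes_iff]

theorem one_precedes (σ : Perm α) : Precedes 1 σ := by simp [precedes_iff]

theorem Precedes.trans {ρ τ σ : Perm α} (h : Precedes ρ τ) (h' : Precedes τ σ) :
    Precedes ρ σ := by
  have h1 := h.eq
  have h2 := h'.eq
  have h3 := permLength_mul_le (ρ⁻¹ * τ) (τ⁻¹ * σ)
  rw [mul_assoc, mul_inv_cancel_left] at h3
  exact precedes_iff_le.2 (by omega)

theorem Precedes.antisymm {τ σ : Perm α} (h : Precedes τ σ) (h' : Precedes σ τ) : τ = σ := by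
  have h1 := h.eq
  have h2 := h'.eq
  have : τ⁻¹ * σ = 1 := permLength_eq_zero (by omega)
  rw [inv_mul_eq_one] at this
  exact this

/-- Left translation by `j⁻¹` identifies the interval from `j` to `γ` with the one from `1` to `j⁻¹
* γ`, which reduces statements on intervals to `sum_moebius`. -/
theorem precedes_interval {j h γ : Perm α} (hj : Precedes j γ) :
    (Precedes j h ∧ Precedes h γ) ↔ Precedes (j⁻¹ * h) (j⁻¹ * γ) := by
  have e : (j⁻¹ * h)⁻¹ * (j⁻¹ * γ) = h⁻¹ * γ := by group
  have h0 := hj.eq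
  constructor
  · rintro ⟨h1, h2⟩
    have := h1.eq
    have := h2.eq
    rw [precedes_iff, e]; omega
  · intro h1
    have h1 := h1.eq
    rw [e] at h1
    have h2 := permLength_mul_le j (j⁻¹ * h)
    rw [mul_inv_cancel_left] at h2
    have h3 := permLength_mul_le h (h⁻¹ * γ)
    rw [mul_inv_cancel_left] at h3
    exact ⟨precedes_iff_le.2 (by omega), precedes_iff_le.2 (by omega)⟩

/-- The map `τ ↦ τ⁻¹ * ν` is the Kreweras complement; applied twice it conjugates by `ν`, so the
same two lengths occur. -/
theorem precedes_reflect {τ ν : Perm α} : Precedes (τ⁻¹ * ν) ν ↔ Precedes τ ν := by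
  rw [precedes_iff, precedes_iff]
  have : (τ⁻¹ * ν)⁻¹ * ν = ν⁻¹ * τ * ν⁻¹⁻¹ := by group
  rw [this, permLength_conj, add_comm]

/-- Two points cannot be both in the same cycle of `j` and of `j⁻¹ γ` when `j ⪯ γ`. -/
theorem Precedes.not_sameCycle {j γ : Perm α} (h : Precedes j γ) {e i : α} (hne : e ≠ i)
    (h1 : j.SameCycle e i) : ¬ (j⁻¹ * γ).SameCycle e i := by
  intro h2
  have e1 := permLength_mul_swap_of_sameCycle hne h1
  have e2 := permLength_swap_mul_of_sameCycle hne h2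
  have e3 := permLength_mul_le (j * swap e i) (swap e i * (j⁻¹ * γ))
  rw [mul_assoc, ← mul_assoc (swap e i), swap_mul_self, one_mul, mul_inv_cancel_left] at e3
  have := h.eq
  omega

omit [Fintype α] [DecidableEq α] in
theorem sameCycle_comp_eq {β : Type*} {σ : Perm α} {a : α → β} (ha : ∀ x, a (σ x) = a x)
    {x y : α} (h : σ.SameCycle x y) : a x = a y := by
  obtain ⟨k, rfl⟩ := h
  have key : ∀ (k : ℤ) x, a ((σ ^ k) x) = a x := by
    intro k
    induction k using Int.induction_on with
    | zero => simp
    | succ k ih =>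
      intro x; rw [zpow_add_one, Perm.mul_apply, ih, ha]
    | pred k ih =>
      intro x
      rw [zpow_sub_one, Perm.mul_apply, ih]
      exact ((ha _).symm.trans (congrArg a (Equiv.apply_symm_apply σ x)))
  exact (key k x).symm

/-- Functions constant on the cycles of `γ` are constant on the cycles of `τ ⪯ γ`. -/
theorem Precedes.comp_eq {β : Type*} {τ γ : Perm α} (h : Precedes τ γ) {a : α → β}
    (ha : ∀ x, a (γ x) = a x) : ∀ x, a (τ x) = a x := by
  induction hn : permLength (τ⁻¹ * γ) generalizing τ with
  | zero =>
    rw [inv_mul_eq_one.1 (permLength_eq_zero hn)]; exact ha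
  | succ n ih =>
    have hne : τ⁻¹ * γ ≠ 1 := by intro h0; rw [h0] at hn; simp at hn
    obtain ⟨e, he⟩ : ∃ e, (τ⁻¹ * γ) e ≠ e := by
      by_contra hcon; push Not at hcon; exact hne (Perm.ext hcon)
    -- Induction on the distance to `γ`. The permutation `τ * swap e i` is one step closer, so it
    -- preserves `a`; it merges the cycles of `e` and `i`, which therefore carry the same value, and
    -- undoing the transposition changes nothing.
    set i := (τ⁻¹ * γ) e with hi
    have hsc : (τ⁻¹ * γ).SameCycle e i := Perm.sameCycle_apply_right.2 (Perm.SameCycle.refl _ _)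
    have hns : ¬ τ.SameCycle e i := fun h0 => h.not_sameCycle he.symm h0 hsc
    have e1 := permLength_mul_swap_of_not_sameCycle hns
    have e2 := permLength_swap_mul_of_sameCycle he.symm hsc
    have e3 : (τ * swap e i)⁻¹ * γ = swap e i * (τ⁻¹ * γ) := by simp [mul_assoc]
    have h0 := h.eq
    have hle : Precedes (τ * swap e i) γ := precedes_iff_le.2 (by rw [e3]; omega)
    have hinv := ih hle (by rw [e3]; omega)
    have hai : a e = a i := sameCycle_comp_eq hinv (sameCycle_mul_swap_of_not hns)
    intro x
    have := hinv (swap e i x)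
    rw [Perm.mul_apply, swap_apply_self] at this
    rw [this]
    by_cases hxe : x = e
    · rw [hxe, swap_apply_left, hai]
    · by_cases hxi : x = i
      · rw [hxi, swap_apply_right, hai]
      · rw [swap_apply_of_ne_of_ne hxe hxi]

theorem Precedes.sameCycle {τ γ : Perm α} (h : Precedes τ γ) {x y : α}
    (hxy : τ.SameCycle x y) : γ.SameCycle x y := by
  have key := h.comp_eq (a := fun z => γ.SameCycle x z) (fun z => by simp)
  exact (sameCycle_comp_eq key hxy).mp (Perm.SameCycle.refl _ _)

theorem Precedes.apply_eq_self {τ γ : Perm α} (h : Precedes τ γ) {x : α} (hx : γ x = x) :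
    τ x = x := by
  have h1 : γ.SameCycle x (τ x) :=
    h.sameCycle (Perm.sameCycle_apply_right.2 (Perm.SameCycle.refl _ _))
  exact (h1.eq_of_left hx).symm

/-- If `j ⪯ h ⪯ γ` and `j`, `γ` agree at `e`, then so does `h`. -/
theorem Precedes.apply_eq {j h γ : Perm α} (hj : Precedes j h) (hh : Precedes h γ) {e : α}
    (he : j e = γ e) : h e = γ e := by
  by_contra hne
  set m := (h⁻¹ * γ) e with hm
  have hme : e ≠ m := by
    intro h0
    apply hne
    conv_lhs => rw [h0, hm]
    simp
  refine hh.not_sameCycle hme ?_ (Perm.sameCycle_apply_right.2 (Perm.SameCycle.refl _ _))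
  have h1 : h.SameCycle e (γ e) := by
    rw [← he]
    exact hj.sameCycle (Perm.sameCycle_apply_right.2 (Perm.SameCycle.refl _ _))
  have h2 : h m = γ e := by simp [hm]
  rw [← h2] at h1
  exact Perm.sameCycle_apply_right.1 h1

/-! ### Möbius inversion -/

-- Fix a point `e` moved by `ν`. A `τ ⪯ ν` moving `e` is uniquely `ρ * swap e i` with `ρ ⪯ ν` fixing
-- `e` and `i = τ⁻¹ e` in the cycle of `e` under `ρ⁻¹ * ν`. For each `ρ`, these terms cancel the
-- term of `ρ` itself by `sum_moebius_swap_mul`.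
open scoped Classical in
theorem sum_moebius (ν : Perm α) :
    ∑ τ with Precedes τ ν, moebius (τ⁻¹ * ν) = if ν = 1 then 1 else 0 := by
  split_ifs with hν
  · subst hν
    have : (Finset.univ.filter fun τ : Perm α => Precedes τ 1) = {1} := by
      ext τ
      simp only [Finset.mem_filter, Finset.mem_univ, true_and, Finset.mem_singleton]
      exact ⟨fun h => h.antisymm (one_precedes _), fun h => h ▸ Precedes.refl _⟩
    rw [this]; simp
  obtain ⟨e, he⟩ : ∃ e, ν e ≠ e := by
    by_contra hcon; push Not at hcon; exact hν (Perm.ext hcon)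
  rw [← Finset.sum_filter_add_sum_filter_not _ (fun τ : Perm α => τ e = e),
    Finset.filter_filter, Finset.filter_filter]
  have key : ∑ τ with Precedes τ ν ∧ ¬ τ e = e, moebius (τ⁻¹ * ν) =
      ∑ ρ with Precedes ρ ν ∧ ρ e = e, ∑ i with (ρ⁻¹ * ν).SameCycle e i ∧ i ≠ e,
        moebius (swap e i * (ρ⁻¹ * ν)) := by
    rw [Finset.sum_sigma']
    symm
    refine Finset.sum_bij' (fun x _ => x.1 * swap e x.2)
      (fun τ _ => ⟨τ * swap e (τ⁻¹ e), τ⁻¹ e⟩) ?_ ?_ ?_ ?_ ?_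
    · rintro ⟨ρ, i⟩ hx
      simp only [Finset.mem_sigma, Finset.mem_filter, Finset.mem_univ, true_and] at hx ⊢
      obtain ⟨⟨h1, h2⟩, h3, h4⟩ := hx
      have hns : ¬ ρ.SameCycle e i := fun h0 => h4 (h0.eq_of_left h2).symm
      have e1 := permLength_mul_swap_of_not_sameCycle hns
      have e2 := permLength_swap_mul_of_sameCycle (Ne.symm h4) h3
      have e3 : (ρ * swap e i)⁻¹ * ν = swap e i * (ρ⁻¹ * ν) := by simp [mul_assoc]
      have := h1.eq
      refine ⟨precedes_iff_le.2 (by rw [e3]; omega), ?_⟩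
      rw [Perm.mul_apply, swap_apply_left]
      intro h0
      apply h4
      apply ρ.injective
      rw [h0, h2]
    · intro τ hx
      simp only [Finset.mem_sigma, Finset.mem_filter, Finset.mem_univ, true_and] at hx ⊢
      obtain ⟨h1, h2⟩ := hx
      have hie : e ≠ τ⁻¹ e := by
        intro h0; apply h2; conv_lhs => rw [h0]
        simp
      have hsc : τ.SameCycle e (τ⁻¹ e) :=
        ⟨-1, by rw [zpow_neg_one]⟩
      have e1 := permLength_mul_swap_of_sameCycle hie hsc
      have hns := h1.not_sameCycle hie hsc
      have e2 := permLength_swap_mul_of_not_sameCycle hns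
      have e3 : (τ * swap e (τ⁻¹ e))⁻¹ * ν = swap e (τ⁻¹ e) * (τ⁻¹ * ν) := by
        simp [mul_assoc]
      have := h1.eq
      refine ⟨⟨precedes_iff_le.2 (by rw [e3]; omega), by simp⟩, ?_, hie.symm⟩
      rw [e3]
      exact sameCycle_swap_mul_of_not hns
    · rintro ⟨ρ, i⟩ hx
      simp only [Finset.mem_sigma, Finset.mem_filter, Finset.mem_univ, true_and] at hx
      obtain ⟨⟨h1, h2⟩, h3, h4⟩ := hx
      have h5 : ρ⁻¹ e = e := by rw [Perm.inv_eq_iff_eq, h2]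
      have h6 : (ρ * swap e i)⁻¹ e = i := by
        rw [mul_inv_rev, swap_inv, Perm.mul_apply, h5, swap_apply_left]
      simp only [h6, mul_assoc, swap_mul_self, mul_one]
    · intro τ hx
      simp [mul_assoc]
    · rintro ⟨ρ, i⟩ hx
      simp [mul_assoc]
  rw [key, ← Finset.sum_add_distrib]
  refine Finset.sum_eq_zero fun ρ hρ => ?_
  simp only [Finset.mem_filter, Finset.mem_univ, true_and] at hρ
  rw [sum_moebius_swap_mul]
  · ring
  · intro h0
    apply he
    rw [Perm.mul_apply, Perm.inv_eq_iff_eq, hρ.2] at h0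
    exact h0

open scoped Classical in
theorem sum_moebius_interval {j γ : Perm α} (hj : Precedes j γ) :
    ∑ h with Precedes j h ∧ Precedes h γ, moebius (h * γ⁻¹) = if j = γ then 1 else 0 := by
  have := sum_moebius (j⁻¹ * γ)
  simp only [inv_mul_eq_one] at this
  rw [← this]
  refine Finset.sum_bij' (fun h _ => j⁻¹ * h) (fun τ _ => j * τ) ?_ ?_ ?_ ?_ ?_
  · intro h hh
    simpa [precedes_interval hj] using hh
  · intro τ hτ
    simpa [precedes_interval hj] using hτ
  · simp
  · simp
  · intro h _
    rw [moebius_mul_inv_eq]; congr 1; group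

-- The reflection `h ↦ j * h⁻¹ * γ` of the interval exchanges the weights of its lower and upper
-- segments.
open scoped Classical in
theorem sum_moebius_interval' {j γ : Perm α} (hj : Precedes j γ) :
    ∑ h with Precedes j h ∧ Precedes h γ, moebius (j * h⁻¹) = if j = γ then 1 else 0 := by
  rw [← sum_moebius_interval hj]
  have key : ∀ h, (j⁻¹ * (j * (h⁻¹ * γ))) = (j⁻¹ * h)⁻¹ * (j⁻¹ * γ) := by intro h; group
  refine Finset.sum_bij' (fun h _ => j * (h⁻¹ * γ)) (fun τ _ => γ * (τ⁻¹ * j)) ?_ ?_ ?_ ?_ ?_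
  · intro h hh
    simp only [Finset.mem_filter, Finset.mem_univ, true_and] at hh ⊢
    rw [precedes_interval hj] at hh ⊢
    rw [key, precedes_reflect]
    exact hh
  · intro h hh
    simp only [Finset.mem_filter, Finset.mem_univ, true_and] at hh ⊢
    rw [precedes_interval hj] at hh ⊢
    rw [← precedes_reflect]
    convert hh using 1
    group
  · intro h _; group
  · intro h _; group
  · intro h _
    congr 1; group

open scoped Classical in
/-- The Möbius transform of a function on permutations. -/
def moebiusTransform (f : Perm α → ℂ) (γ : Perm α) : ℂ :=
  ∑ τ with Precedes τ γ, f τ * moebius (τ * γ⁻¹)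

open scoped Classical in
theorem sum_moebiusTransform (f : Perm α → ℂ) (γ : Perm α) :
    ∑ h with Precedes h γ, moebiusTransform f h = f γ := by
  simp only [moebiusTransform]
  rw [Finset.sum_comm' (t' := Finset.univ.filter fun j => Precedes j γ)
    (s' := fun j => Finset.univ.filter fun h => Precedes j h ∧ Precedes h γ)]
  · rw [Finset.sum_eq_single γ]
    · rw [← Finset.mul_sum, sum_moebius_interval' (Precedes.refl γ)]; simp
    · intro j hj hne
      rw [← Finset.mul_sum, sum_moebius_interval' (by simpa using hj)]; simp [hne]
    · intro h; exact absurd (by simp [Precedes.refl]) h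
  · intro h j
    simp only [Finset.mem_filter, Finset.mem_univ, true_and]
    exact ⟨fun h => ⟨⟨h.2, h.1⟩, h.2.trans h.1⟩, fun h => ⟨h.1.2, h.1.1⟩⟩

/-! ### Joins, removals and transversals -/

theorem sameCycle_apply_self (σ : Perm α) (e : α) : σ.SameCycle e (σ e) :=
  Perm.sameCycle_apply_right.2 (Perm.SameCycle.refl _ _)

/-- Choose `i` with `k i = γ e` and merge the cycles of `k` through `e` and `i`. If `k ⪯ h` and `h e
= γ e`, then `k⁻¹ * h` sends `e` to `i`, so the transposition `swap e i` can be moved from `k⁻¹ * h`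
to `k` along a geodesic. -/
theorem exists_join_single {γ k : Perm α} (hk : Precedes k γ) (e : α) :
    ∃ j, Precedes j γ ∧ (∀ h, Precedes h γ → (Precedes j h ↔ Precedes k h ∧ h e = γ e)) ∧
      ∃ i, j = k * swap e i ∧ k i = γ e := by
  set i := (k⁻¹ * γ) e with hi
  have hki : k i = γ e := by simp [hi]
  by_cases hie : e = i
  · refine ⟨k, hk, fun h hh => ⟨fun h1 => ⟨h1, h1.apply_eq hh ?_⟩, fun h1 => h1.1⟩, i, ?_, hki⟩
    · rw [← hki, ← hie]
    · rw [← hie, swap_self]; rfl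
  have hsc : (k⁻¹ * γ).SameCycle e i := sameCycle_apply_self _ _
  have hns : ¬ k.SameCycle e i := fun h0 => hk.not_sameCycle hie h0 hsc
  have e1 := permLength_mul_swap_of_not_sameCycle hns
  have e2 := permLength_swap_mul_of_sameCycle hie hsc
  have e3 : ∀ h : Perm α, (k * swap e i)⁻¹ * h = swap e i * (k⁻¹ * h) := by simp [mul_assoc]
  have h0 := hk.eq
  have hje : (k * swap e i) e = γ e := by rw [Perm.mul_apply, swap_apply_left, hki]
  refine ⟨k * swap e i, precedes_iff_le.2 (by rw [e3]; omega), fun h hh => ?_, i, rfl, hki⟩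
  constructor
  · intro h1
    refine ⟨Precedes.trans (precedes_iff_le.2 ?_) h1, h1.apply_eq hh hje⟩
    have : permLength (k⁻¹ * (k * swap e i)) ≤ 1 := by
      rw [inv_mul_cancel_left]
      have := permLength_mul_swap_le (1 : Perm α) e i
      simpa using this
    omega
  · rintro ⟨h1, h2⟩
    have h3 : (k⁻¹ * h).SameCycle e i := by
      have : (k⁻¹ * h) e = i := by rw [Perm.mul_apply, h2, hi, Perm.mul_apply]
      rw [← this]; exact sameCycle_apply_self _ _
    have e4 := permLength_swap_mul_of_sameCycle hie h3
    have := h1.eq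
    exact precedes_iff_le.2 (by rw [e3]; omega)

/-- The least element above `k` which agrees with `γ` on `C`. -/
theorem exists_join {β : Type*} (a : α → β) {γ k : Perm α} (hk : Precedes k γ) (C : Finset α) :
    ∃ j, Precedes j γ ∧
      (∀ h, Precedes h γ → (Precedes j h ↔ Precedes k h ∧ ∀ e ∈ C, h e = γ e)) ∧
      ((∀ x, a (k x) = a x) → (∀ e ∈ C, a (γ e) = a e) → ∀ x, a (j x) = a x) := by
  induction C using Finset.induction_on with
  | empty => exact ⟨k, hk, by simp, fun h _ => h⟩
  | insert e C _ ih =>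
    obtain ⟨j, h1, h2, h3⟩ := ih
    obtain ⟨j', h1', h2', i, hj', hji⟩ := exists_join_single h1 e
    refine ⟨j', h1', fun h hh => ?_, fun hk hC x => ?_⟩
    · rw [h2' h hh, h2 h hh]
      simp only [Finset.mem_insert, forall_eq_or_imp]
      tauto
    -- The transposed points `e` and `i` satisfy `j i = γ e`, so both carry the label of `γ e`.
    · have h4 := h3 hk fun e he => hC e (Finset.mem_insert_of_mem he)
      have h5 := hC e (Finset.mem_insert_self _ _)
      have hei : a e = a i := by rw [← h5, ← hji, h4]
      rw [hj', Perm.mul_apply, h4]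
      by_cases hxe : x = e
      · rw [hxe, swap_apply_left, hei]
      · by_cases hxi : x = i
        · rw [hxi, swap_apply_right, hei]
        · rw [swap_apply_of_ne_of_ne hxe hxi]

open scoped Classical in
/-- The relative Möbius transform over the `h ⪯ γ` which agree with `γ` on `C` is the full
transform, when the transform vanishes at all smaller permutations which do not preserve `a`. -/
theorem sum_agree_eq_moebiusTransform {β : Type*} (a : α → β) (f : Perm α → ℂ) (γ : Perm α)
    (C : Finset α) (hC : ∀ e ∈ C, a (γ e) = a e) (hγ : ∃ x, a (γ x) ≠ a x)
    (hf : ∀ k, Precedes k γ → k ≠ γ → (∃ x, a (k x) ≠ a x) → moebiusTransform f k = 0) :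
    ∑ h with Precedes h γ ∧ ∀ e ∈ C, h e = γ e, f h * moebius (h * γ⁻¹) =
      moebiusTransform f γ := by
  -- Expand `f` in its transform and exchange the sums. The coefficient of the transform at `k` is a
  -- full Möbius sum over the interval from `j` to `γ`, where `j` is the join of `k` with the values
  -- of `γ` on `C`; it is 1 if `j = γ` and 0 otherwise.
  have h1 : ∀ h, f h * moebius (h * γ⁻¹) =
      ∑ k with Precedes k h, moebiusTransform f k * moebius (h * γ⁻¹) := fun h => by
    rw [← Finset.sum_mul, sum_moebiusTransform]
  simp_rw [h1]
  rw [Finset.sum_comm' (t' := Finset.univ.filter fun j => Precedes j γ)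
    (s' := fun k => Finset.univ.filter fun h => (Precedes k h ∧ ∀ e ∈ C, h e = γ e) ∧
      Precedes h γ)]
  · have inner : ∀ k, Precedes k γ → ∀ j, (∀ h, Precedes h γ →
        (Precedes j h ↔ Precedes k h ∧ ∀ e ∈ C, h e = γ e)) → Precedes j γ →
        ∑ h with (Precedes k h ∧ ∀ e ∈ C, h e = γ e) ∧ Precedes h γ,
          moebiusTransform f k * moebius (h * γ⁻¹) =
        moebiusTransform f k * if j = γ then 1 else 0 := by
      intro k hk j hj hjγ
      rw [← sum_moebius_interval hjγ, Finset.mul_sum]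
      refine Finset.sum_congr ?_ fun _ _ => rfl
      ext h
      simp only [Finset.mem_filter, Finset.mem_univ, true_and]
      exact and_congr_left fun hh => (hj h hh).symm
    rw [Finset.sum_eq_single γ]
    · rw [inner γ (Precedes.refl γ) γ _ (Precedes.refl γ)]
      · simp
      · intro h hh
        exact ⟨fun h1 => ⟨h1, fun e _ => by rw [h1.antisymm hh]⟩, fun h1 => h1.1⟩
    · intro k hk hne
      have hk : Precedes k γ := by simpa using hk
      obtain ⟨j, hj1, hj2, hj3⟩ := exists_join a hk C
      rw [inner k hk j hj2 hj1]
      by_cases hp : ∃ x, a (k x) ≠ a x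
      · rw [hf k hk hne hp, zero_mul]
      -- Here `k` and the values of `γ` on `C` preserve `a`, hence so does their join `j`; but `γ`
      -- does not, so `j ≠ γ`.
      · push Not at hp
        have := hj3 hp hC
        rw [if_neg, mul_zero]
        rintro rfl
        obtain ⟨x, hx⟩ := hγ
        exact hx (this x)
    · intro h; exact absurd (by simp [Precedes.refl]) h
  · intro h k
    simp only [Finset.mem_filter, Finset.mem_univ, true_and]
    exact ⟨fun h => ⟨⟨⟨h.2, h.1.2⟩, h.1.1⟩, h.2.trans h.1.1⟩, fun h => ⟨⟨h.1.2, h.1.1.2⟩, h.1.1.1⟩⟩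

/-- The permutation `swap e (γ e) * γ` is `γ` with `e` taken out of its cycle. With
`precedes_swap_apply_mul_iff` it is the largest element below `γ` fixing `e`; leaves and identity
tensors are removed in this way. -/
theorem swap_apply_mul_precedes (γ : Perm α) (e : α) : Precedes (swap e (γ e) * γ) γ := by
  by_cases he : γ e = e
  · rw [he, swap_self]; exact Precedes.refl γ
  have h1 := exists_swap_mul he
  refine precedes_iff_le.2 ?_
  have : (swap e (γ e) * γ)⁻¹ * γ = γ⁻¹ * swap e (γ e) * γ⁻¹⁻¹ := by simp [mul_assoc]
  rw [this, permLength_conj]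
  have := permLength_mul_swap_le (1 : Perm α) e (γ e)
  rw [one_mul, permLength_one] at this
  omega

theorem precedes_swap_apply_mul_iff {γ τ : Perm α} (h : Precedes τ γ) (e : α) :
    Precedes τ (swap e (γ e) * γ) ↔ τ e = e := by
  constructor
  · intro h1
    exact h1.apply_eq_self (by simp)
  · intro h1
    by_cases he : γ e = e
    · rw [he, swap_self]; exact h
    have e0 := exists_swap_mul he
    have e1 : swap e (γ e) * γ = γ * swap (γ⁻¹ e) e := by
      rw [Equiv.mul_swap_eq_swap_mul]; simp
    have hne : γ⁻¹ e ≠ e := by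
      intro h0; apply he; rw [Perm.inv_eq_iff_eq] at h0; exact h0.symm
    have h2 : (τ⁻¹ * γ).SameCycle (γ⁻¹ e) e := by
      have : (τ⁻¹ * γ) (γ⁻¹ e) = e := by
        rw [Perm.mul_apply, show γ (γ⁻¹ e) = e from Equiv.apply_symm_apply γ e,
          Perm.inv_eq_iff_eq, h1]
      have h3 := sameCycle_apply_self (τ⁻¹ * γ) (γ⁻¹ e)
      rwa [this] at h3
    have e2 := permLength_mul_swap_of_sameCycle hne h2
    have := h.eq
    refine precedes_iff_le.2 ?_
    rw [e1, ← mul_assoc]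
    rw [e1] at e0
    omega

/-- The largest element below `γ` which fixes `A`, obtained by removing the points of `A` one by
one. -/
theorem exists_remove (γ : Perm α) (A : Finset α) (Q : Perm α → Prop) (hQ : Q γ)
    (hstep : ∀ δ e, e ∈ A → Q δ → δ e ≠ e → Q (swap e (δ e) * δ)) :
    ∃ δ, Q δ ∧ Precedes δ γ ∧ ∀ τ, Precedes τ γ → (Precedes τ δ ↔ ∀ e ∈ A, τ e = e) := by
  induction A using Finset.induction_on with
  | empty => exact ⟨γ, hQ, Precedes.refl γ, fun τ h => by simp [h]⟩
  | insert e A _ ih =>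
    obtain ⟨δ, h1, h2, h3⟩ := ih fun δ e he => hstep δ e (Finset.mem_insert_of_mem he)
    refine ⟨swap e (δ e) * δ, ?_, (swap_apply_mul_precedes δ e).trans h2, fun τ hτ => ?_⟩
    · by_cases he : δ e = e
      · rw [he, swap_self]; exact h1
      · exact hstep δ e (Finset.mem_insert_self _ _) h1 he
    · simp only [Finset.mem_insert, forall_eq_or_imp]
      rw [← h3 τ hτ]
      constructor
      · intro h4
        have h5 := h4.trans (swap_apply_mul_precedes δ e)
        exact ⟨(precedes_swap_apply_mul_iff h5 e).1 h4, h5⟩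
      · rintro ⟨h4, h5⟩
        exact (precedes_swap_apply_mul_iff h5 e).2 h4

/-- Multiplying by a permutation whose support meets each cycle at most once merges cycles. -/
theorem permLength_mul_of_transversal (σ τ : Perm α)
    (hT : ∀ x y, τ x ≠ x → τ y ≠ y → σ.SameCycle x y → x = y) :
    permLength (σ * τ) = permLength σ + permLength τ := by
  induction hn : permLength τ generalizing τ with
  | zero => rw [permLength_eq_zero hn]; simp
  | succ n ih =>
    have hτ : τ ≠ 1 := by rintro rfl; simp at hn
    obtain ⟨e, he⟩ : ∃ e, τ e ≠ e := by
      by_contra hcon; push Not at hcon; exact hτ (Perm.ext hcon)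
    have h1 := exists_swap_mul he
    set f := τ e with hf
    set τ' := swap e f * τ with hτ'
    have hτe : τ' e = e := by simp [hτ', ← hf]
    have hττ : τ = swap e f * τ' := by rw [hτ', ← mul_assoc, swap_mul_self, one_mul]
    have hsupp : ∀ x, τ' x ≠ x → τ x ≠ x := by
      intro x hx h0
      apply hx
      rw [hτ', Perm.mul_apply, h0]
      refine swap_apply_of_ne_of_ne ?_ ?_
      · rintro rfl; exact he h0
      · rintro rfl
        exact he (τ.injective (h0.trans hf)).symm.symm
    have hff : τ f ≠ f := by
      intro h0; exact he (τ.injective (h0.trans hf))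
    have h2 := ih τ' (fun x y hx hy => hT x y (hsupp x hx) (hsupp y hy)) (by omega)
    have h3 : σ * τ = swap (σ e) (σ f) * (σ * τ') := by
      rw [hττ, ← mul_assoc, Equiv.mul_swap_eq_swap_mul, mul_assoc]
    have hfix : ∀ z, σ.SameCycle e z → τ' z = z := by
      intro z hz
      by_contra hzz
      have := hT e z he (hsupp z hzz) hz
      subst this
      exact hzz hτe
    have hinv : ∀ z, σ.SameCycle e ((σ * τ') z) = σ.SameCycle e z := by
      intro z
      rw [Perm.mul_apply, Perm.sameCycle_apply_right]
      apply propext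
      constructor
      · intro hz
        have := hfix _ hz
        rw [τ'.injective this] at hz
        exact hz
      · intro hz
        rwa [hfix z hz]
    -- The `σ`-cycle of `e` is fixed pointwise by `τ'`, hence is invariant under `σ * τ'`; the
    -- transversality hypothesis keeps `f` outside it. Restoring the transposition therefore merges
    -- two cycles.
    have hns : ¬ (σ * τ').SameCycle (σ e) (σ f) := by
      intro h0
      have h4 := sameCycle_comp_eq (a := fun z => σ.SameCycle e z) hinv h0
      have h5 : σ.SameCycle e (σ f) := h4.mp (sameCycle_apply_self σ e)
      exact he.symm (hT e f he hff (Perm.sameCycle_apply_right.1 h5))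
    rw [h3, permLength_swap_mul_of_not_sameCycle hns, h2]
    omega

end Geodesic

end TensorFreeness

end

noncomputable section

namespace TensorFreeness

/-! ### Connected components and forests -/

/-- Collapsing the class of `u` onto that of `v` gives a map `F` whose kernel contains `s'`. So away
from the class of `u`, which is sent to `none`, the `s'`-class determines the `s`-class. -/
theorem card_quotient_le_succ {V : Type} [Finite V] (s s' : Setoid V) (u v : V)
    (h : ∀ r : Setoid V, s ≤ r → r u v → s' ≤ r) :
    Nat.card (Quotient s) ≤ Nat.card (Quotient s') + 1 := by
  classical
  let F : V → Quotient s := fun x => if s x u then Quotient.mk s v else Quotient.mk s x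
  have hF : s' ≤ Setoid.ker F := by
    refine h _ ?_ ?_
    · intro x y hxy
      change F x = F y
      have : s x u ↔ s y u := ⟨fun h => s.trans (s.symm hxy) h, fun h => s.trans hxy h⟩
      simp only [F, this]
      split_ifs
      · rfl
      · exact Quotient.sound hxy
    · change F u = F v
      have hu : s u u := s.refl u
      simp only [F, hu, if_true]
      split_ifs <;> rfl
  have : Function.Injective (fun q : Quotient s =>
      if q = Quotient.mk s u then none else some (Quotient.mk s' q.out)) := by
    intro q q' hqq
    simp only at hqq
    have hout : ∀ q : Quotient s, q ≠ Quotient.mk s u → F q.out = q := by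
      intro q hq
      have : ¬ s q.out u := fun h => hq (by rw [← Quotient.sound h, Quotient.out_eq])
      simp only [F, this, if_false, Quotient.out_eq]
    split_ifs at hqq with h1 h2 h2
    · rw [h1, h2]
    · have h3 := Quotient.exact (Option.some.inj hqq)
      have h4 : F q.out = F q'.out := hF h3
      rwa [hout q h1, hout q' h2] at h4
  have h1 := Nat.card_le_card_of_injective _ this
  rwa [Finite.card_option] at h1

section Graph

variable {V : Type} [Fintype V] [DecidableEq V] {S : V → Type} [∀ v, Fintype (S v)]
  [∀ v, DecidableEq (S v)]

omit [Fintype V] [DecidableEq V] [∀ v, Fintype (S v)] [∀ v, DecidableEq (S v)] in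
theorem graphSetoid_le_iff {γ : Perm (Σ v, S v)} {r : Setoid V} :
    graphSetoid γ ≤ r ↔ ∀ e, r e.1 (γ e).1 := by
  constructor
  · intro h e
    exact h (Relation.EqvGen.rel _ _ (GraphAdj.edge e))
  · intro h x y hxy
    induction hxy with
    | rel x y hxy => cases hxy with | edge e => exact h e
    | refl x => exact r.refl x
    | symm x y _ ih => exact r.symm ih
    | trans x y z _ _ ih1 ih2 => exact r.trans ih1 ih2

omit [Fintype V] [DecidableEq V] [∀ v, Fintype (S v)] [∀ v, DecidableEq (S v)] in
theorem graphSetoid_edge (γ : Perm (Σ v, S v)) (e : Σ v, S v) : graphSetoid γ e.1 (γ e).1 :=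
  Relation.EqvGen.rel _ _ (GraphAdj.edge e)

/-- The number of connected components. -/
def numComp {V : Type} {S : V → Type} (γ : Perm (Σ v, S v)) : ℕ := Nat.card (GraphComponent γ)

theorem numComp_one : numComp (1 : Perm (Σ v, S v)) = Nat.card V := by
  have h : graphSetoid (1 : Perm (Σ v, S v)) ≤ ⊥ :=
    graphSetoid_le_iff.2 fun e => (⊥ : Setoid V).refl _
  exact (Nat.card_eq_of_bijective (Quotient.mk (graphSetoid (1 : Perm (Σ v, S v))))
    ⟨fun x y hxy => h (Quotient.exact hxy), Quotient.mk_surjective⟩).symm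

theorem numComp_le_mul_swap (γ : Perm (Σ v, S v)) (e f : Σ v, S v) :
    numComp γ ≤ numComp (γ * swap e f) + 1 := by
  refine card_quotient_le_succ _ _ e.1 f.1 fun r hr huv => graphSetoid_le_iff.2 fun x => ?_
  rw [graphSetoid_le_iff] at hr
  rw [Perm.mul_apply]
  by_cases hxe : x = e
  · rw [hxe, swap_apply_left]; exact r.trans huv (hr f)
  · by_cases hxf : x = f
    · rw [hxf, swap_apply_right]; exact r.trans (r.symm huv) (hr e)
    · rw [swap_apply_of_ne_of_ne hxe hxf]; exact hr x

theorem numComp_le_mul (τ ρ : Perm (Σ v, S v)) :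
    numComp τ ≤ numComp (τ * ρ) + permLength ρ := by
  induction hn : permLength ρ generalizing τ ρ with
  | zero => rw [permLength_eq_zero hn]; simp
  | succ n ih =>
    have hτ : ρ ≠ 1 := by rintro rfl; simp at hn
    obtain ⟨e, he⟩ : ∃ e, ρ e ≠ e := by
      by_contra hcon; push Not at hcon; exact hτ (Perm.ext hcon)
    have h1 := exists_swap_mul he
    have h2 := ih (τ * swap e (ρ e)) (swap e (ρ e) * ρ) (by omega)
    rw [mul_assoc, ← mul_assoc (swap e (ρ e)), swap_mul_self, one_mul] at h2
    have h3 := numComp_le_mul_swap τ e (ρ e)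
    omega

/-- This is the Euler characteristic bound for the bipartite graph of thick edges and cycles, with
one edge per slot; equality means that this graph has no circuit. -/
theorem card_le_numComp_add (γ : Perm (Σ v, S v)) :
    Nat.card V ≤ numComp γ + permLength γ := by
  have := numComp_le_mul 1 γ
  rwa [numComp_one, one_mul] at this

/-- The bipartite graph of thick edges and cycles is a forest. -/
def IsForest (γ : Perm (Σ v, S v)) : Prop := Nat.card V = numComp γ + permLength γ

theorem isForest_iff_le {γ : Perm (Σ v, S v)} :
    IsForest γ ↔ numComp γ + permLength γ ≤ Nat.card V :=
  ⟨fun h => h.ge, fun h => le_antisymm (card_le_numComp_add γ) h⟩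

/-- Lengths add along a geodesic, which forces equality in both `|V| ≤ numComp τ + |τ|` and `numComp
τ ≤ numComp γ + |τ⁻¹ * γ|`. -/
theorem IsForest.of_precedes {τ γ : Perm (Σ v, S v)} (hγ : IsForest γ) (h : Precedes τ γ) :
    IsForest τ ∧ numComp τ = numComp γ + permLength (τ⁻¹ * γ) := by
  have h1 := numComp_le_mul τ (τ⁻¹ * γ)
  rw [mul_inv_cancel_left] at h1
  have h2 := h.eq
  have h3 := card_le_numComp_add τ
  unfold IsForest at hγ ⊢
  constructor <;> omega

/-- Two slots of one thick edge in a common cycle would close a circuit: cutting the cycle between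
them shortens the permutation without changing the components, against `card_le_numComp_add`. -/
theorem IsForest.fst_ne {γ : Perm (Σ v, S v)} (hγ : IsForest γ) {e f : Σ v, S v} (hne : e ≠ f)
    (h : γ.SameCycle e f) : e.1 ≠ f.1 := by
  intro h0
  have h1 := permLength_mul_swap_of_sameCycle hne h
  have h2 := card_le_numComp_add (γ * swap e f)
  have h3 : numComp (γ * swap e f) = numComp γ := by
    have key : ∀ δ : Perm (Σ v, S v), graphSetoid (δ * swap e f) ≤ graphSetoid δ := by
      intro δ
      refine graphSetoid_le_iff.2 fun x => ?_
      rw [Perm.mul_apply]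
      by_cases hxe : x = e
      · rw [hxe, swap_apply_left, h0]; exact graphSetoid_edge δ f
      · by_cases hxf : x = f
        · rw [hxf, swap_apply_right, ← h0]; exact graphSetoid_edge δ e
        · rw [swap_apply_of_ne_of_ne hxe hxf]; exact graphSetoid_edge δ x
    have h4 := key (γ * swap e f)
    rw [mul_assoc, swap_mul_self, mul_one] at h4
    unfold numComp
    change Nat.card (Quotient (graphSetoid (γ * swap e f))) = Nat.card (Quotient (graphSetoid γ))
    rw [le_antisymm (key γ) h4]
  unfold IsForest at hγ
  omega

theorem IsForest.apply_fst_ne {γ : Perm (Σ v, S v)} (hγ : IsForest γ) {e : Σ v, S v}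
    (hne : γ e ≠ e) : (γ e).1 ≠ e.1 :=
  (hγ.fst_ne hne.symm (sameCycle_apply_self γ e)).symm

theorem graphSetoid_eq_of_fixed {γ : Perm (Σ v, S v)} {v : V}
    (hv : ∀ s : S v, γ ⟨v, s⟩ = ⟨v, s⟩) {u : V} (h : graphSetoid γ v u) : u = v := by
  have : graphSetoid γ ≤ Setoid.ker (fun x => x = v) := by
    refine graphSetoid_le_iff.2 fun e => ?_
    change (e.1 = v) = ((γ e).1 = v)
    apply propext
    obtain ⟨w, s⟩ := e
    constructor
    · rintro rfl; rw [hv]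
    · intro h1
      rcases hw : γ ⟨w, s⟩ with ⟨w', s'⟩
      rw [hw] at h1
      simp only at h1
      subst h1
      have : γ ⟨w, s⟩ = γ ⟨w', s'⟩ := by rw [hv, hw]
      exact congrArg Sigma.fst (γ.injective this)
  have h2 : (v = v) = (u = v) := this h
  exact h2.mp rfl

/-- The nontrivial slots of a thick edge. -/
theorem card_support_eq_sum (γ : Perm (Σ v, S v)) :
    γ.support.card = ∑ v, (Finset.univ.filter fun s : S v => γ ⟨v, s⟩ ≠ ⟨v, s⟩).card := by
  rw [← Finset.card_sigma]
  congr 1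
  ext ⟨v, s⟩
  simp

/-- A nontrivial forest has a leaf. -/
theorem IsForest.exists_leaf {γ : Perm (Σ v, S v)} (hγ : IsForest γ) (hne : γ ≠ 1) :
    ∃ e : Σ v, S v, γ e ≠ e ∧ ∀ s : S e.1, s ≠ e.2 → γ ⟨e.1, s⟩ = ⟨e.1, s⟩ := by
  classical
  by_contra hcon
  push Not at hcon
  -- Without leaves, each non-isolated thick edge has two moved slots, so `2|A| ≤ |supp γ| ≤ 2|γ|`.
  -- The isolated ones together with one nontrivial component give `|V| - |A| + 1 ≤ numComp γ`. The
  -- sum contradicts the forest equation.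
  set A := Finset.univ.filter fun v : V => ∃ s : S v, γ ⟨v, s⟩ ≠ ⟨v, s⟩ with hA
  have h1 : ∑ v ∈ A, 2 ≤ γ.support.card := by
    rw [card_support_eq_sum]
    refine (Finset.sum_le_sum fun v hv => ?_).trans
      (Finset.sum_le_sum_of_subset (Finset.subset_univ A))
    simp only [hA, Finset.mem_filter, Finset.mem_univ, true_and] at hv
    obtain ⟨s, hs⟩ := hv
    obtain ⟨s', h1, h2⟩ := hcon ⟨v, s⟩ hs
    have : ({s, s'} : Finset (S v)).card = 2 := Finset.card_pair h1.symm
    rw [← this]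
    refine Finset.card_le_card fun x hx => ?_
    simp only [Finset.mem_insert, Finset.mem_singleton] at hx
    rcases hx with rfl | rfl
    · simpa using hs
    · simpa using h2
  have h2 := card_support_le γ
  obtain ⟨e, he⟩ : ∃ e, γ e ≠ e := by
    by_contra hc; push Not at hc; exact hne (Perm.ext hc)
  have heA : e.1 ∈ A := by
    simp only [hA, Finset.mem_filter, Finset.mem_univ, true_and]
    exact ⟨e.2, he⟩
  -- isolated vertices are components
  have h3 : Aᶜ.card + 1 ≤ numComp γ := by
    have hfix : ∀ v ∉ A, ∀ s : S v, γ ⟨v, s⟩ = ⟨v, s⟩ := by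
      intro v hv s
      simp only [hA, Finset.mem_filter, Finset.mem_univ, true_and, not_exists, not_not] at hv
      exact hv s
    have hinj : Function.Injective
        (fun v : {v // v ∈ insert e.1 Aᶜ} => (Quotient.mk (graphSetoid γ) v.1)) := by
      rintro ⟨u, hu⟩ ⟨v, hv⟩ huv
      have huv := Quotient.exact huv
      simp only [Finset.mem_insert, Finset.mem_compl] at hu hv
      apply Subtype.ext
      rcases hu with hu | hu
      · rcases hv with hv | hv
        · exact hu.trans hv.symm
        · exact graphSetoid_eq_of_fixed (hfix v hv) ((graphSetoid γ).symm huv)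
      · exact (graphSetoid_eq_of_fixed (hfix u hu) huv).symm
    have := Nat.card_le_card_of_injective _ hinj
    rw [Nat.card_eq_fintype_card, Fintype.card_coe, Finset.card_insert_of_notMem (by simpa using heA)]
      at this
    exact this
  have h4 := Finset.card_compl_add_card A
  rw [Finset.sum_const, smul_eq_mul] at h1
  unfold IsForest at hγ
  rw [Nat.card_eq_fintype_card] at hγ
  omega

/-! ### Melonic graphs -/

/-- Each insertion raises both the length and the number of thick edges by one and attaches the new
thick edge to `A`; for `A` the whole set this is the equation of a connected forest. -/
theorem IsMelonicOn.facts {A : Finset V} {γ : Perm (Σ v, S v)} (h : IsMelonicOn A γ) :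
    A.Nonempty ∧ (∀ e : Σ v, S v, e.1 ∉ A → γ e = e) ∧ permLength γ + 1 = A.card ∧
      ∀ u ∈ A, ∀ v ∈ A, graphSetoid γ u v := by
  induction h with
  | single v =>
    refine ⟨by simp, by simp, by simp, fun u hu w hw => ?_⟩
    simp only [Finset.mem_singleton] at hu hw
    rw [hu, hw]
  | insert A γ v r hv hr hfix hA ih =>
    obtain ⟨h1, h2, h3, h4⟩ := ih
    set e : Σ v, S v := ⟨v, r⟩ with he
    have hne : γ e ≠ e := by
      intro h0; rw [h0] at hr; exact hv hr
    refine ⟨by simp, ?_, ?_, ?_⟩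
    · intro x hx
      have hxA : x.1 ∉ A := fun h => hx (Finset.mem_insert_of_mem h)
      have h5 := h2 x hxA
      have hxe : x ≠ e := by
        rintro rfl; exact hx (Finset.mem_insert_self _ _)
      by_contra hxx
      rw [Perm.mul_apply] at h5
      by_cases h6 : γ x = γ e
      · exact hxe (γ.injective h6)
      · by_cases h7 : γ x = e
        · rw [h7, swap_apply_left] at h5
          rw [h5] at hr
          exact hxA hr
        · rw [swap_apply_of_ne_of_ne h7 h6] at h5
          exact hxx h5
    · have := exists_swap_mul hne
      rw [Finset.card_insert_of_notMem hv]
      omega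
    · have hle : graphSetoid (swap e (γ e) * γ) ≤ graphSetoid γ := by
        refine graphSetoid_le_iff.2 fun x => ?_
        rw [Perm.mul_apply]
        by_cases h6 : γ x = γ e
        · rw [h6, swap_apply_right]
          rw [γ.injective h6]
        · by_cases h7 : γ x = e
          · rw [h7, swap_apply_left]
            have := graphSetoid_edge γ x
            rw [h7] at this
            exact (graphSetoid γ).trans this (graphSetoid_edge γ e)
          · rw [swap_apply_of_ne_of_ne h7 h6]; exact graphSetoid_edge γ x
      have hve : graphSetoid γ v (γ e).1 := graphSetoid_edge γ e
      have key : ∀ u ∈ Insert.insert v A, graphSetoid γ u (γ e).1 := by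
        intro u hu
        rcases Finset.mem_insert.1 hu with rfl | hu
        · exact hve
        · exact hle (h4 u hu _ hr)
      intro u hu w hw
      exact (graphSetoid γ).trans (key u hu) ((graphSetoid γ).symm (key w hw))

/-- A connected forest is dismantled leaf by leaf. Removing a leaf moves down a geodesic, so a
forest remains, and contracting the leaf onto its neighbour shows that the rest is still connected.
-/
theorem isMelonicOn_of_facts {A : Finset V} {γ : Perm (Σ v, S v)} (hγ : IsForest γ)
    (hA : A.Nonempty) (hfix : ∀ e : Σ v, S v, e.1 ∉ A → γ e = e)
    (hconn : ∀ u ∈ A, ∀ v ∈ A, graphSetoid γ u v) : IsMelonicOn A γ := by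
  induction hn : permLength γ generalizing A γ with
  | zero =>
    have h1 := permLength_eq_zero hn
    subst h1
    obtain ⟨v, hv⟩ := hA
    have : A = {v} := by
      ext u
      simp only [Finset.mem_singleton]
      constructor
      · intro hu
        exact graphSetoid_eq_of_fixed (fun _ => rfl) (hconn v hv u hu)
      · rintro rfl; exact hv
    rw [this]
    exact IsMelonicOn.single v
  | succ n ih =>
    have hne : γ ≠ 1 := by rintro rfl; simp at hn
    obtain ⟨e, he, hleaf⟩ := hγ.exists_leaf hne
    obtain ⟨v, r⟩ := e
    simp only at hleaf
    have hvA : v ∈ A := by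
      by_contra h0; exact he (hfix ⟨v, r⟩ h0)
    have hfv : (γ ⟨v, r⟩).1 ≠ v := hγ.apply_fst_ne he
    have hγγ : γ (γ ⟨v, r⟩) ≠ γ ⟨v, r⟩ := fun h0 => he (γ.injective h0)
    have hfA : (γ ⟨v, r⟩).1 ∈ A := by
      by_contra h0; exact hγγ (hfix _ h0)
    have hlen := exists_swap_mul he
    have hfor := (hγ.of_precedes (swap_apply_mul_precedes γ ⟨v, r⟩)).1
    have hA' : A = insert v (A.erase v) := (Finset.insert_erase hvA).symm
    rw [hA']
    refine IsMelonicOn.insert _ γ v r (Finset.notMem_erase _ _)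
      (Finset.mem_erase.2 ⟨hfv, hfA⟩) hleaf ?_
    refine ih hfor ⟨_, Finset.mem_erase.2 ⟨hfv, hfA⟩⟩ ?_ ?_ (by omega)
    · intro x hx
      have hxx : γ x = x ∨ x = ⟨v, r⟩ := by
        by_cases hxv : x.1 = v
        · obtain ⟨w, s⟩ := x
          simp only at hxv
          subst hxv
          by_cases hs : s = r
          · right; rw [hs]
          · left; exact hleaf s hs
        · left
          exact hfix x fun h0 => hx (Finset.mem_erase.2 ⟨hxv, h0⟩)
      rcases hxx with h1 | h1
      · rw [Perm.mul_apply, h1, swap_apply_of_ne_of_ne]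
        · rintro rfl; exact he h1
        · intro h2; rw [h2] at h1; exact hγγ h1
      · rw [h1, Perm.mul_apply, swap_apply_right]
    · -- contraction of `v` onto its neighbour
      let π : V → V := fun u => if u = v then (γ ⟨v, r⟩).1 else u
      have hle : graphSetoid γ ≤ (graphSetoid (swap ⟨v, r⟩ (γ ⟨v, r⟩) * γ)).comap π := by
        refine graphSetoid_le_iff.2 fun x => ?_
        change graphSetoid (swap ⟨v, r⟩ (γ ⟨v, r⟩) * γ) (π x.1) (π (γ x).1)
        by_cases h1 : x = ⟨v, r⟩
        · subst h1
          simp only [π, if_true, hfv, if_false]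
          exact (graphSetoid _).refl _
        by_cases h2 : γ x = x
        · rw [h2]
        have hxv : x.1 ≠ v := by
          intro h0
          obtain ⟨w, s⟩ := x
          simp only at h0
          subst h0
          refine h2 (hleaf s fun h3 => h1 (by rw [h3]))
        have h4 := graphSetoid_edge (swap ⟨v, r⟩ (γ ⟨v, r⟩) * γ) x
        rw [Perm.mul_apply] at h4
        simp only [π, hxv, if_false]
        by_cases h3 : γ x = ⟨v, r⟩
        · rw [h3, swap_apply_left] at h4
          rw [h3]
          simpa using h4
        · rw [swap_apply_of_ne_of_ne h3 fun h5 => h1 (γ.injective h5)] at h4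
          have : (γ x).1 ≠ v := by
            intro h0
            rcases hw : γ x with ⟨w, s⟩
            rw [hw] at h0 h3
            simp only at h0
            subst h0
            have h6 := hleaf s fun h7 => h3 (by rw [h7])
            rw [← hw] at h6
            exact h2 (γ.injective h6)
          simpa only [this, if_false] using h4
      intro u hu w hw
      have hu' := Finset.mem_erase.1 hu
      have hw' := Finset.mem_erase.1 hw
      have h5 := hle (hconn u hu'.2 w hw'.2)
      change graphSetoid _ (π u) (π w) at h5
      simpa only [π, hu'.1, hw'.1, if_false] using h5

theorem isMelonic_iff {γ : Perm (Σ v, S v)} : IsMelonic γ ↔ IsForest γ ∧ numComp γ = 1 := by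
  constructor
  · intro h
    obtain ⟨⟨v, _⟩, _, h3, h4⟩ := IsMelonicOn.facts h
    have h5 : numComp γ = 1 := by
      have hs : Subsingleton (GraphComponent γ) := by
        constructor
        rintro ⟨u⟩ ⟨w⟩
        exact Quotient.sound (h4 u (Finset.mem_univ _) w (Finset.mem_univ _))
      exact Nat.card_eq_one_iff_unique.2 ⟨hs, ⟨Quotient.mk _ v⟩⟩
    refine ⟨?_, h5⟩
    rw [IsForest, h5, Nat.card_eq_fintype_card, ← Finset.card_univ, ← h3, add_comm]
  · rintro ⟨h1, h2⟩
    obtain ⟨h3, ⟨v⟩⟩ := Nat.card_eq_one_iff_unique.1 h2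
    refine isMelonicOn_of_facts h1 ⟨v.out, Finset.mem_univ _⟩
      (fun e he => absurd (Finset.mem_univ _) he) fun u _ w _ => ?_
    exact Quotient.exact (h3.elim _ _)

/-- In a connected forest, a geodesic subgraph without isolated thick edges which preserves the
labels shares at least two nontrivial edges with the graph. -/
theorem exists_two_monochromatic_edges {I : Type*} (a : V → I) {g τ : Perm (Σ v, S v)}
    (hg : IsForest g) (hg1 : numComp g = 1) (hV : 2 ≤ Nat.card V) (hτ : Precedes τ g)
    (hiso : ∀ v, ∃ s : S v, τ ⟨v, s⟩ ≠ ⟨v, s⟩) (ha : ∀ e, a (τ e).1 = a e.1) :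
    ∃ e f : Σ v, S v, e ≠ f ∧ (e.1 ≠ (g e).1 ∧ a e.1 = a (g e).1) ∧
      (f.1 ≠ (g f).1 ∧ a f.1 = a (g f).1) := by
  classical
  have h1 := hg.of_precedes hτ
  have hne : g ≠ 1 := by
    rintro rfl
    rw [numComp_one] at hg1; omega
  have h2 := permLength_lt_card_support hne
  have h3 := card_support_le (τ⁻¹ * g)
  -- Every thick edge has a moved slot, and in a forest such a slot leads to another thick edge, so
  -- each component of `τ` contains at least two.
  have h4 : 2 * numComp τ ≤ Nat.card V := by
    have hch : ∀ C : GraphComponent τ, ∃ v, Quotient.mk _ v = C := Quotient.mk_surjective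
    choose rep hrep using hch
    have : ∀ C : GraphComponent τ, ∃ w, w ≠ rep C ∧ Quotient.mk (graphSetoid τ) w = C := by
      intro C
      obtain ⟨s, hs⟩ := hiso (rep C)
      exact ⟨_, h1.1.apply_fst_ne hs, by rw [mk_apply_eq]; exact hrep C⟩
    choose oth hoth1 hoth2 using this
    have hinj : Function.Injective (fun x : GraphComponent τ × Bool =>
        if x.2 then rep x.1 else oth x.1) := by
      rintro ⟨C, b⟩ ⟨C', b'⟩ hxy
      have hq : ∀ x : GraphComponent τ × Bool,
          Quotient.mk (graphSetoid τ) (if x.2 then rep x.1 else oth x.1) = x.1 := by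
        rintro ⟨C, b⟩; cases b
        · exact hoth2 C
        · exact hrep C
      have hC : C = C' := by
        have h5 := hq (C, b)
        have h6 := hq (C', b')
        simp only at hxy h5 h6
        rw [hxy] at h5
        exact h5.symm.trans h6
      subst hC
      cases b <;> cases b' <;> simp_all
      · exact hoth1 C hxy.symm
    have := Nat.card_le_card_of_injective _ hinj
    rw [Nat.card_prod, Nat.card_eq_fintype_card (α := Bool), Fintype.card_bool] at this
    unfold numComp
    omega
  -- Here `|supp g| ≥ |g| + 1 = |V|`, while `|supp (τ⁻¹ * g)| ≤ 2|τ⁻¹ * g| = 2(numComp τ - 1) ≤ |V|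
  -- - 2`. So at least two slots are moved by `g` and sent to the same place by `τ`.
  have h5 : 1 < (g.support \ (τ⁻¹ * g).support).card := by
    have h6 := Finset.le_card_sdiff (τ⁻¹ * g).support g.support
    have h7 := h1.2
    unfold IsForest at hg
    omega
  obtain ⟨e, he, f, hf, hef⟩ := Finset.one_lt_card.1 h5
  have key : ∀ x ∈ g.support \ (τ⁻¹ * g).support, x.1 ≠ (g x).1 ∧ a x.1 = a (g x).1 := by
    intro x hx
    simp only [Finset.mem_sdiff, Perm.mem_support, not_not] at hx
    refine ⟨(hg.apply_fst_ne hx.1).symm, ?_⟩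
    have h8 : g x = τ x := by
      have := hx.2
      rwa [Perm.mul_apply, Perm.inv_eq_iff_eq] at this
    rw [h8, ha]
  exact ⟨e, f, hef, key e he, key f hf⟩

end Graph

end TensorFreeness

end

noncomputable section

namespace TensorFreeness

/-! ### Relabeling and sums of permutations -/

section Relabel

variable {α β : Type} [Fintype α] [DecidableEq α] [Fintype β] [DecidableEq β]

theorem cycleType_permCongr (e : α ≃ β) (σ : Perm α) :
    (e.permCongr σ).cycleType = σ.cycleType := by
  have h : e.permCongr σ =
      σ.extendDomain (e.trans (Equiv.subtypeUnivEquiv (p := fun _ : β => True)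
        (fun _ => trivial)).symm) := by
    ext x
    rw [Perm.extendDomain_apply_subtype _ _ (trivial : (fun _ : β => True) x)]
    simp [Equiv.permCongr_apply, Equiv.subtypeUnivEquiv]
  rw [h, Perm.cycleType_extendDomain]

theorem cycleType_sumCongr (σ : Perm α) (τ : Perm β) :
    (Perm.sumCongr σ τ).cycleType = σ.cycleType + τ.cycleType := by
  classical
  have h1 : Perm.sumCongr σ τ = Perm.sumCongr σ 1 * Perm.sumCongr 1 τ := by
    rw [Perm.sumCongr_mul, mul_one, one_mul]
  have hd : (Perm.sumCongr σ (1 : Perm β)).Disjoint (Perm.sumCongr (1 : Perm α) τ) := by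
    rintro (x | x)
    · right; simp
    · left; simp
  let e₁ : α ≃ {x : α ⊕ β // x.isLeft = true} :=
    { toFun := fun a => ⟨Sum.inl a, rfl⟩
      invFun := fun x => x.1.getLeft x.2
      left_inv := fun a => rfl
      right_inv := fun x => by
        obtain ⟨x | x, hx⟩ := x
        · rfl
        · exact absurd hx (by simp) }
  let e₂ : β ≃ {x : α ⊕ β // x.isRight = true} :=
    { toFun := fun a => ⟨Sum.inr a, rfl⟩
      invFun := fun x => x.1.getRight x.2
      left_inv := fun a => rfl
      right_inv := fun x => by
        obtain ⟨x | x, hx⟩ := x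
        · exact absurd hx (by simp)
        · rfl }
  have h2 : Perm.sumCongr σ (1 : Perm β) = σ.extendDomain e₁ := by
    ext x
    rcases x with x | x
    · exact (Perm.extendDomain_apply_image σ e₁ x).symm
    · rw [Perm.extendDomain_apply_not_subtype _ _ (by simp)]
      rfl
  have h3 : Perm.sumCongr (1 : Perm α) τ = τ.extendDomain e₂ := by
    ext x
    rcases x with x | x
    · rw [Perm.extendDomain_apply_not_subtype _ _ (by simp)]
      rfl
    · exact (Perm.extendDomain_apply_image τ e₂ x).symm
  rw [h1, hd.cycleType_mul, h2, h3, Perm.cycleType_extendDomain, Perm.cycleType_extendDomain]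

omit [Fintype α] [DecidableEq α] [Fintype β] [DecidableEq β] in
theorem permCongr_mul_inv (e : α ≃ β) (τ σ : Perm α) :
    e.permCongr τ * (e.permCongr σ)⁻¹ = e.permCongr (τ * σ⁻¹) :=
  (map_mul_inv e.permCongrHom τ σ).symm

theorem permLength_permCongr (e : α ≃ β) (σ : Perm α) :
    permLength (e.permCongr σ) = permLength σ := by
  rw [permLength, cycleType_permCongr, permLength]

theorem moebius_permCongr (e : α ≃ β) (σ : Perm α) : moebius (e.permCongr σ) = moebius σ := by
  rw [moebius, cycleType_permCongr, moebius]

theorem permLength_sumCongr (σ : Perm α) (τ : Perm β) :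
    permLength (Perm.sumCongr σ τ) = permLength σ + permLength τ := by
  rw [permLength, cycleType_sumCongr, Multiset.map_add, Multiset.sum_add, permLength, permLength]

theorem moebius_sumCongr (σ : Perm α) (τ : Perm β) :
    moebius (Perm.sumCongr σ τ) = moebius σ * moebius τ := by
  rw [moebius, cycleType_sumCongr, Multiset.map_add, Multiset.prod_add, moebius, moebius]

theorem precedes_permCongr (e : α ≃ β) (σ τ : Perm α) :
    Precedes (e.permCongr τ) (e.permCongr σ) ↔ Precedes τ σ := by
  simp only [Precedes, permCongr_mul_inv, permLength_permCongr]

theorem precedes_sumCongr (σ₁ τ₁ : Perm α) (σ₂ τ₂ : Perm β) :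
    Precedes (Perm.sumCongr τ₁ τ₂) (Perm.sumCongr σ₁ σ₂) ↔
      Precedes τ₁ σ₁ ∧ Precedes τ₂ σ₂ := by
  simp only [precedes_iff, Perm.sumCongr_inv, Perm.sumCongr_mul, permLength_sumCongr]
  have h1 := permLength_mul_le τ₁ (τ₁⁻¹ * σ₁)
  have h2 := permLength_mul_le τ₂ (τ₂⁻¹ * σ₂)
  rw [mul_inv_cancel_left] at h1 h2
  omega

end Relabel

/-! ### Restrictions of graphs along injections -/

section Restriction

variable {U V : Type} {S : V → Type}

/-- The map of slots induced by a map of thick edges. -/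
def slotMap (ι : U → V) (e : Σ u, S (ι u)) : Σ v, S v := ⟨ι e.1, e.2⟩

/-- `δ` is the restriction of `γ` along `ι`. -/
def IsRestriction (ι : U → V) (δ : Perm (Σ u, S (ι u))) (γ : Perm (Σ v, S v)) : Prop :=
  ∀ e, γ (slotMap ι e) = slotMap ι (δ e)

theorem slotMap_injective {ι : U → V} (hι : Function.Injective ι) :
    Function.Injective (slotMap (S := S) ι) := by
  rintro ⟨u, s⟩ ⟨u', s'⟩ h
  have h1 : ι u = ι u' := congrArg Sigma.fst h
  obtain rfl := hι h1
  simp only [slotMap, Sigma.mk.injEq, heq_eq_eq, true_and] at h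
  rw [h]

theorem slotMap_surjective {ι : U → V} (hι : Function.Surjective ι) :
    Function.Surjective (slotMap (S := S) ι) := by
  rintro ⟨v, s⟩
  obtain ⟨u, rfl⟩ := hι v
  exact ⟨⟨u, s⟩, rfl⟩

theorem slotMap_bijective {ι : U → V} (hι : Function.Bijective ι) :
    Function.Bijective (slotMap (S := S) ι) :=
  ⟨slotMap_injective hι.1, slotMap_surjective hι.2⟩

theorem IsRestriction.symm_apply {ι : U → V} {δ : Perm (Σ u, S (ι u))} {γ : Perm (Σ v, S v)}
    (h : IsRestriction ι δ γ) (e : Σ u, S (ι u)) :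
    γ.symm (slotMap ι e) = slotMap ι (δ.symm e) := by
  rw [Equiv.symm_apply_eq, h, Equiv.apply_symm_apply]

theorem IsRestriction.unique {ι : U → V} (hι : Function.Injective ι)
    {δ δ' : Perm (Σ u, S (ι u))} {γ : Perm (Σ v, S v)}
    (h : IsRestriction ι δ γ) (h' : IsRestriction ι δ' γ) : δ = δ' := by
  ext1 e
  exact slotMap_injective hι ((h e).symm.trans (h' e))

theorem graphRestrict_isRestriction (γ : Perm (Σ v, S v)) (C : GraphComponent γ) :
    IsRestriction Subtype.val (graphRestrict γ C) γ := fun _ => rfl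

theorem exists_isRestriction (γ : Perm (Σ v, S v)) (p : V → Prop)
    (hp : ∀ e, p (γ e).1 ↔ p e.1) :
    ∃ δ : Perm (Σ v : {v // p v}, S v.1), IsRestriction Subtype.val δ γ :=
  ⟨(subtypeSigmaEquiv S p).permCongr (γ.subtypePerm fun e => hp e), fun _ => rfl⟩

/-- The image of `ι` is stable under `γ`, so a path of `γ` between two of its points never leaves
it. In the proof, `Q v` is the `δ`-component of the preimage of `v`, which is constant along edges
of `γ`. -/
theorem IsRestriction.setoid_iff {ι : U → V} (hι : Function.Injective ι)
    {δ : Perm (Σ u, S (ι u))} {γ : Perm (Σ v, S v)} (h : IsRestriction ι δ γ) (u u' : U) :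
    graphSetoid δ u u' ↔ graphSetoid γ (ι u) (ι u') := by
  classical
  constructor
  · intro h1
    have : graphSetoid δ ≤ (graphSetoid γ).comap ι := graphSetoid_le_iff.2 fun e => by
      have h2 := graphSetoid_edge γ (slotMap ι e)
      rw [h] at h2
      exact h2
    exact this h1
  · intro h1
    let Q : V → Set U := fun v => {w | ∃ u, ι u = v ∧ graphSetoid δ u w}
    have : graphSetoid γ ≤ Setoid.ker Q := graphSetoid_le_iff.2 fun e => by
      change Q e.1 = Q (γ e).1
      ext w
      constructor
      · rintro ⟨u, hu, huw⟩
        obtain ⟨v, s⟩ := e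
        simp only at hu
        subst hu
        refine ⟨(δ ⟨u, s⟩).1, ?_, (graphSetoid δ).trans
          ((graphSetoid δ).symm (graphSetoid_edge δ ⟨u, s⟩)) huw⟩
        exact (congrArg Sigma.fst (h ⟨u, s⟩)).symm
      · rintro ⟨u, hu, huw⟩
        rcases hx : γ e with ⟨v, s⟩
        rw [hx] at hu
        simp only at hu
        subst hu
        have h2 : e = slotMap ι (δ.symm ⟨u, s⟩) := by
          rw [← h.symm_apply]
          exact (Equiv.eq_symm_apply γ).2 hx
        refine ⟨(δ.symm ⟨u, s⟩).1, by rw [h2]; rfl, ?_⟩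
        have h3 := graphSetoid_edge δ (δ.symm ⟨u, s⟩)
        rw [Equiv.apply_symm_apply] at h3
        exact (graphSetoid δ).trans h3 huw
    have h2 : Q (ι u) = Q (ι u') := this h1
    have h3 : u' ∈ Q (ι u') := ⟨u', rfl, (graphSetoid δ).refl _⟩
    rw [← h2] at h3
    obtain ⟨w, hw, hwu⟩ := h3
    rwa [hι hw] at hwu

theorem IsRestriction.mem_range {ι : U → V} {δ : Perm (Σ u, S (ι u))} {γ : Perm (Σ v, S v)}
    (h : IsRestriction ι δ γ) {v w : V} (hvw : graphSetoid γ v w) :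
    v ∈ Set.range ι ↔ w ∈ Set.range ι := by
  have : graphSetoid γ ≤ Setoid.ker (fun v => v ∈ Set.range ι) := graphSetoid_le_iff.2 fun e => by
    change (e.1 ∈ Set.range ι) = ((γ e).1 ∈ Set.range ι)
    apply propext
    constructor
    · rintro ⟨u, hu⟩
      obtain ⟨v, s⟩ := e
      simp only at hu
      subst hu
      exact ⟨(δ ⟨u, s⟩).1, (congrArg Sigma.fst (h ⟨u, s⟩)).symm⟩
    · rintro ⟨u, hu⟩
      rcases hx : γ e with ⟨v, s⟩
      rw [hx] at hu
      simp only at hu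
      subst hu
      have h2 : e = slotMap ι (δ.symm ⟨u, s⟩) := by
        rw [← h.symm_apply]
        exact (Equiv.eq_symm_apply γ).2 hx
      exact ⟨(δ.symm ⟨u, s⟩).1, by rw [h2]; rfl⟩
  exact (this hvw).to_iff

/-- The map of components induced by a restriction. -/
def IsRestriction.compMap {ι : U → V} (hι : Function.Injective ι) {δ : Perm (Σ u, S (ι u))}
    {γ : Perm (Σ v, S v)} (h : IsRestriction ι δ γ) : GraphComponent δ → GraphComponent γ :=
  Quotient.map ι fun u u' => (h.setoid_iff hι u u').1

theorem IsRestriction.compMap_injective {ι : U → V} (hι : Function.Injective ι)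
    {δ : Perm (Σ u, S (ι u))} {γ : Perm (Σ v, S v)} (h : IsRestriction ι δ γ) :
    Function.Injective (h.compMap hι) := by
  rintro ⟨u⟩ ⟨u'⟩ huu
  exact Quotient.sound ((h.setoid_iff hι u u').2 (Quotient.exact huu))

theorem IsRestriction.compMap_bijective {ι : U → V} (hι : Function.Bijective ι)
    {δ : Perm (Σ u, S (ι u))} {γ : Perm (Σ v, S v)} (h : IsRestriction ι δ γ) :
    Function.Bijective (h.compMap hι.1) := by
  refine ⟨h.compMap_injective hι.1, ?_⟩
  rintro ⟨v⟩
  obtain ⟨u, rfl⟩ := hι.2 v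
  exact ⟨Quotient.mk _ u, rfl⟩

theorem numComp_eq_of_isRestriction {ι : U → V} (hι : Function.Bijective ι)
    {δ : Perm (Σ u, S (ι u))} {γ : Perm (Σ v, S v)} (h : IsRestriction ι δ γ) :
    numComp δ = numComp γ := Nat.card_eq_of_bijective _ (h.compMap_bijective hι)

theorem permCongr_of_isRestriction {ι : U → V} (hι : Function.Bijective ι)
    {δ : Perm (Σ u, S (ι u))} {γ : Perm (Σ v, S v)} (h : IsRestriction ι δ γ) :
    (Equiv.ofBijective _ (slotMap_bijective hι)).permCongr δ = γ := by
  ext1 x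
  obtain ⟨e, rfl⟩ := (Equiv.ofBijective _ (slotMap_bijective (S := S) hι)).surjective x
  rw [Equiv.permCongr_apply, Equiv.symm_apply_apply]
  exact (h e).symm

theorem isRestriction_permCongr {ι : U → V} (hι : Function.Bijective ι)
    (δ : Perm (Σ u, S (ι u))) :
    IsRestriction ι δ ((Equiv.ofBijective _ (slotMap_bijective hι)).permCongr δ) := by
  intro e
  rw [Equiv.permCongr_apply]
  change Equiv.ofBijective _ (slotMap_bijective hι) (δ ((Equiv.ofBijective _ (slotMap_bijective hι)).symm
    (Equiv.ofBijective _ (slotMap_bijective hι) e))) = _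
  rw [Equiv.symm_apply_apply]
  rfl

variable [Fintype U] [DecidableEq U] [Fintype V] [DecidableEq V]
  [∀ v, Fintype (S v)] [∀ v, DecidableEq (S v)]

theorem permLength_eq_of_isRestriction {ι : U → V} (hι : Function.Bijective ι)
    {δ : Perm (Σ u, S (ι u))} {γ : Perm (Σ v, S v)} (h : IsRestriction ι δ γ) :
    permLength δ = permLength γ := by
  rw [← permCongr_of_isRestriction hι h, permLength_permCongr]

theorem isForest_iff_of_isRestriction {ι : U → V} (hι : Function.Bijective ι)
    {δ : Perm (Σ u, S (ι u))} {γ : Perm (Σ v, S v)} (h : IsRestriction ι δ γ) :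
    IsForest δ ↔ IsForest γ := by
  unfold IsForest
  rw [permLength_eq_of_isRestriction hι h, numComp_eq_of_isRestriction hι h,
    Nat.card_eq_of_bijective ι hι]

theorem isMelonic_iff_of_isRestriction {ι : U → V} (hι : Function.Bijective ι)
    {δ : Perm (Σ u, S (ι u))} {γ : Perm (Σ v, S v)} (h : IsRestriction ι δ γ) :
    IsMelonic δ ↔ IsMelonic γ := by
  rw [isMelonic_iff, isMelonic_iff, isForest_iff_of_isRestriction hι h,
    numComp_eq_of_isRestriction hι h]

theorem pairedTrace_eq_of_isRestriction {N : ℕ} {ι : U → V} (hι : Function.Bijective ι)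
    {δ : Perm (Σ u, S (ι u))} {γ : Perm (Σ v, S v)} (h : IsRestriction ι δ γ)
    (P : ∀ v, (S v → Fin N) → (S v → Fin N) → ℂ) :
    pairedTrace δ (fun u => P (ι u)) = pairedTrace γ P := by
  unfold pairedTrace
  refine (Fintype.sum_equiv (Equiv.arrowCongr (Equiv.ofBijective _ (slotMap_bijective hι)).symm
    (Equiv.refl _)) _ _ fun i => ?_).symm
  rw [← (Equiv.ofBijective ι hι).prod_comp]
  refine Finset.prod_congr rfl fun u _ => ?_
  change P (ι u) _ _ = P (ι u) _ _
  congr 1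
  funext s
  exact congrArg i (h.symm_apply ⟨u, s⟩)

end Restriction

/-! ### Splitting a graph into two unions of components -/

section Split

variable {V : Type} {S : V → Type}

/-- The slots of `V` split along a predicate. -/
def slotSum (p : V → Prop) :
    ((Σ v : {v // p v}, S v.1) ⊕ (Σ v : {v // ¬ p v}, S v.1)) → Σ v, S v :=
  Sum.elim (slotMap Subtype.val) (slotMap Subtype.val)

theorem slotSum_bijective (p : V → Prop) : Function.Bijective (slotSum (S := S) p) := by
  classical
  constructor
  · rintro (x | x) (y | y) h
    · exact congrArg _ (slotMap_injective Subtype.val_injective h)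
    · have h1 : x.1.1 = y.1.1 := congrArg Sigma.fst h
      exact absurd x.1.2 (h1 ▸ y.1.2)
    · have h1 : x.1.1 = y.1.1 := congrArg Sigma.fst h
      exact absurd y.1.2 (h1 ▸ x.1.2)
    · exact congrArg _ (slotMap_injective Subtype.val_injective h)
  · rintro ⟨v, s⟩
    by_cases hv : p v
    · exact ⟨Sum.inl ⟨⟨v, hv⟩, s⟩, rfl⟩
    · exact ⟨Sum.inr ⟨⟨v, hv⟩, s⟩, rfl⟩

/-- The graph with prescribed restrictions. -/
def joinPerm (p : V → Prop) (δ₁ : Perm (Σ v : {v // p v}, S v.1))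
    (δ₂ : Perm (Σ v : {v // ¬ p v}, S v.1)) : Perm (Σ v, S v) :=
  (Equiv.ofBijective _ (slotSum_bijective p)).permCongr (Perm.sumCongr δ₁ δ₂)

theorem joinPerm_inl (p : V → Prop) (δ₁ : Perm (Σ v : {v // p v}, S v.1))
    (δ₂ : Perm (Σ v : {v // ¬ p v}, S v.1)) :
    IsRestriction Subtype.val δ₁ (joinPerm p δ₁ δ₂) := by
  intro e
  have : slotMap Subtype.val e = Equiv.ofBijective _ (slotSum_bijective (S := S) p) (Sum.inl e) :=
    rfl
  rw [joinPerm, Equiv.permCongr_apply, this, Equiv.symm_apply_apply]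
  rfl

theorem joinPerm_inr (p : V → Prop) (δ₁ : Perm (Σ v : {v // p v}, S v.1))
    (δ₂ : Perm (Σ v : {v // ¬ p v}, S v.1)) :
    IsRestriction Subtype.val δ₂ (joinPerm p δ₁ δ₂) := by
  intro e
  have : slotMap Subtype.val e = Equiv.ofBijective _ (slotSum_bijective (S := S) p) (Sum.inr e) :=
    rfl
  rw [joinPerm, Equiv.permCongr_apply, this, Equiv.symm_apply_apply]
  rfl

theorem eq_joinPerm {p : V → Prop} {δ₁ : Perm (Σ v : {v // p v}, S v.1)}
    {δ₂ : Perm (Σ v : {v // ¬ p v}, S v.1)} {γ : Perm (Σ v, S v)}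
    (h₁ : IsRestriction Subtype.val δ₁ γ) (h₂ : IsRestriction Subtype.val δ₂ γ) :
    γ = joinPerm p δ₁ δ₂ := by
  ext1 x
  obtain ⟨e, rfl⟩ := (slotSum_bijective p).2 x
  rcases e with e | e
  · exact (h₁ e).trans (joinPerm_inl p δ₁ δ₂ e).symm
  · exact (h₂ e).trans (joinPerm_inr p δ₁ δ₂ e).symm

/-- Kept as a bijection rather than an equality of numbers, because products over components are
split along it too. -/
theorem numComp_split [Finite V] {p : V → Prop} {δ₁ : Perm (Σ v : {v // p v}, S v.1)}
    {δ₂ : Perm (Σ v : {v // ¬ p v}, S v.1)} {γ : Perm (Σ v, S v)}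
    (h₁ : IsRestriction Subtype.val δ₁ γ) (h₂ : IsRestriction Subtype.val δ₂ γ) :
    Function.Bijective (Sum.elim (h₁.compMap Subtype.val_injective)
      (h₂.compMap Subtype.val_injective)) := by
  constructor
  · rintro (x | x) (y | y) h
    · exact congrArg _ (h₁.compMap_injective Subtype.val_injective h)
    · revert h
      refine Quotient.inductionOn₂ x y fun u w h => ?_
      have h3 := (h₁.mem_range (Quotient.exact h)).1 ⟨u, rfl⟩
      obtain ⟨z, hz⟩ := h3
      exact absurd z.2 (hz ▸ w.2)
    · revert h
      refine Quotient.inductionOn₂ x y fun u w h => ?_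
      have h3 := (h₂.mem_range (Quotient.exact h)).1 ⟨u, rfl⟩
      obtain ⟨z, hz⟩ := h3
      exact absurd w.2 (hz ▸ z.2)
    · exact congrArg _ (h₂.compMap_injective Subtype.val_injective h)
  · rintro ⟨v⟩
    by_cases hv : p v
    · exact ⟨Sum.inl (Quotient.mk _ ⟨v, hv⟩), rfl⟩
    · exact ⟨Sum.inr (Quotient.mk _ ⟨v, hv⟩), rfl⟩

variable [Fintype V] [DecidableEq V] [∀ v, Fintype (S v)] [∀ v, DecidableEq (S v)]

theorem permLength_joinPerm (p : V → Prop) [DecidablePred p]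
    (δ₁ : Perm (Σ v : {v // p v}, S v.1)) (δ₂ : Perm (Σ v : {v // ¬ p v}, S v.1)) :
    permLength (joinPerm p δ₁ δ₂) = permLength δ₁ + permLength δ₂ := by
  rw [joinPerm, permLength_permCongr, permLength_sumCongr]

theorem joinPerm_mul_inv (p : V → Prop)
    (δ₁ δ₁' : Perm (Σ v : {v // p v}, S v.1)) (δ₂ δ₂' : Perm (Σ v : {v // ¬ p v}, S v.1)) :
    joinPerm p δ₁ δ₂ * (joinPerm p δ₁' δ₂')⁻¹ = joinPerm p (δ₁ * δ₁'⁻¹) (δ₂ * δ₂'⁻¹) := by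
  rw [joinPerm, joinPerm, permCongr_mul_inv, joinPerm, Perm.sumCongr_inv, Perm.sumCongr_mul]

theorem moebius_joinPerm (p : V → Prop) [DecidablePred p]
    (δ₁ : Perm (Σ v : {v // p v}, S v.1)) (δ₂ : Perm (Σ v : {v // ¬ p v}, S v.1)) :
    moebius (joinPerm p δ₁ δ₂) = moebius δ₁ * moebius δ₂ := by
  rw [joinPerm, moebius_permCongr, moebius_sumCongr]

theorem precedes_joinPerm (p : V → Prop) [DecidablePred p]
    (δ₁ τ₁ : Perm (Σ v : {v // p v}, S v.1)) (δ₂ τ₂ : Perm (Σ v : {v // ¬ p v}, S v.1)) :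
    Precedes (joinPerm p τ₁ τ₂) (joinPerm p δ₁ δ₂) ↔ Precedes τ₁ δ₁ ∧ Precedes τ₂ δ₂ := by
  rw [joinPerm, joinPerm, precedes_permCongr, precedes_sumCongr]

/-- The number of thick edges, the number of components and the length are additive over the two
parts, and each part obeys the Euler bound; equality for the sum forces equality in each. -/
theorem IsForest.restriction {p : V → Prop} [DecidablePred p] {γ : Perm (Σ v, S v)}
    (hγ : IsForest γ) {δ₁ : Perm (Σ v : {v // p v}, S v.1)}
    (h₁ : IsRestriction Subtype.val δ₁ γ) : IsForest δ₁ := by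
  obtain ⟨δ₂, h₂⟩ := exists_isRestriction γ (fun v => ¬ p v) (fun e => by
    have h := h₁.mem_range (graphSetoid_edge γ e)
    simp only [Subtype.range_coe_subtype, Set.mem_ofPred_eq] at h
    rw [h])
  have e1 := Nat.card_eq_of_bijective _ (numComp_split h₁ h₂)
  rw [Nat.card_sum] at e1
  have e2 : permLength γ = permLength δ₁ + permLength δ₂ := by
    rw [eq_joinPerm h₁ h₂, permLength_joinPerm]
  have e3 := card_le_numComp_add δ₁
  have e4 := card_le_numComp_add δ₂
  have e5 : Nat.card V = Nat.card {v // p v} + Nat.card {v // ¬ p v} := by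
    rw [← Nat.card_sum]
    exact (Nat.card_congr (Equiv.sumCompl p)).symm
  unfold IsForest at hγ ⊢
  unfold numComp at *
  omega

omit [Fintype V] [DecidableEq V] [∀ v, Fintype (S v)] [∀ v, DecidableEq (S v)] in
theorem numComp_graphRestrict (γ : Perm (Σ v, S v)) (C : GraphComponent γ) :
    numComp (graphRestrict γ C) = 1 := by
  refine Nat.card_eq_one_iff_unique.2 ⟨⟨?_⟩, ?_⟩
  · rintro ⟨u⟩ ⟨w⟩
    refine Quotient.sound (((graphRestrict_isRestriction γ C).setoid_iff
      Subtype.val_injective u w).2 (Quotient.exact (u.2.trans w.2.symm)))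
  · exact ⟨Quotient.mk _ ⟨C.out, Quotient.out_eq C⟩⟩

end Split

end TensorFreeness

end

noncomputable section

namespace TensorFreeness

/-! ### Multiplicativity of moments and free cumulants of paired tensors -/

namespace PureTensorFamily

variable {D : ℕ} {I : Type*} (F : PureTensorFamily D I)

section

variable {U V : Type} {S : V → Type} [Fintype U] [Fintype V] [∀ v, Fintype (S v)]

theorem rescaledPairedMoment_eq_of_isRestriction {ι : U → V} (hι : Function.Bijective ι)
    {δ : Perm (Σ u, S (ι u))} {γ : Perm (Σ v, S v)} (h : IsRestriction ι δ γ)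
    (H : ∀ v, F.RandomPaired (S v)) :
    F.rescaledPairedMoment δ (fun u => H (ι u)) = F.rescaledPairedMoment γ H := by
  classical
  funext N
  unfold rescaledPairedMoment
  congr 2
  funext ω
  exact pairedTrace_eq_of_isRestriction hι h (fun v => H v N ω)

theorem pairedMoment_eq_of_isRestriction {ι : U → V} (hι : Function.Bijective ι)
    {δ : Perm (Σ u, S (ι u))} {γ : Perm (Σ v, S v)} (h : IsRestriction ι δ γ)
    (H : ∀ v, F.RandomPaired (S v)) :
    F.pairedMoment δ (fun u => H (ι u)) = F.pairedMoment γ H := by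
  unfold pairedMoment
  rw [F.rescaledPairedMoment_eq_of_isRestriction hι h]

end

end PureTensorFamily

section

variable {U V : Type} {S : V → Type}

/-- The map of the thick edges of a component induced by a restriction. -/
def IsRestriction.thickMap {ι : U → V} (hι : Function.Injective ι)
    {δ : Perm (Σ u, S (ι u))} {γ : Perm (Σ v, S v)} (h : IsRestriction ι δ γ)
    (C : GraphComponent δ) (u : Thick δ C) : Thick γ (h.compMap hι C) :=
  ⟨ι u.1, congrArg (h.compMap hι) u.2⟩

theorem IsRestriction.thickMap_bijective {ι : U → V} (hι : Function.Injective ι)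
    {δ : Perm (Σ u, S (ι u))} {γ : Perm (Σ v, S v)} (h : IsRestriction ι δ γ)
    (C : GraphComponent δ) : Function.Bijective (h.thickMap hι C) := by
  constructor
  · intro u u' huu
    exact Subtype.ext (hι (congrArg Subtype.val huu))
  · rintro ⟨v, hv⟩
    revert hv
    refine Quotient.inductionOn C fun u hv => ?_
    have h1 := Quotient.exact hv
    obtain ⟨w, rfl⟩ := (h.mem_range ((graphSetoid γ).symm h1)).1 ⟨u, rfl⟩
    exact ⟨⟨w, Quotient.sound ((h.setoid_iff hι w u).2 h1)⟩, rfl⟩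

theorem IsRestriction.graphRestrict {ι : U → V} (hι : Function.Injective ι)
    {δ : Perm (Σ u, S (ι u))} {γ : Perm (Σ v, S v)} (h : IsRestriction ι δ γ)
    (C : GraphComponent δ) :
    IsRestriction (S := fun v : Thick γ (h.compMap hι C) => S v.1) (h.thickMap hι C)
      (graphRestrict δ C) (graphRestrict γ (h.compMap hι C)) := by
  intro e
  apply slotMap_injective Subtype.val_injective
  exact h (slotMap Subtype.val e)

end

namespace PureTensorFamily

variable {D : ℕ} {I : Type*} (F : PureTensorFamily D I)

section

variable {U V : Type} {S : V → Type} [Fintype U] [Fintype V] [∀ v, Fintype (S v)]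

theorem pairedMoment_graphRestrict_of_isRestriction {ι : U → V} (hι : Function.Injective ι)
    {δ : Perm (Σ u, S (ι u))} {γ : Perm (Σ v, S v)} (h : IsRestriction ι δ γ)
    (H : ∀ v, F.RandomPaired (S v)) (C : GraphComponent δ) :
    F.pairedMoment (graphRestrict δ C) (fun u => H (ι u.1)) =
      F.pairedMoment (graphRestrict γ (h.compMap hι C)) (fun v => H v.1) :=
  F.pairedMoment_eq_of_isRestriction (h.thickMap_bijective hι C) (h.graphRestrict hι C)
    (fun v => H v.1)

theorem pairedMomentMul_eq_prod {ι : U → V} (hι : Function.Injective ι)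
    {δ : Perm (Σ u, S (ι u))} {γ : Perm (Σ v, S v)} (h : IsRestriction ι δ γ)
    (H : ∀ v, F.RandomPaired (S v)) :
    F.pairedMomentMul δ (fun u => H (ι u)) =
      ∏ C : GraphComponent δ,
        F.pairedMoment (graphRestrict γ (h.compMap hι C)) (fun v => H v.1) :=
  Finset.prod_congr rfl fun C _ => F.pairedMoment_graphRestrict_of_isRestriction hι h H C

theorem pairedMomentMul_eq_of_isRestriction {ι : U → V} (hι : Function.Bijective ι)
    {δ : Perm (Σ u, S (ι u))} {γ : Perm (Σ v, S v)} (h : IsRestriction ι δ γ)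
    (H : ∀ v, F.RandomPaired (S v)) :
    F.pairedMomentMul δ (fun u => H (ι u)) = F.pairedMomentMul γ H := by
  rw [F.pairedMomentMul_eq_prod hι.1 h]
  exact Fintype.prod_bijective _ (h.compMap_bijective hι) _ _ fun _ => rfl

theorem pairedMomentMul_split {p : V → Prop} [Fintype {v // p v}] [Fintype {v // ¬ p v}]
    {δ₁ : Perm (Σ v : {v // p v}, S v.1)}
    {δ₂ : Perm (Σ v : {v // ¬ p v}, S v.1)} {γ : Perm (Σ v, S v)}
    (h₁ : IsRestriction Subtype.val δ₁ γ) (h₂ : IsRestriction Subtype.val δ₂ γ)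
    (H : ∀ v, F.RandomPaired (S v)) :
    F.pairedMomentMul γ H =
      F.pairedMomentMul δ₁ (fun v => H v.1) * F.pairedMomentMul δ₂ (fun v => H v.1) := by
  rw [F.pairedMomentMul_eq_prod Subtype.val_injective h₁,
    F.pairedMomentMul_eq_prod Subtype.val_injective h₂, ← Fintype.prod_sumElim]
  refine (Fintype.prod_bijective _ (numComp_split h₁ h₂) _ _ fun x => ?_).symm
  rcases x with x | x <;> rfl

theorem pairedMomentMul_of_connected {γ : Perm (Σ v, S v)} (hγ : numComp γ = 1)
    (H : ∀ v, F.RandomPaired (S v)) : F.pairedMomentMul γ H = F.pairedMoment γ H := by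
  obtain ⟨h1, ⟨C⟩⟩ := Nat.card_eq_one_iff_unique.1 hγ
  have : Unique (GraphComponent γ) := ⟨⟨C⟩, fun x => h1.elim _ _⟩
  unfold pairedMomentMul
  rw [Fintype.prod_unique]
  have hb : Function.Bijective (Subtype.val : Thick γ default → V) :=
    ⟨Subtype.val_injective, fun v => ⟨⟨v, h1.elim _ _⟩, rfl⟩⟩
  exact F.pairedMoment_eq_of_isRestriction hb (graphRestrict_isRestriction γ default) H

theorem pairedCumulant_eq_moebiusTransform [DecidableEq (Σ v, S v)] (γ : Perm (Σ v, S v))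
    (H : ∀ v, F.RandomPaired (S v)) :
    F.pairedCumulant γ H = moebiusTransform (fun τ => F.pairedMomentMul τ H) γ := by
  classical
  unfold pairedCumulant moebiusTransform
  convert rfl

theorem pairedCumulant_eq_of_isRestriction {ι : U → V} (hι : Function.Bijective ι)
    {δ : Perm (Σ u, S (ι u))} {γ : Perm (Σ v, S v)} (h : IsRestriction ι δ γ)
    (H : ∀ v, F.RandomPaired (S v)) :
    F.pairedCumulant δ (fun u => H (ι u)) = F.pairedCumulant γ H := by
  classical
  rw [pairedCumulant_eq_moebiusTransform, pairedCumulant_eq_moebiusTransform]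
  unfold moebiusTransform
  refine Finset.sum_equiv (Equiv.ofBijective _ (slotMap_bijective hι)).permCongr ?_ ?_
  · intro τ
    simp only [Finset.mem_filter, Finset.mem_univ, true_and]
    rw [← permCongr_of_isRestriction hι h, precedes_permCongr]
  · intro τ _
    rw [← permCongr_of_isRestriction hι h, permCongr_mul_inv, moebius_permCongr]
    exact congrArg (· * _)
      (F.pairedMomentMul_eq_of_isRestriction hι (isRestriction_permCongr hι τ) H)

/-- By `Precedes.comp_eq`, no `τ ⪯ γ` joins the two parts, so the interval below `γ` is a product of
intervals, and moments and Möbius weights multiply. -/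
theorem pairedCumulant_split {p : V → Prop} [Fintype {v // p v}] [Fintype {v // ¬ p v}]
    {δ₁ : Perm (Σ v : {v // p v}, S v.1)}
    {δ₂ : Perm (Σ v : {v // ¬ p v}, S v.1)} {γ : Perm (Σ v, S v)}
    (h₁ : IsRestriction Subtype.val δ₁ γ) (h₂ : IsRestriction Subtype.val δ₂ γ)
    (H : ∀ v, F.RandomPaired (S v)) :
    F.pairedCumulant γ H =
      F.pairedCumulant δ₁ (fun v => H v.1) * F.pairedCumulant δ₂ (fun v => H v.1) := by
  classical
  simp only [pairedCumulant_eq_moebiusTransform]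
  unfold moebiusTransform
  rw [Finset.sum_mul_sum, ← Finset.sum_product']
  symm
  refine Finset.sum_bij (fun x _ => joinPerm p x.1 x.2) ?_ ?_ ?_ ?_
  · rintro ⟨τ₁, τ₂⟩ hx
    simp only [Finset.mem_product, Finset.mem_filter, Finset.mem_univ, true_and] at hx ⊢
    rw [eq_joinPerm h₁ h₂]
    have := (precedes_joinPerm p δ₁ τ₁ δ₂ τ₂).2
    convert this _
    convert hx
  · rintro ⟨τ₁, τ₂⟩ _ ⟨τ₁', τ₂'⟩ _ hxy
    simp only at hxy
    have e1 := joinPerm_inl p τ₁ τ₂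
    rw [hxy] at e1
    have e2 := joinPerm_inr p τ₁ τ₂
    rw [hxy] at e2
    rw [e1.unique Subtype.val_injective (joinPerm_inl p τ₁' τ₂'),
      e2.unique Subtype.val_injective (joinPerm_inr p τ₁' τ₂')]
  · intro τ hτ
    simp only [Finset.mem_filter, Finset.mem_univ, true_and] at hτ
    have hp : ∀ e, p (τ e).1 = p e.1 := hτ.comp_eq (a := fun e => p e.1) fun e => by
      have h := h₁.mem_range (graphSetoid_edge γ e)
      simp only [Subtype.range_coe_subtype, Set.mem_ofPred_eq] at h
      exact propext h.symm
    obtain ⟨τ₁, t₁⟩ := exists_isRestriction τ p fun e => (hp e).to_iff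
    obtain ⟨τ₂, t₂⟩ := exists_isRestriction τ (fun v => ¬ p v) fun e => by rw [hp e]
    have e := eq_joinPerm t₁ t₂
    rw [e, eq_joinPerm h₁ h₂] at hτ
    have := (precedes_joinPerm p δ₁ τ₁ δ₂ τ₂).1 (by convert hτ)
    refine ⟨(τ₁, τ₂), ?_, e.symm⟩
    simp only [Finset.mem_product, Finset.mem_filter, Finset.mem_univ, true_and]
    convert this
  · rintro ⟨τ₁, τ₂⟩ _
    simp only
    rw [F.pairedMomentMul_split (joinPerm_inl p τ₁ τ₂) (joinPerm_inr p τ₁ τ₂) H,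
      eq_joinPerm h₁ h₂, joinPerm_mul_inv]
    have := moebius_joinPerm p (τ₁ * δ₁⁻¹) (τ₂ * δ₂⁻¹)
    have e : moebius (joinPerm p (τ₁ * δ₁⁻¹) (τ₂ * δ₂⁻¹)) =
        moebius (τ₁ * δ₁⁻¹) * moebius (τ₂ * δ₂⁻¹) := by convert this
    rw [e]; ring

/-- Free cumulants vanish as soon as the cumulant of a component vanishes. -/
theorem pairedCumulant_eq_zero (γ : Perm (Σ v, S v)) (H : ∀ v, F.RandomPaired (S v))
    (C : GraphComponent γ) (h : F.pairedCumulant (graphRestrict γ C) (fun v => H v.1) = 0) :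
    F.pairedCumulant γ H = 0 := by
  classical
  obtain ⟨δ₂, h₂⟩ := exists_isRestriction γ
    (fun v => ¬ (Quotient.mk (graphSetoid γ) v : GraphComponent γ) = C)
    (fun e => by rw [mk_apply_eq])
  rw [F.pairedCumulant_split (graphRestrict_isRestriction γ C) h₂, h, zero_mul]

end

end PureTensorFamily

end TensorFreeness

end

noncomputable section

namespace TensorFreeness

/-! ### Tuples of permutations as graphs -/

section Tuple

variable {D : ℕ} {V : Type}

/-- The graph of a tuple of permutations of an arbitrary type. -/
def tupleGraphOn (σ : Fin D → Perm V) : Perm (Σ _ : V, Fin D) where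
  toFun e := ⟨σ e.2 e.1, e.2⟩
  invFun e := ⟨(σ e.2).symm e.1, e.2⟩
  left_inv e := by simp
  right_inv e := by simp

theorem tupleGraph_eq {n : ℕ} (σ : Fin D → Perm (Fin n)) : tupleGraph σ = tupleGraphOn σ := rfl

theorem tupleGraphOn_apply (σ : Fin D → Perm V) (v : V) (c : Fin D) :
    tupleGraphOn σ ⟨v, c⟩ = ⟨σ c v, c⟩ := rfl

theorem tupleGraphOn_injective : Function.Injective (tupleGraphOn (D := D) (V := V)) := by
  intro σ τ h
  funext c
  ext1 v
  have := congrArg (fun γ : Perm (Σ _ : V, Fin D) => (γ ⟨v, c⟩).1) h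
  exact this

theorem tupleGraphOn_mul (σ τ : Fin D → Perm V) :
    tupleGraphOn σ * tupleGraphOn τ = tupleGraphOn (fun c => σ c * τ c) := rfl

theorem tupleGraphOn_inv (σ : Fin D → Perm V) :
    (tupleGraphOn σ)⁻¹ = tupleGraphOn (fun c => (σ c)⁻¹) := rfl

/-- The tuple of a color preserving graph. -/
def tupleOf (γ : Perm (Σ _ : V, Fin D)) (h : ∀ e, (γ e).2 = e.2) (c : Fin D) : Perm V where
  toFun v := (γ ⟨v, c⟩).1
  invFun v := (γ.symm ⟨v, c⟩).1
  left_inv v := by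
    have : γ ⟨v, c⟩ = ⟨(γ ⟨v, c⟩).1, c⟩ := Sigma.ext rfl (heq_of_eq (h ⟨v, c⟩))
    change (γ.symm ⟨(γ ⟨v, c⟩).1, c⟩).1 = v
    rw [← this, Equiv.symm_apply_apply]
  right_inv v := by
    have h' := h (γ.symm ⟨v, c⟩)
    rw [Equiv.apply_symm_apply] at h'
    have : γ.symm ⟨v, c⟩ = ⟨(γ.symm ⟨v, c⟩).1, c⟩ := Sigma.ext rfl (heq_of_eq h'.symm)
    change (γ ⟨(γ.symm ⟨v, c⟩).1, c⟩).1 = v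
    rw [← this, Equiv.apply_symm_apply]

theorem tupleGraphOn_tupleOf (γ : Perm (Σ _ : V, Fin D)) (h : ∀ e, (γ e).2 = e.2) :
    tupleGraphOn (tupleOf γ h) = γ := by
  ext1 ⟨v, c⟩
  exact Sigma.ext rfl (heq_of_eq (h ⟨v, c⟩).symm)

theorem exists_tupleGraphOn_eq {γ : Perm (Σ _ : V, Fin D)} (h : ∀ e, (γ e).2 = e.2) :
    ∃ σ, tupleGraphOn σ = γ := ⟨_, tupleGraphOn_tupleOf γ h⟩

variable [Fintype V] [DecidableEq V]

theorem cycleType_tupleGraphOn (σ : Fin D → Perm V) :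
    (tupleGraphOn σ).cycleType = ∑ c, (σ c).cycleType := by
  have key : ∀ s : Finset (Fin D),
      (tupleGraphOn fun c => if c ∈ s then σ c else 1).cycleType = ∑ c ∈ s, (σ c).cycleType := by
    intro s
    induction s using Finset.induction_on with
    | empty => simp; rfl
    | insert c s hc ih =>
      have h1 : (tupleGraphOn fun c' => if c' ∈ insert c s then σ c' else 1) =
          (tupleGraphOn fun c' => if c' = c then σ c' else 1) *
            tupleGraphOn fun c' => if c' ∈ s then σ c' else 1 := by
        rw [tupleGraphOn_mul]
        congr 1
        funext c'
        by_cases h : c' = c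
        · subst h; simp [hc]
        · simp [h]
      have hd : (tupleGraphOn fun c' => if c' = c then σ c' else 1).Disjoint
          (tupleGraphOn fun c' => if c' ∈ s then σ c' else 1) := by
        rintro ⟨v, c'⟩
        by_cases h : c' = c
        · right; subst h; simp [tupleGraphOn_apply, hc]
        · left; simp [tupleGraphOn_apply, h]
      let e : V ≃ {x : Σ _ : V, Fin D // x.2 = c} :=
        { toFun := fun v => ⟨⟨v, c⟩, rfl⟩
          invFun := fun x => x.1.1
          left_inv := fun v => rfl
          right_inv := fun x => by
            obtain ⟨⟨v, c'⟩, h⟩ := x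
            simp only at h
            subst h
            rfl }
      have h2 : (tupleGraphOn fun c' => if c' = c then σ c' else 1) =
          (σ c).extendDomain e := by
        ext1 ⟨v, c'⟩
        by_cases h : c' = c
        · subst h
          rw [tupleGraphOn_apply, if_pos rfl]
          exact (Perm.extendDomain_apply_image (σ c') e v).symm
        · have h3 : ((σ c).extendDomain e) ⟨v, c'⟩ = ⟨v, c'⟩ :=
            Perm.extendDomain_apply_not_subtype _ _ h
          rw [h3, tupleGraphOn_apply, if_neg h]
          rfl
      rw [h1, hd.cycleType_mul, ih, h2, Perm.cycleType_extendDomain, Finset.sum_insert hc]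
  have := key Finset.univ
  simpa using this

theorem permLength_tupleGraphOn (σ : Fin D → Perm V) :
    permLength (tupleGraphOn σ) = ∑ c, permLength (σ c) := by
  rw [permLength, cycleType_tupleGraphOn]
  simp only [permLength]
  rw [← Multiset.coe_mapAddMonoidHom, map_sum, ← Multiset.coe_sumAddMonoidHom, map_sum]

theorem moebius_tupleGraphOn (σ : Fin D → Perm V) :
    moebius (tupleGraphOn σ) = ∏ c, moebius (σ c) := by
  rw [moebius, cycleType_tupleGraphOn]
  simp only [moebius]
  generalize (fun p : ℕ => (-1 : ℂ) ^ (p - 1) * (catalan (p - 1) : ℂ)) = w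
  have : ∀ s : Finset (Fin D), (Multiset.map w (∑ c ∈ s, (σ c).cycleType)).prod =
      ∏ c ∈ s, (Multiset.map w (σ c).cycleType).prod := by
    intro s
    induction s using Finset.induction_on with
    | empty => simp
    | insert c s hc ih =>
      rw [Finset.sum_insert hc, Finset.prod_insert hc, Multiset.map_add, Multiset.prod_add, ih]
  exact this _

/-- Lengths add over the colors and the triangle inequality holds in each color, so one equality of
sums is equality color by color. -/
theorem precedes_tupleGraphOn (σ τ : Fin D → Perm V) :
    Precedes (tupleGraphOn τ) (tupleGraphOn σ) ↔ ∀ c, Precedes (τ c) (σ c) := by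
  simp only [precedes_iff, tupleGraphOn_inv, tupleGraphOn_mul, permLength_tupleGraphOn]
  have h : ∀ c ∈ Finset.univ, permLength (σ c) ≤
      permLength (τ c) + permLength ((τ c)⁻¹ * σ c) := fun c _ => by
    have := permLength_mul_le (τ c) ((τ c)⁻¹ * σ c)
    rwa [mul_inv_cancel_left] at this
  rw [← Finset.sum_add_distrib]
  constructor
  · intro h1 c
    exact ((Finset.sum_eq_sum_iff_of_le h).1 h1.symm c (Finset.mem_univ c)).symm
  · intro h1
    exact Finset.sum_congr rfl fun c _ => h1 c

theorem Precedes.color_preserving {γ τ : Perm (Σ _ : V, Fin D)} (h : Precedes τ γ)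
    (hγ : ∀ e, (γ e).2 = e.2) : ∀ e, (τ e).2 = e.2 := h.comp_eq (a := fun e => e.2) hγ

end Tuple

/-! ### Pure components of forests -/

section Pure

variable {D : ℕ}

theorem pureSetoid_le_iff {ι W B : Type} {σ : ι → W ≃ B} {r : Setoid (W ⊕ B)} :
    pureSetoid σ ≤ r ↔ ∀ c s, r (Sum.inl s) (Sum.inr (σ c s)) := by
  constructor
  · intro h c s
    exact h (Relation.EqvGen.rel _ _ (PureAdj.edge c s))
  · intro h x y hxy
    induction hxy with
    | rel x y hxy => cases hxy with | edge c s => exact h c s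
    | refl x => exact r.refl x
    | symm x y _ ih => exact r.symm ih
    | trans x y z _ _ ih1 ih2 => exact r.trans ih1 ih2

theorem pureSetoid_edge {ι W B : Type} (σ : ι → W ≃ B) (c : ι) (s : W) :
    pureSetoid σ (Sum.inl s) (Sum.inr (σ c s)) :=
  Relation.EqvGen.rel _ _ (PureAdj.edge c s)

/-- Pure components ignore thick edges and could separate a canonical pair. In a forest they do not:
a leaf `w` has a color other than its single moved one, and that color joins `w` to its partner.
Pure connections of the graph without the leaf then lift to the original graph, and induction
applies. -/
theorem pureSetoid_pair {V : Type} [Fintype V] (hD : 2 ≤ D) (σ : Fin D → Perm V)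
    (hσ : ∃ _ : DecidableEq V, IsForest (tupleGraphOn σ)) (v : V) :
    pureSetoid σ (Sum.inl v) (Sum.inr v) := by
  obtain ⟨_, hσ⟩ := hσ
  induction hn : permLength (tupleGraphOn σ) generalizing σ v with
  | zero =>
    have h1 := permLength_eq_zero hn
    have h2 : σ ⟨0, by omega⟩ v = v :=
      congrArg (fun γ : Perm (Σ _ : V, Fin D) => (γ ⟨v, ⟨0, by omega⟩⟩).1) h1
    have := pureSetoid_edge σ ⟨0, by omega⟩ v
    rwa [h2] at this
  | succ n ih =>
    have hne : tupleGraphOn σ ≠ 1 := by intro h; rw [h] at hn; simp at hn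
    obtain ⟨⟨w, r⟩, he, hleaf⟩ := hσ.exists_leaf hne
    simp only at hleaf
    have hlen := exists_swap_mul he
    have hle := swap_apply_mul_precedes (tupleGraphOn σ) ⟨w, r⟩
    obtain ⟨σ', hσ'⟩ := exists_tupleGraphOn_eq (hle.color_preserving fun _ => rfl)
    have hww : pureSetoid σ (Sum.inl w) (Sum.inr w) := by
      obtain ⟨c, hc⟩ : ∃ c : Fin D, c ≠ r := by
        have : Nontrivial (Fin D) := Fin.nontrivial_iff_two_le.2 hD
        exact exists_ne r
      have h2 := pureSetoid_edge σ c w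
      have h3 : σ c w = w := congrArg Sigma.fst (hleaf c hc)
      rwa [h3] at h2
    have hsub : pureSetoid σ' ≤ pureSetoid σ := by
      refine pureSetoid_le_iff.2 fun c s => ?_
      have h2 : (⟨σ' c s, c⟩ : Σ _ : V, Fin D) =
          swap ⟨w, r⟩ (tupleGraphOn σ ⟨w, r⟩) (tupleGraphOn σ ⟨s, c⟩) := by
        rw [← tupleGraphOn_apply σ' s c, hσ']; rfl
      by_cases h3 : tupleGraphOn σ ⟨s, c⟩ = tupleGraphOn σ ⟨w, r⟩
      · rw [h3, swap_apply_right] at h2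
        have h4 := (tupleGraphOn σ).injective h3
        simp only [Sigma.mk.injEq, heq_eq_eq] at h4 h2
        rw [h2.1, h4.1]
        exact hww
      · by_cases h4 : tupleGraphOn σ ⟨s, c⟩ = ⟨w, r⟩
        · rw [h4, swap_apply_left] at h2
          simp only [tupleGraphOn_apply, Sigma.mk.injEq, heq_eq_eq] at h2 h4
          have h5 := pureSetoid_edge σ c s
          rw [h4.1] at h5
          rw [h2.1]
          exact (pureSetoid σ).trans h5 ((pureSetoid σ).trans ((pureSetoid σ).symm hww)
            (pureSetoid_edge σ r w))
        · rw [swap_apply_of_ne_of_ne h4 h3] at h2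
          simp only [tupleGraphOn_apply, Sigma.mk.injEq, heq_eq_eq] at h2
          rw [h2.1]
          exact pureSetoid_edge σ c s
    exact hsub (ih σ' v (by rw [hσ']; exact (hσ.of_precedes hle).1) (by rw [hσ']; omega))

/-- Pure components and connected components agree for forests. -/
def pureComponentEquiv {V : Type} (σ : Fin D → Perm V)
    (hp : ∀ v, pureSetoid σ (Sum.inl v) (Sum.inr v)) :
    GraphComponent (tupleGraphOn σ) ≃ PureComponent σ where
  toFun := Quotient.map Sum.inl fun u v huv => by
    have : graphSetoid (tupleGraphOn σ) ≤ (pureSetoid σ).comap Sum.inl :=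
      graphSetoid_le_iff.2 fun e => (pureSetoid σ).trans (pureSetoid_edge σ e.2 e.1)
        ((pureSetoid σ).symm (hp _))
    exact this huv
  invFun := Quotient.map (Sum.elim id id) fun u v huv => by
    have : pureSetoid σ ≤ (graphSetoid (tupleGraphOn σ)).comap (Sum.elim id id) :=
      pureSetoid_le_iff.2 fun c s => graphSetoid_edge (tupleGraphOn σ) ⟨s, c⟩
    exact this huv
  left_inv := by rintro ⟨v⟩; rfl
  right_inv := by
    rintro ⟨v | v⟩
    · rfl
    · exact Quotient.sound (hp v)

theorem pureTrace_eq_pairedTrace {N : ℕ} {V W B : Type} [Fintype V] [DecidableEq V] [Fintype W]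
    [DecidableEq W] [Fintype B] (e : V ≃ W) (f : V ≃ B) (σ : Fin D → W ≃ B)
    (ρ : Fin D → Perm V) (h : ∀ c v, σ c (e v) = f (ρ c v))
    (X : W → (Fin D → Fin N) → ℂ) (X' : B → (Fin D → Fin N) → ℂ) :
    pureTrace σ X X' =
      pairedTrace (tupleGraphOn ρ) (fun v i j => X (e v) i * X' (f v) j) := by
  unfold pureTrace pairedTrace
  refine Fintype.sum_equiv ((Equiv.arrowCongr e.symm (Equiv.refl _)).trans
    (Equiv.piCurry (fun (_ : V) (_ : Fin D) => Fin N)).symm) _ _ fun i => ?_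
  rw [Finset.prod_mul_distrib, ← e.prod_comp, ← f.prod_comp]
  congr 1
  refine Finset.prod_congr rfl fun v _ => ?_
  congr 1
  funext c
  have : (σ c).symm (f v) = e ((ρ c).symm v) := by
    rw [Equiv.symm_apply_eq, h, Equiv.apply_symm_apply]
  rw [this]
  rfl

/-- Identifying white with black vertices through `η` turns `σ` into a connected graph on `B`, to
which the Euler bound applies. -/
theorem card_le_tupleDist {W B : Type} [Fintype W] [Fintype B] [DecidableEq B]
    (σ : Fin D → W ≃ B) (η : W ≃ B)
    (h : Nat.card (PureComponent (fun o : Option (Fin D) => o.elim η σ)) = 1) :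
    Fintype.card W ≤ tupleDist σ η + 1 := by
  obtain ⟨h1, ⟨C⟩⟩ := Nat.card_eq_one_iff_unique.1 h
  let ρ : Fin D → Perm B := fun c => η.symm.trans (σ c)
  have h2 : pureSetoid (fun o : Option (Fin D) => o.elim η σ) ≤
      (graphSetoid (tupleGraphOn ρ)).comap (Sum.elim η id) := by
    refine pureSetoid_le_iff.2 fun o s => ?_
    change graphSetoid (tupleGraphOn ρ) (η s) (o.elim η σ s)
    cases o with
    | none => exact (graphSetoid _).refl _
    | some c =>
      have := graphSetoid_edge (tupleGraphOn ρ) ⟨η s, c⟩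
      simpa [ρ, tupleGraphOn_apply] using this
  have h3 : numComp (tupleGraphOn ρ) ≤ 1 := by
    have : Subsingleton (GraphComponent (tupleGraphOn ρ)) := by
      constructor
      rintro ⟨u⟩ ⟨w⟩
      refine Quotient.sound ?_
      have h4 : (Quotient.mk _ (Sum.inr u) : PureComponent (fun o : Option (Fin D) => o.elim η σ)) =
        Quotient.mk _ (Sum.inr w) := h1.elim _ _
      exact h2 (Quotient.exact h4)
    exact Finite.card_le_one_iff_subsingleton.2 this
  have h4 := card_le_numComp_add (tupleGraphOn ρ)
  rw [permLength_tupleGraphOn, Nat.card_eq_fintype_card] at h4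
  rw [Fintype.card_congr η]
  unfold tupleDist
  change _ ≤ ∑ c, permLength (ρ c) + 1
  omega

/-- The given `η` makes the set of distances nonempty, so the infimum is attained and is not the
default 0; `card_le_tupleDist` then bounds it below. -/
theorem gaussianScaling_le_one {W B : Type} [Fintype W] [Fintype B] [DecidableEq B]
    (σ : Fin D → W ≃ B) (η : W ≃ B)
    (h : Nat.card (PureComponent (fun o : Option (Fin D) => o.elim η σ)) = 1) :
    gaussianScaling σ ≤ 1 ∧ (tupleDist σ η + 1 = Fintype.card W → gaussianScaling σ = 1) := by
  set A := {d : ℕ | ∃ η : W ≃ B,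
      Nat.card (PureComponent (fun o : Option (Fin D) => o.elim η σ)) = 1 ∧
        d = tupleDist σ η} with hA
  have hmem : tupleDist σ η ∈ A := ⟨η, h, rfl⟩
  obtain ⟨η', h1, h2⟩ := Nat.sInf_mem ⟨_, hmem⟩
  have h3 := card_le_tupleDist σ η' h1
  have h4 := Nat.sInf_le hmem
  have h5 : gaussianScaling σ = (Fintype.card W : ℤ) - (sInf A : ℕ) := rfl
  rw [h5]
  omega

theorem card_pureComponent_option {V W B : Type} (e : V ≃ W) (f : V ≃ B) (σ : Fin D → W ≃ B)
    (ρ : Fin D → Perm V) (h : ∀ c v, σ c (e v) = f (ρ c v))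
    (hp : ∀ v, pureSetoid ρ (Sum.inl v) (Sum.inr v))
    (hc : numComp (tupleGraphOn ρ) = 1) :
    Nat.card (PureComponent σ) = 1 ∧ ∀ η : W ≃ B,
      Nat.card (PureComponent (fun o : Option (Fin D) => o.elim η σ)) = 1 := by
  have h0 : Nat.card (PureComponent ρ) = 1 := by
    rw [← hc]; exact (Nat.card_congr (pureComponentEquiv ρ hp)).symm
  obtain ⟨h1, ⟨C⟩⟩ := Nat.card_eq_one_iff_unique.1 h0
  have key : ∀ r : Setoid (W ⊕ B), (∀ c s, r (Sum.inl s) (Sum.inr (σ c s))) →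
      Nat.card (Quotient r) = 1 := by
    intro r hr
    have hle : pureSetoid ρ ≤ r.comap (Sum.map e f) := by
      refine pureSetoid_le_iff.2 fun c s => ?_
      change r (Sum.inl (e s)) (Sum.inr (f (ρ c s)))
      rw [← h]; exact hr c _
    refine Nat.card_eq_one_iff_unique.2 ⟨⟨?_⟩, ⟨Quotient.mk _ (Sum.map e f C.out)⟩⟩
    have hall : ∀ x : W ⊕ B, ∃ y, Sum.map e f y = x := by
      rintro (x | x)
      · exact ⟨Sum.inl (e.symm x), by simp⟩
      · exact ⟨Sum.inr (f.symm x), by simp⟩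
    rintro ⟨x⟩ ⟨y⟩
    obtain ⟨x, rfl⟩ := hall x
    obtain ⟨y, rfl⟩ := hall y
    refine Quotient.sound (hle ?_)
    have h4 : (Quotient.mk _ x : PureComponent ρ) = Quotient.mk _ y := h1.elim _ _
    exact Quotient.exact h4
  exact ⟨key _ fun c s => pureSetoid_edge σ c s, fun η => key _ fun c s =>
    pureSetoid_edge (fun o : Option (Fin D) => o.elim η σ) (some c) s⟩

theorem classicalCumulant_unique {Ω : Type*} [MeasurableSpace Ω] (μ : Measure Ω) {κ : Type}
    [Fintype κ] [DecidableEq κ] [Unique κ] (Y : κ → Ω → ℂ) :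
    classicalCumulant μ Y = ∫ ω, Y default ω ∂μ := by
  unfold classicalCumulant
  have hat : IsAtom (Finset.univ : Finset κ) := by
    rw [Finset.univ_unique]; exact Finset.isAtom_singleton _
  let := hat.uniqueFinpartition (P := Finpartition.indiscrete hat.1)
  rw [Fintype.sum_unique]
  have : (default : Finpartition (Finset.univ : Finset κ)).parts = {Finset.univ} := by
    rw [Subsingleton.elim default (Finpartition.indiscrete hat.1)]
    rfl
  rw [this]
  simp

end Pure

namespace PureTensorFamily

variable {D : ℕ} {I : Type*} (F : PureTensorFamily D I)

/-- The paired tensor `T_a ⊗ T̄_b`. -/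
def basic (a b : I) : F.RandomPaired (Fin D) := fun N ω i j => F.T a N ω i * F.Tbar b N ω j

/-! ### Connected melonic tuples: scaling exponent and moment -/

section Connected

variable {V W B : Type} [Fintype V] [Fintype W] [Fintype B] (hD : 2 ≤ D) (e : V ≃ W) (f : V ≃ B)
  (σ : Fin D → W ≃ B) (ρ : Fin D → Perm V) (h : ∀ c v, σ c (e v) = f (ρ c v))
  (hρ : ∃ _ : DecidableEq V, IsForest (tupleGraphOn ρ)) (hc : numComp (tupleGraphOn ρ) = 1)

include hD h hρ hc

-- The canonical pairing, taken as `η`, is at distance equal to the length of a connected forest,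
-- one less than the number of vertices, which is the least possible.
omit F in
theorem gaussianScaling_eq_one [DecidableEq B] : gaussianScaling σ = 1 := by
  classical
  have h1 := (card_pureComponent_option e f σ ρ h (pureSetoid_pair hD ρ hρ) hc).2 (e.symm.trans f)
  refine (gaussianScaling_le_one σ _ h1).2 ?_
  obtain ⟨_, hρ⟩ := hρ
  have h2 : tupleDist σ (e.symm.trans f) = permLength (tupleGraphOn ρ) := by
    rw [permLength_tupleGraphOn]
    unfold tupleDist
    refine Finset.sum_congr rfl fun c _ => ?_
    have : (e.symm.trans f).symm.trans (σ c) = f.permCongr (ρ c) := by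
      ext1 b
      simp only [Equiv.permCongr_apply, Equiv.trans_apply, Equiv.symm_trans_apply,
        Equiv.symm_symm, h]
    rw [this, permLength_permCongr]
  unfold IsForest at hρ
  rw [h2, ← Fintype.card_congr e, ← Nat.card_eq_fintype_card, hρ, hc, add_comm]

theorem traceCumulant_of_connected (x : W → I) (x' : B → I) (N : ℕ) [DecidableEq V] :
    F.traceCumulant σ x x' N =
      ∫ ω, pairedTrace (tupleGraphOn ρ) (fun v => F.basic (x (e v)) (x' (f v)) N ω) ∂(F.P N) := by
  classical
  have h1 := (card_pureComponent_option e f σ ρ h (pureSetoid_pair hD ρ hρ) hc).1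
  obtain ⟨h2, ⟨G⟩⟩ := Nat.card_eq_one_iff_unique.1 h1
  have : Unique (PureComponent σ) := ⟨⟨G⟩, fun x => h2.elim _ _⟩
  unfold traceCumulant
  have h3 := classicalCumulant_unique (F.P N) (κ := PureComponent σ)
    (fun (G : PureComponent σ) (ω : F.Ω N) =>
    pureTrace (pureRestrict σ G) (fun s => F.T (x s.1) N ω) (fun t => F.Tbar (x' t.1) N ω))
  refine Eq.trans ?_ (h3.trans ?_)
  · convert rfl
  congr 1
  funext ω
  let e' : V ≃ White σ default := e.trans (Equiv.subtypeUnivEquiv fun _ => h2.elim _ _).symm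
  let f' : V ≃ Black σ default := f.trans (Equiv.subtypeUnivEquiv fun _ => h2.elim _ _).symm
  have := pureTrace_eq_pairedTrace (N := N) e' f' (pureRestrict σ default) ρ
    (fun c v => Subtype.ext (h c v)) (fun s => F.T (x s.1) N ω) (fun t => F.Tbar (x' t.1) N ω)
  refine Eq.trans ?_ this
  convert rfl

theorem rescaledTraceCumulant_of_connected (x : W → I) (x' : B → I) :
    F.rescaledTraceCumulant σ x x' =
      F.rescaledPairedMoment (tupleGraphOn ρ) (fun v => F.basic (x (e v)) (x' (f v))) := by
  classical
  funext N
  unfold rescaledTraceCumulant rescaledPairedMoment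
  rw [gaussianScaling_eq_one hD e f σ ρ h hρ hc, zpow_one,
    F.traceCumulant_of_connected hD e f σ ρ h hρ hc]
  convert rfl

theorem asympMoment_of_connected (x : W → I) (x' : B → I) :
    F.asympMoment σ x x' =
      F.pairedMoment (tupleGraphOn ρ) (fun v => F.basic (x (e v)) (x' (f v))) := by
  unfold asympMoment pairedMoment
  rw [F.rescaledTraceCumulant_of_connected hD e f σ ρ h hρ hc]

end Connected

end PureTensorFamily

end TensorFreeness

end

noncomputable section

namespace TensorFreeness

/-! ### Moments of tuples as moments of paired tensors -/

namespace PureTensorFamily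

variable {D : ℕ} {I : Type*} (F : PureTensorFamily D I)

/-- Components match through `pureComponentEquiv`, and on each the cumulant is an expectation
divided by `N`. White and black vertices of a component form different subtypes, whence the two
relabelings `hinl` and `hinr`. -/
theorem asympMomentMul_eq_pairedMomentMul {V : Type} [Fintype V] [DecidableEq V] (hD : 2 ≤ D)
    (ρ : Fin D → Perm V) (hρ : IsForest (tupleGraphOn ρ)) (x x' : V → I) :
    F.asympMomentMul ρ x x' =
      F.pairedMomentMul (tupleGraphOn ρ) (fun v => F.basic (x v) (x' v)) := by
  classical
  have hp := pureSetoid_pair hD ρ ⟨_, hρ⟩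
  unfold asympMomentMul pairedMomentMul
  refine (Fintype.prod_equiv (pureComponentEquiv ρ hp) _ _ fun C => ?_).symm
  have hcol : ∀ e : Σ _ : Thick (tupleGraphOn ρ) C, Fin D,
      (graphRestrict (tupleGraphOn ρ) C e).2 = e.2 := fun e => rfl
  have hinl : ∀ v : V, (Quotient.mk (graphSetoid (tupleGraphOn ρ)) v : GraphComponent _) = C ↔
      (Quotient.mk (pureSetoid ρ) (Sum.inl v) : PureComponent ρ) = pureComponentEquiv ρ hp C :=
    fun v => ((pureComponentEquiv ρ hp).injective.eq_iff
      (a := Quotient.mk (graphSetoid (tupleGraphOn ρ)) v)).symm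
  have hinr : ∀ v : V, (Quotient.mk (graphSetoid (tupleGraphOn ρ)) v : GraphComponent _) = C ↔
      (Quotient.mk (pureSetoid ρ) (Sum.inr v) : PureComponent ρ) = pureComponentEquiv ρ hp C := by
    intro v
    rw [hinl v, Quotient.sound (hp v)]
  have hσ : ∀ c v, pureRestrict ρ (pureComponentEquiv ρ hp C) c (Equiv.subtypeEquivRight hinl v) =
      Equiv.subtypeEquivRight hinr (tupleOf _ hcol c v) := fun c v => Subtype.ext rfl
  have hfor : IsForest (tupleGraphOn (tupleOf _ hcol)) := by
    rw [tupleGraphOn_tupleOf]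
    have h1 := hρ.restriction (graphRestrict_isRestriction _ C)
    convert h1
  have hcon : numComp (tupleGraphOn (tupleOf _ hcol)) = 1 := by
    rw [tupleGraphOn_tupleOf]
    exact numComp_graphRestrict _ C
  have key := F.asympMoment_of_connected hD _ _ _ _ hσ ⟨_, hfor⟩ hcon (fun s => x s.1)
    (fun t => x' t.1)
  rw [tupleGraphOn_tupleOf] at key
  exact key.symm

theorem freeCumulant_eq_pairedCumulant {n : ℕ} (hD : 2 ≤ D) (σ : Fin D → Perm (Fin n))
    (hσ : IsMelonicTuple σ) (x x' : Fin n → I) :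
    F.freeCumulant σ x x' =
      F.pairedCumulant (tupleGraph σ) (fun v => F.basic (x v) (x' v)) := by
  classical
  have hf : IsForest (tupleGraphOn σ) := (isMelonic_iff.1 hσ).1
  rw [tupleGraph_eq, pairedCumulant_eq_moebiusTransform]
  unfold freeCumulant moebiusTransform
  refine Finset.sum_bij (fun τ _ => tupleGraphOn τ) ?_ ?_ ?_ ?_
  · intro τ hτ
    simp only [Finset.mem_filter, Finset.mem_univ, true_and] at hτ ⊢
    rw [precedes_tupleGraphOn]
    convert hτ
  · intro τ _ τ' _ h
    exact tupleGraphOn_injective h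
  · intro γ hγ
    simp only [Finset.mem_filter, Finset.mem_univ, true_and] at hγ
    obtain ⟨τ, rfl⟩ := exists_tupleGraphOn_eq (hγ.color_preserving fun _ => rfl)
    refine ⟨τ, ?_, rfl⟩
    rw [precedes_tupleGraphOn] at hγ
    simp only [Finset.mem_filter, Finset.mem_univ, true_and]
    convert hγ
  · intro τ hτ
    simp only [Finset.mem_filter, Finset.mem_univ, true_and] at hτ
    have h1 : Precedes (tupleGraphOn τ) (tupleGraphOn σ) := by
      rw [precedes_tupleGraphOn]; convert hτ
    rw [F.asympMomentMul_eq_pairedMomentMul hD τ (hf.of_precedes h1).1, tupleGraphOn_inv,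
      tupleGraphOn_mul, moebius_tupleGraphOn]
    congr 1
    refine Finset.prod_congr rfl fun c _ => ?_
    rw [← moebius_inv, mul_inv_rev, inv_inv]

theorem asympMoment_eq_pairedMoment {n : ℕ} (hD : 2 ≤ D) (σ : Fin D → Perm (Fin n))
    (hσ : IsMelonicTuple σ) (x x' : Fin n → I) :
    F.asympMoment σ x x' =
      F.pairedMoment (tupleGraph σ) (fun v => F.basic (x v) (x' v)) := by
  obtain ⟨h1, h2⟩ := isMelonic_iff.1 hσ
  exact F.asympMoment_of_connected hD (Equiv.refl _) (Equiv.refl _) σ σ (fun _ _ => rfl)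
    ⟨_, h1⟩ h2 x x'

end PureTensorFamily

/-- Color preserving graphs can be relabeled by `Fin n`. -/
theorem exists_tupleGraph_isRestriction {D n : ℕ} {V : Type} (e : Fin n ≃ V)
    (γ : Perm (Σ _ : V, Fin D)) (hγ : ∀ e, (γ e).2 = e.2) :
    ∃ σ : Fin D → Perm (Fin n), IsRestriction (S := fun _ : V => Fin D) e (tupleGraph σ) γ := by
  obtain ⟨ρ, rfl⟩ := exists_tupleGraphOn_eq hγ
  refine ⟨fun c => (ρ c).trans e.symm |> e.trans, ?_⟩
  rintro ⟨v, c⟩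
  change (⟨ρ c (e v), c⟩ : Σ _ : V, Fin D) = ⟨e (e.symm (ρ c (e v))), c⟩
  rw [Equiv.apply_symm_apply]

end TensorFreeness

end

noncomputable section

namespace TensorFreeness

/-! ### Moments and classical cumulants -/

section Partition

variable {κ : Type} [Fintype κ] [DecidableEq κ]

/-- Functions with a given kernel partition are embeddings of the set of its blocks. -/
def kernelEquiv (π : Finpartition (Finset.univ : Finset κ)) (p : ℕ) :
    {f : κ → Fin p // ∀ x y, f x = f y ↔ π.part x = π.part y} ≃ (π.parts ↪ Fin p) where
  toFun f := ⟨fun B => f.1 (π.nonempty_of_mem_parts B.2).choose, fun B B' h => by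
    have h1 := (f.2 _ _).1 h
    rw [π.part_eq_of_mem B.2 (π.nonempty_of_mem_parts B.2).choose_spec,
      π.part_eq_of_mem B'.2 (π.nonempty_of_mem_parts B'.2).choose_spec] at h1
    exact Subtype.ext h1⟩
  invFun g := ⟨fun x => g ⟨π.part x, π.part_mem.2 (Finset.mem_univ x)⟩, fun x y => by
    rw [g.injective.eq_iff, Subtype.mk.injEq]⟩
  left_inv f := by
    refine Subtype.ext (funext fun x => (f.2 _ _).2 ?_)
    have h := π.part_mem.2 (Finset.mem_univ x)
    exact π.part_eq_of_mem h (π.nonempty_of_mem_parts h).choose_spec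
  right_inv g := by
    ext1 B
    refine congrArg g (Subtype.ext ?_)
    exact π.part_eq_of_mem B.2 (π.nonempty_of_mem_parts B.2).choose_spec

theorem exists_kernel {β : Type} [DecidableEq β] (f : κ → β) :
    ∃! π : Finpartition (Finset.univ : Finset κ), ∀ x y, f x = f y ↔ π.part x = π.part y := by
  let s : Setoid κ := Setoid.ker f
  have : DecidableRel s.r := fun x y => inferInstanceAs (Decidable (f x = f y))
  refine ⟨Finpartition.ofSetoid s, fun x y => ?_, fun π hπ => ?_⟩
  · rw [← Finpartition.mem_part_iff_part_eq_part _ (Finset.mem_univ x) (Finset.mem_univ y),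
      Finpartition.mem_part_ofSetoid_iff_rel]
    exact eq_comm
  · have key : ∀ x, π.part x = (Finpartition.ofSetoid s).part x := by
      intro x
      ext y
      rw [Finpartition.mem_part_ofSetoid_iff_rel,
        π.mem_part_iff_part_eq_part (Finset.mem_univ y) (Finset.mem_univ x), ← hπ]
      exact eq_comm
    have hle : ∀ π π' : Finpartition (Finset.univ : Finset κ), (∀ x, π.part x = π'.part x) →
        π.parts ⊆ π'.parts := by
      intro π π' h B hB
      obtain ⟨x, hx⟩ := π.nonempty_of_mem_parts hB
      rw [← π.part_eq_of_mem hB hx, h]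
      exact π'.part_mem.2 (Finset.mem_univ x)
    exact Finpartition.ext ((hle _ _ key).antisymm (hle _ _ fun x => (key x).symm))

/-- Count the maps `κ → Fin p` by their kernel: those with kernel `π` are the injections of the
blocks of `π`. -/
theorem sum_descFactorial_card_parts (p : ℕ) :
    ∑ π : Finpartition (Finset.univ : Finset κ), p.descFactorial π.parts.card =
      p ^ Fintype.card κ := by
  classical
  have h1 : ∀ π : Finpartition (Finset.univ : Finset κ), p.descFactorial π.parts.card =
      ∑ f : κ → Fin p, if ∀ x y, f x = f y ↔ π.part x = π.part y then 1 else 0 := by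
    intro π
    rw [Finset.sum_boole, ← Fintype.card_subtype, Fintype.card_congr (kernelEquiv π p),
      Fintype.card_embedding_eq]
    simp
  simp only [h1]
  rw [Finset.sum_comm]
  have h2 : ∀ f : κ → Fin p, (∑ π : Finpartition (Finset.univ : Finset κ),
      if ∀ x y, f x = f y ↔ π.part x = π.part y then 1 else 0) = 1 := by
    intro f
    obtain ⟨π, h, hu⟩ := exists_kernel f
    rw [Finset.sum_boole, Nat.cast_id, Finset.card_eq_one]
    refine ⟨π, Finset.ext fun π' => ?_⟩
    simp only [Finset.mem_filter, Finset.mem_univ, true_and, Finset.mem_singleton]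
    exact ⟨hu π', fun h' => h' ▸ h⟩
  simp [h2]

theorem eval_neg_one_descPochhammer (n : ℕ) :
    (descPochhammer ℂ n).eval (-1) = (-1) ^ n * (n.factorial : ℂ) := by
  induction n with
  | zero => simp
  | succ n ih =>
    rw [descPochhammer_succ_eval, ih, Nat.factorial_succ]
    push_cast
    ring

/-- The classical cumulants of the constant `1` of order at least two vanish. -/
theorem sum_cumulantWeight (h : 2 ≤ Fintype.card κ) :
    ∑ π : Finpartition (Finset.univ : Finset κ),
      (-1 : ℂ) ^ (π.parts.card - 1) * ((π.parts.card - 1).factorial : ℂ) = 0 := by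
  have hκ : (Finset.univ : Finset κ) ≠ ∅ := by
    have : Nonempty κ := Fintype.card_pos_iff.1 (by omega)
    exact Finset.univ_nonempty.ne_empty
  have hpos : ∀ π : Finpartition (Finset.univ : Finset κ), π.parts.card - 1 + 1 = π.parts.card :=
    fun π => Nat.sub_add_cancel (Finset.card_pos.2 (π.parts_nonempty hκ))
  have h1 : (Polynomial.X : Polynomial ℂ) ^ Fintype.card κ =
      ∑ π : Finpartition (Finset.univ : Finset κ), descPochhammer ℂ π.parts.card := by
    refine Polynomial.eq_of_infinite_eval_eq _ _ (Set.Infinite.mono (s := Set.range (Nat.cast))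
      ?_ (Set.infinite_range_of_injective Nat.cast_injective))
    rintro _ ⟨p, rfl⟩
    simp only [Set.mem_ofPred_eq, Polynomial.eval_pow, Polynomial.eval_X, Polynomial.eval_finsetSum,
      descPochhammer_eval_eq_descFactorial]
    rw [← Nat.cast_pow, ← sum_descFactorial_card_parts (κ := κ) p, Nat.cast_sum]
  -- Divide by `X`: a falling factorial in `X` leaves one in `X - 1`. Its value at 0 is the weight
  -- `(-1) ^ m * m!`, while the left-hand side vanishes there because `|κ| ≥ 2`.
  have h2 : (Polynomial.X : Polynomial ℂ) ^ (Fintype.card κ - 1) =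
      ∑ π : Finpartition (Finset.univ : Finset κ),
        (descPochhammer ℂ (π.parts.card - 1)).comp (Polynomial.X - 1) := by
    refine mul_left_cancel₀ (Polynomial.X_ne_zero (R := ℂ)) ?_
    rw [← pow_succ', Nat.sub_add_cancel (by omega), h1, Finset.mul_sum]
    refine Finset.sum_congr rfl fun π _ => ?_
    rw [← descPochhammer_succ_left, hpos]
  have h3 := congrArg (Polynomial.eval 0) h2
  rw [Polynomial.eval_finsetSum] at h3
  simp only [Polynomial.eval_pow, Polynomial.eval_X, Polynomial.eval_comp, Polynomial.eval_sub,
    Polynomial.eval_one, zero_sub, eval_neg_one_descPochhammer] at h3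
  rw [← h3, zero_pow (by omega)]

end Partition

/-- Solve the cumulant formula for its one-block term. All other partitions have blocks with
factorized limits, and their weights add up to `-1` by `sum_cumulantWeight`. -/
theorem tendsto_moment_of_cumulant {κ : Type} [Fintype κ] [DecidableEq κ]
    (hκ : 2 ≤ Fintype.card κ) {Ω : ℕ → Type*} [∀ N, MeasurableSpace (Ω N)]
    (P : ∀ N, Measure (Ω N)) (Y : ∀ N, κ → Ω N → ℂ) (φ : κ → ℂ)
    (hcum : Tendsto (fun N : ℕ => classicalCumulant (P N) (Y N) / (N : ℂ) ^ Fintype.card κ) atTop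
      (𝓝 0))
    (hmom : ∀ A : Finset κ, A ≠ Finset.univ →
      Tendsto (fun N : ℕ => (∫ ω, ∏ k ∈ A, Y N k ω ∂(P N)) / (N : ℂ) ^ A.card) atTop
        (𝓝 (∏ k ∈ A, φ k))) :
    Tendsto (fun N : ℕ => (∫ ω, ∏ k, Y N k ω ∂(P N)) / (N : ℂ) ^ Fintype.card κ) atTop
      (𝓝 (∏ k, φ k)) := by
  have hne : (Finset.univ : Finset κ) ≠ ⊥ := by
    have : Nonempty κ := Fintype.card_pos_iff.1 (by omega)
    exact Finset.univ_nonempty.ne_empty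
  set w : Finpartition (Finset.univ : Finset κ) → ℂ := fun π =>
    (-1 : ℂ) ^ (π.parts.card - 1) * ((π.parts.card - 1).factorial : ℂ) with hw
  set t : Finpartition (Finset.univ : Finset κ) := Finpartition.indiscrete hne with ht
  have htp : t.parts = {Finset.univ} := rfl
  have hwt : w t = 1 := by simp [hw, htp]
  have hsum : ∑ π ∈ Finset.univ.erase t, w π = -1 := by
    have h1 := sum_cumulantWeight hκ
    change ∑ π, w π = 0 at h1
    rw [← Finset.add_sum_erase _ _ (Finset.mem_univ t), hwt] at h1
    linear_combination h1
  have hblock : ∀ π ∈ Finset.univ.erase t, ∀ G ∈ π.parts, G ≠ Finset.univ := by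
    intro π hπ G hG hGu
    refine Finset.ne_of_mem_erase hπ (Finpartition.ext ?_)
    rw [htp]
    subst hGu
    refine Finset.eq_singleton_iff_unique_mem.2 ⟨hG, fun G' hG' => ?_⟩
    obtain ⟨x, hx⟩ := π.nonempty_of_mem_parts hG'
    exact π.eq_of_mem_parts hG' hG hx (Finset.mem_univ x)
  have hlim : ∀ π ∈ Finset.univ.erase t, Tendsto (fun N : ℕ => w π * ∏ G ∈ π.parts,
      ((∫ ω, ∏ k ∈ G, Y N k ω ∂(P N)) / (N : ℂ) ^ G.card)) atTop (𝓝 (w π * ∏ k, φ k)) := by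
    intro π hπ
    refine Tendsto.const_mul _ ?_
    have h1 : ∏ k, φ k = ∏ G ∈ π.parts, ∏ k ∈ G, φ k := by
      conv_lhs => rw [← π.biUnion_parts]
      rw [Finset.prod_biUnion]
      · rfl
      · exact π.disjoint
    rw [h1]
    exact tendsto_finsetProd _ fun G hG => hmom G (hblock π hπ G hG)
  have hsumlim := tendsto_finsetSum (Finset.univ.erase t) hlim
  rw [← Finset.sum_mul, hsum] at hsumlim
  have hfinal := hcum.sub hsumlim
  have e1 : (0 : ℂ) - -1 * ∏ k, φ k = ∏ k, φ k := by ring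
  rw [e1] at hfinal
  refine hfinal.congr fun N => ?_
  have e2 : ∀ π : Finpartition (Finset.univ : Finset κ), ∏ G ∈ π.parts,
      ((∫ ω, ∏ k ∈ G, Y N k ω ∂(P N)) / (N : ℂ) ^ G.card) =
      (∏ G ∈ π.parts, (∫ ω, ∏ k ∈ G, Y N k ω ∂(P N))) / (N : ℂ) ^ Fintype.card κ := by
    intro π
    rw [Finset.prod_div_distrib, Finset.prod_pow_eq_pow_sum, π.sum_card_parts, Finset.card_univ]
  simp only [e2]
  unfold classicalCumulant
  rw [Finset.sum_div, ← Finset.add_sum_erase _ _ (Finset.mem_univ t)]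
  have e3 : ∀ π : Finpartition (Finset.univ : Finset κ),
      w π * ((∏ G ∈ π.parts, (∫ ω, ∏ k ∈ G, Y N k ω ∂(P N))) / (N : ℂ) ^ Fintype.card κ) =
      (-1 : ℂ) ^ (π.parts.card - 1) * ((π.parts.card - 1).factorial : ℂ) *
        (∏ G ∈ π.parts, (∫ ω, ∏ k ∈ G, Y N k ω ∂(P N))) / (N : ℂ) ^ Fintype.card κ := by
    intro π
    rw [mul_div_assoc]
  rw [Finset.sum_congr rfl fun π _ => e3 π, add_sub_cancel_right, ← e3 t, hwt, one_mul, htp,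
    Finset.prod_singleton]

/-! ### Factorization of trace-invariants over components -/

section Factor

variable {V : Type} {S : V → Type}

/-- The assignments of indices split along the connected components. -/
def componentIndexEquiv (γ : Perm (Σ v, S v)) (N : ℕ) :
    ((Σ v, S v) → Fin N) ≃ ((C : GraphComponent γ) → (Σ v : Thick γ C, S v.1) → Fin N) where
  toFun i C e := i (slotMap Subtype.val e)
  invFun q e := q (Quotient.mk _ e.1) ⟨⟨e.1, rfl⟩, e.2⟩
  left_inv i := rfl
  right_inv q := by
    funext C ⟨⟨v, hv⟩, s⟩
    subst hv
    rfl

variable [Fintype V] [DecidableEq V] [∀ v, Fintype (S v)] [∀ v, DecidableEq (S v)]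

theorem pairedTrace_eq_prod {N : ℕ} (γ : Perm (Σ v, S v))
    [∀ C : GraphComponent γ, DecidableEq (Thick γ C)]
    (P : ∀ v, (S v → Fin N) → (S v → Fin N) → ℂ) :
    pairedTrace γ P = ∏ C : GraphComponent γ, pairedTrace (graphRestrict γ C) (fun v => P v.1) := by
  classical
  unfold pairedTrace
  rw [Finset.prod_univ_sum, Fintype.piFinset_univ]
  refine Fintype.sum_equiv (componentIndexEquiv γ N) _ _ fun i => ?_
  rw [← Fintype.prod_fiberwise (fun v => (Quotient.mk (graphSetoid γ) v : GraphComponent γ))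
    (fun v => P v (fun s => i ⟨v, s⟩) (fun s => i (γ.symm ⟨v, s⟩)))]
  refine Finset.prod_congr rfl fun C _ => ?_
  refine Finset.prod_congr ?_ fun v _ => rfl
  ext v
  simp

theorem prod_pairedTrace_graphRestrict {U : Type} [Fintype U] [DecidableEq U] {N : ℕ} {ι : U → V}
    (hι : Function.Injective ι) {δ : Perm (Σ u, S (ι u))} {γ : Perm (Σ v, S v)}
    (h : IsRestriction ι δ γ) [∀ C : GraphComponent γ, DecidableEq (Thick γ C)]
    (P : ∀ v, (S v → Fin N) → (S v → Fin N) → ℂ) :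
    pairedTrace δ (fun u => P (ι u)) = ∏ C : GraphComponent δ,
      pairedTrace (graphRestrict γ (h.compMap hι C)) (fun v => P v.1) := by
  classical
  rw [pairedTrace_eq_prod]
  refine Fintype.prod_congr _ _ fun C => ?_
  exact pairedTrace_eq_of_isRestriction (h.thickMap_bijective hι C) (h.graphRestrict hι C)
    (fun v => P v.1)

end Factor

end TensorFreeness

end

noncomputable section

namespace TensorFreeness

/-! ### Asymptotic factorization of the moments -/

theorem gaussianScaling_perm_le_one {D n : ℕ} (hD : 1 ≤ D) (hn : 1 ≤ n)
    (σ : Fin D → Perm (Fin n)) : gaussianScaling σ ≤ 1 := by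
  obtain ⟨m, rfl⟩ : ∃ m, n = m + 1 := ⟨n - 1, by omega⟩
  -- The pairing `η` used below joins the white vertex `s` to the neighbour of color `c` of its
  -- cyclic successor. It chains all white vertices together, so connectedness holds for every `σ`.
  let c : Fin D := ⟨0, hD⟩
  refine (gaussianScaling_le_one σ ((finRotate (m + 1)).trans (σ c)) ?_).1
  set ρ : Option (Fin D) → Fin (m + 1) ≃ Fin (m + 1) :=
    fun o => o.elim ((finRotate (m + 1)).trans (σ c)) σ with hρ
  have hstep : ∀ s, pureSetoid ρ (Sum.inl s) (Sum.inr (σ c (finRotate (m + 1) s))) :=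
    fun s => pureSetoid_edge ρ none s
  have hedge : ∀ s, pureSetoid ρ (Sum.inl s) (Sum.inr (σ c s)) :=
    fun s => pureSetoid_edge ρ (some c) s
  have hw : ∀ s, pureSetoid ρ (Sum.inl 0) (Sum.inl s) := by
    intro s
    induction s using Fin.induction with
    | zero => exact (pureSetoid ρ).refl _
    | succ i ih =>
      refine (pureSetoid ρ).trans ih ((pureSetoid ρ).trans (hstep i.castSucc) ?_)
      rw [finRotate_apply, Fin.coeSucc_eq_succ]
      exact (pureSetoid ρ).symm (hedge _)
  have hall : ∀ x, pureSetoid ρ (Sum.inl 0) x := by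
    rintro (s | t)
    · exact hw s
    · have := (pureSetoid ρ).trans (hw ((σ c).symm t)) (hedge _)
      rwa [Equiv.apply_symm_apply] at this
  refine Nat.card_eq_one_iff_unique.2 ⟨⟨?_⟩, ⟨Quotient.mk _ (Sum.inl 0)⟩⟩
  rintro ⟨x⟩ ⟨y⟩
  exact Quotient.sound ((pureSetoid ρ).trans ((pureSetoid ρ).symm (hall x)) (hall y))

theorem tendsto_natCast_zpow_div_pow {r : ℤ} {k : ℕ} (h : r < k) :
    Tendsto (fun N : ℕ => (N : ℂ) ^ r / (N : ℂ) ^ k) atTop (𝓝 0) := by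
  have h1 : Tendsto (fun N : ℕ => (((N : ℝ) ^ (r - k) : ℝ) : ℂ)) atTop (𝓝 ((0 : ℝ) : ℂ)) :=
    (Complex.continuous_ofReal.tendsto 0).comp
      ((tendsto_zpow_atTop_zero (by omega)).comp tendsto_natCast_atTop_atTop)
  rw [Complex.ofReal_zero] at h1
  refine h1.congr' ?_
  filter_upwards [eventually_ge_atTop 1] with N hN
  have : (N : ℂ) ≠ 0 := by exact_mod_cast (by omega : N ≠ 0)
  rw [Complex.ofReal_zpow, Complex.ofReal_natCast, zpow_sub₀ this, zpow_natCast]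

namespace PureTensorFamily

variable {D : ℕ} {I : Type*} (F : PureTensorFamily D I)

omit F in
theorem pureTrace_pureRestrict {N : ℕ} {V : Type} [Fintype V] [DecidableEq V] (ρ : Fin D → Perm V)
    (hp : ∀ v, pureSetoid ρ (Sum.inl v) (Sum.inr v)) (C : GraphComponent (tupleGraphOn ρ))
    [DecidableEq (White ρ (pureComponentEquiv ρ hp C))] [DecidableEq (Thick (tupleGraphOn ρ) C)]
    (X X' : V → (Fin D → Fin N) → ℂ) :
    pureTrace (pureRestrict ρ (pureComponentEquiv ρ hp C)) (fun s => X s.1) (fun t => X' t.1) =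
      pairedTrace (graphRestrict (tupleGraphOn ρ) C) (fun v i j => X v.1 i * X' v.1 j) := by
  have hcol : ∀ e : Σ _ : Thick (tupleGraphOn ρ) C, Fin D,
      (graphRestrict (tupleGraphOn ρ) C e).2 = e.2 := fun e => rfl
  have hinl : ∀ v : V, (Quotient.mk (graphSetoid (tupleGraphOn ρ)) v : GraphComponent _) = C ↔
      (Quotient.mk (pureSetoid ρ) (Sum.inl v) : PureComponent ρ) = pureComponentEquiv ρ hp C :=
    fun v => ((pureComponentEquiv ρ hp).injective.eq_iff
      (a := Quotient.mk (graphSetoid (tupleGraphOn ρ)) v)).symm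
  have hinr : ∀ v : V, (Quotient.mk (graphSetoid (tupleGraphOn ρ)) v : GraphComponent _) = C ↔
      (Quotient.mk (pureSetoid ρ) (Sum.inr v) : PureComponent ρ) = pureComponentEquiv ρ hp C := by
    intro v
    rw [hinl v, Quotient.sound (hp v)]
  have hσ : ∀ c v, pureRestrict ρ (pureComponentEquiv ρ hp C) c (Equiv.subtypeEquivRight hinl v) =
      Equiv.subtypeEquivRight hinr (tupleOf _ hcol c v) := fun c v => Subtype.ext rfl
  have key := pureTrace_eq_pairedTrace (N := N) _ _ _ _ hσ (fun s => X s.1) (fun t => X' t.1)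
  rw [tupleGraphOn_tupleOf] at key
  exact key

variable {F}

/-- With `k ≥ 2` components the cumulant grows at most like `N ^ r` with `r ≤ 1 < k`, and proper
subfamilies of components fall under `IH`, so `tendsto_moment_of_cumulant` applies. With one
component the limit is the definition. `IH` ranges over all vertex types because a subfamily lives
on a subtype, while the scaling hypothesis only concerns `Fin n`. -/
theorem HasGaussianScaling.tendsto_of_tuple (hD : 2 ≤ D) (hF : F.HasGaussianScaling) {n : ℕ}
    (hn : 1 ≤ n) (σ : Fin D → Perm (Fin n)) (hσ : IsForest (tupleGraphOn σ)) (x x' : Fin n → I)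
    (IH : ∀ (V : Type) [Fintype V] [DecidableEq V] (γ : Perm (Σ _ : V, Fin D)),
      (∀ e, (γ e).2 = e.2) → IsForest γ → numComp γ < numComp (tupleGraphOn σ) →
      ∀ x x' : V → I, Tendsto (fun N : ℕ =>
        (∫ ω, pairedTrace γ (fun v => F.basic (x v) (x' v) N ω) ∂(F.P N)) / (N : ℂ) ^ numComp γ)
        atTop (𝓝 (F.pairedMomentMul γ (fun v => F.basic (x v) (x' v))))) :
    Tendsto (fun N : ℕ =>
      (∫ ω, pairedTrace (tupleGraphOn σ) (fun v => F.basic (x v) (x' v) N ω) ∂(F.P N)) /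
        (N : ℂ) ^ numComp (tupleGraphOn σ))
      atTop (𝓝 (F.pairedMomentMul (tupleGraphOn σ) (fun v => F.basic (x v) (x' v)))) := by
  classical
  set γ := tupleGraphOn σ with hγ
  obtain ⟨l, hl⟩ := hF n hn σ x x'
  have hpos : 0 < numComp γ := by
    have : Nonempty (GraphComponent γ) := ⟨Quotient.mk _ ⟨0, hn⟩⟩
    exact Nat.card_pos
  have hp := pureSetoid_pair hD σ ⟨_, hσ⟩
  rcases Nat.lt_or_ge 1 (numComp γ) with h2 | h2
  · set E := pureComponentEquiv σ hp with hE
    let X : ∀ N, F.Ω N → GraphComponent γ → ℂ := fun N ω C =>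
      pairedTrace (graphRestrict γ C) (fun v => F.basic (x v.1) (x' v.1) N ω)
    let φ : GraphComponent γ → ℂ := fun C =>
      F.pairedMoment (graphRestrict γ C) (fun v => F.basic (x v.1) (x' v.1))
    have hcard : Fintype.card (PureComponent σ) = numComp γ := by
      rw [numComp, Nat.card_eq_fintype_card, Fintype.card_congr E]
    have hY : ∀ N ω (G : PureComponent σ), pureTrace (pureRestrict σ G)
        (fun s => F.T (x s.1) N ω) (fun t => F.Tbar (x' t.1) N ω) = X N ω (E.symm G) := by
      intro N ω G
      obtain ⟨C, rfl⟩ := E.surjective G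
      rw [Equiv.symm_apply_apply]
      exact pureTrace_pureRestrict σ hp C (fun v => F.T (x v) N ω) (fun v => F.Tbar (x' v) N ω)
    have key := tendsto_moment_of_cumulant (κ := PureComponent σ) (by omega) F.P
      (fun N G ω => X N ω (E.symm G)) (fun G => φ (E.symm G)) ?_ ?_
    · have e1 : ∏ G, φ (E.symm G) =
          F.pairedMomentMul γ (fun v => F.basic (x v) (x' v)) := E.symm.prod_comp φ
      rw [e1, hcard] at key
      refine key.congr fun N => ?_
      congr 2
      funext ω
      rw [E.symm.prod_comp (X N ω)]
      exact (pairedTrace_eq_prod γ fun v => F.basic (x v) (x' v) N ω).symm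
    · rw [hcard]
      have hr := gaussianScaling_perm_le_one (by omega) hn σ
      have h3 := hl.mul (tendsto_natCast_zpow_div_pow (r := gaussianScaling σ) (k := numComp γ)
        (by omega))
      rw [mul_zero] at h3
      refine h3.congr' ?_
      filter_upwards [eventually_ge_atTop 1] with N hN
      have hN0 : (N : ℂ) ≠ 0 := by exact_mod_cast (by omega : N ≠ 0)
      have h4 : F.rescaledTraceCumulant σ x x' N =
          classicalCumulant (F.P N) (fun G ω => X N ω (E.symm G)) /
            (N : ℂ) ^ gaussianScaling σ := by
        unfold rescaledTraceCumulant traceCumulant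
        congr 1
        · congr 1
          funext G ω
          refine Eq.trans ?_ (hY N ω G)
          convert rfl
        · congr 2
      rw [h4]
      have h5 := zpow_ne_zero (gaussianScaling σ) hN0
      field_simp
    · intro A hA
      let p : Fin n → Prop := fun v => E (Quotient.mk _ v) ∈ A
      obtain ⟨δ, hδ⟩ := exists_isRestriction γ p fun e => by
        simp only [p]; rw [mk_apply_eq]
      have hinj : Function.Injective (Subtype.val : {v // p v} → Fin n) := Subtype.val_injective
      have hmem : ∀ C, E (hδ.compMap hinj C) ∈ A := by
        rintro ⟨v⟩
        exact v.2
      let f : GraphComponent δ → A := fun C => ⟨E (hδ.compMap hinj C), hmem C⟩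
      have hf : Function.Bijective f := by
        constructor
        · intro C C' h
          exact hδ.compMap_injective hinj (E.injective (congrArg Subtype.val h))
        · rintro ⟨G, hG⟩
          obtain ⟨C, rfl⟩ := E.surjective G
          revert hG
          refine Quotient.inductionOn C fun v hv => ?_
          exact ⟨Quotient.mk _ ⟨v, hv⟩, rfl⟩
      have hn1 : numComp δ = A.card := by
        rw [numComp, Nat.card_eq_of_bijective f hf]
        simp
      have hlt : numComp δ < numComp γ := by
        rw [hn1, ← hcard]
        obtain ⟨G, hG⟩ : ∃ G, G ∉ A := by
          by_contra! h
          exact hA (Finset.eq_univ_iff_forall.2 h)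
        exact Finset.card_lt_univ_of_notMem hG
      have h3 := IH {v // p v} δ (fun e => (congrArg Sigma.snd (hδ e)).symm) (hσ.restriction hδ) hlt (fun v => x v.1)
        (fun v => x' v.1)
      rw [hn1] at h3
      have e1 : ∏ k ∈ A, φ (E.symm k) =
          F.pairedMomentMul δ (fun v => F.basic (x v.1) (x' v.1)) := by
        rw [F.pairedMomentMul_eq_prod hinj hδ (fun v => F.basic (x v) (x' v)),
          ← Finset.prod_coe_sort A]
        refine (Fintype.prod_bijective f hf _ _ fun C => ?_).symm
        simp only [f, φ, Equiv.symm_apply_apply]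
      rw [e1]
      refine h3.congr fun N => ?_
      congr 2
      funext ω
      rw [prod_pairedTrace_graphRestrict hinj hδ (fun v => F.basic (x v) (x' v) N ω),
        ← Finset.prod_coe_sort A]
      refine Fintype.prod_bijective f hf _ _ fun C => ?_
      simp only [f, X, Equiv.symm_apply_apply]
  · have h1 : numComp γ = 1 := by omega
    rw [h1, F.pairedMomentMul_of_connected h1]
    have h3 : F.rescaledTraceCumulant σ x x' =
        F.rescaledPairedMoment γ (fun v => F.basic (x v) (x' v)) :=
      F.rescaledTraceCumulant_of_connected hD (Equiv.refl _) (Equiv.refl _) σ σ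
        (fun _ _ => rfl) ⟨_, hσ⟩ h1 x x'
    rw [h3] at hl
    have h4 := tendsto_nhds_limUnder ⟨l, hl⟩
    refine h4.congr fun N => ?_
    simp only [rescaledPairedMoment, pow_one]
    congr 2
    funext ω
    convert rfl

theorem HasGaussianScaling.tendsto_pairedMomentMul (hD : 2 ≤ D) (hF : F.HasGaussianScaling)
    {V : Type} [Fintype V] [DecidableEq V] (γ : Perm (Σ _ : V, Fin D)) (hγ : ∀ e, (γ e).2 = e.2)
    (hf : IsForest γ) (x x' : V → I) :
    Tendsto (fun N : ℕ =>
      (∫ ω, pairedTrace γ (fun v => F.basic (x v) (x' v) N ω) ∂(F.P N)) / (N : ℂ) ^ numComp γ)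
      atTop (𝓝 (F.pairedMomentMul γ (fun v => F.basic (x v) (x' v)))) := by
  classical
  induction hk : numComp γ using Nat.strong_induction_on generalizing V with
  | _ k IH =>
  subst hk
  rcases isEmpty_or_nonempty V with hV | hV
  · have hC : IsEmpty (GraphComponent γ) := ⟨fun C => hV.elim C.out⟩
    have h1 : numComp γ = 0 := by rw [numComp, Nat.card_of_isEmpty]
    have h2 : F.pairedMomentMul γ (fun v => F.basic (x v) (x' v)) = 1 := by
      unfold pairedMomentMul; rw [Finset.univ_eq_empty, Finset.prod_empty]
    rw [h1, h2]
    refine tendsto_const_nhds.congr fun N => ?_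
    have : ∀ ω, pairedTrace γ (fun v => F.basic (x v) (x' v) N ω) = 1 := fun ω => by
      rw [pairedTrace_eq_prod, Finset.univ_eq_empty, Finset.prod_empty]
    simp [this]
  · obtain ⟨σ, hσ⟩ := exists_tupleGraph_isRestriction (Fintype.equivFin V).symm γ hγ
    have hb := (Fintype.equivFin V).symm.bijective
    have h1 := HasGaussianScaling.tendsto_of_tuple hD hF Fintype.card_pos σ
      ((isForest_iff_of_isRestriction hb hσ).2 hf) (fun v => x ((Fintype.equivFin V).symm v))
      (fun v => x' ((Fintype.equivFin V).symm v)) ?_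
    · have h2 := F.pairedMomentMul_eq_of_isRestriction hb hσ (fun v => F.basic (x v) (x' v))
      have h3 := numComp_eq_of_isRestriction hb hσ
      rw [tupleGraph_eq] at h2 h3
      rw [h2, h3] at h1
      refine h1.congr fun N => ?_
      congr 2
      funext ω
      exact pairedTrace_eq_of_isRestriction hb hσ (fun v => F.basic (x v) (x' v) N ω)
    · intro U _ _ δ hδ hfδ hlt y y'
      have h3 := numComp_eq_of_isRestriction hb hσ
      rw [tupleGraph_eq] at h3
      rw [h3] at hlt
      refine (IH _ hlt δ hδ hfδ y y' rfl).congr fun N => ?_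
      congr 2

end PureTensorFamily

end TensorFreeness

end

noncomputable section

namespace TensorFreeness

/-! ### Extending permutations along embeddings -/

section ViaEmbedding

variable {α β : Type} [Fintype α] [DecidableEq α] [Fintype β] [DecidableEq β]

theorem viaEmbedding_inv_mul (ι : α ↪ β) (σ τ : Perm α) :
    (σ.viaEmbedding ι)⁻¹ * τ.viaEmbedding ι = (σ⁻¹ * τ).viaEmbedding ι := by
  simp only [← Perm.viaEmbeddingHom_apply, map_mul, map_inv]

theorem cycleType_viaEmbedding (ι : α ↪ β) (σ : Perm α) :
    (σ.viaEmbedding ι).cycleType = σ.cycleType := by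
  classical
  unfold Perm.viaEmbedding
  convert Perm.cycleType_extendDomain (ofInjective ι.1 ι.2) (g := σ)

theorem permLength_viaEmbedding (ι : α ↪ β) (σ : Perm α) :
    permLength (σ.viaEmbedding ι) = permLength σ := by
  rw [permLength, cycleType_viaEmbedding]; rfl

theorem moebius_viaEmbedding (ι : α ↪ β) (σ : Perm α) :
    moebius (σ.viaEmbedding ι) = moebius σ := by
  rw [moebius, cycleType_viaEmbedding]; rfl

omit [Fintype α] [DecidableEq α] [Fintype β] [DecidableEq β] in
theorem viaEmbedding_injective (ι : α ↪ β) :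
    Function.Injective fun σ : Perm α => σ.viaEmbedding ι := by
  intro σ τ h
  ext1 x
  apply ι.injective
  rw [← Perm.viaEmbedding_apply, ← Perm.viaEmbedding_apply]
  exact congrArg (fun ρ : Perm β => ρ (ι x)) h

omit [Fintype α] [DecidableEq α] [Fintype β] [DecidableEq β] in
theorem exists_viaEmbedding_eq (ι : α ↪ β) (ρ : Perm β) (h : ∀ x ∉ Set.range ι, ρ x = x) :
    ∃ σ : Perm α, σ.viaEmbedding ι = ρ := by
  classical
  have hr : ∀ x, ρ x ∈ Set.range ι ↔ x ∈ Set.range ι := by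
    intro x
    constructor
    · intro h1
      by_contra h2
      rw [h x h2] at h1
      exact h2 h1
    · intro h1
      by_contra h2
      have h3 := ρ.injective (h _ h2)
      rw [h3] at h2
      exact h2 h1
  refine ⟨(ofInjective ι.1 ι.2).symm.permCongr (ρ.subtypePerm hr), ?_⟩
  ext1 y
  by_cases hy : y ∈ Set.range ι
  · obtain ⟨x, rfl⟩ := hy
    rw [Perm.viaEmbedding_apply, Equiv.permCongr_apply, Equiv.symm_symm]
    exact congrArg Subtype.val ((ofInjective ι.1 ι.2).apply_symm_apply _)
  · rw [Perm.viaEmbedding_apply_of_notMem _ _ _ hy, h y hy]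

theorem permLength_sigmaCongrRight_le {L : Type} [Fintype L] [DecidableEq L] {A : L → Type}
    [∀ l, Fintype (A l)] [∀ l, DecidableEq (A l)] (σ : ∀ l, Perm (A l)) :
    permLength (Perm.sigmaCongrRight σ) ≤ ∑ l, permLength (σ l) := by
  have key : ∀ s : Finset L, permLength (Perm.sigmaCongrRight fun l => if l ∈ s then σ l else 1) ≤
      ∑ l ∈ s, permLength (σ l) := by
    intro s
    induction s using Finset.induction_on with
    | empty =>
      simp only [Finset.notMem_empty, if_false, Finset.sum_empty]
      have : (Perm.sigmaCongrRight fun l => (1 : Perm (A l))) = 1 := by ext1 ⟨l, x⟩; rfl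
      rw [this, permLength_one]
    | insert l s hl ih =>
      have h1 : (Perm.sigmaCongrRight fun l' => if l' ∈ insert l s then σ l' else 1) =
          (σ l).viaEmbedding ⟨fun x => (⟨l, x⟩ : Σ l, A l), sigma_mk_injective⟩ *
            Perm.sigmaCongrRight fun l' => if l' ∈ s then σ l' else 1 := by
        ext1 ⟨l', x⟩
        rw [Perm.mul_apply]
        change (⟨l', (if l' ∈ insert l s then σ l' else 1) x⟩ : Σ l, A l) =
          Perm.viaEmbedding _ _ ⟨l', (if l' ∈ s then σ l' else 1) x⟩
        by_cases h : l' = l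
        · subst h
          simp only [Finset.mem_insert_self, if_true, hl, if_false, Perm.one_apply]
          exact (Perm.viaEmbedding_apply (σ l') ⟨fun x => (⟨l', x⟩ : Σ l, A l),
            sigma_mk_injective⟩ x).symm
        · rw [Perm.viaEmbedding_apply_of_notMem]
          · simp [h]
          · rintro ⟨y, hy⟩
            exact h (congrArg Sigma.fst hy).symm
      rw [h1, Finset.sum_insert hl]
      refine (permLength_mul_le _ _).trans ?_
      rw [permLength_viaEmbedding]
      exact Nat.add_le_add_left ih _
  simpa using key Finset.univ

end ViaEmbedding

/-! ### Gluing generated paired tensors -/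

section Glue

variable {D : ℕ} {L : Type} (G : L → GeneratedShape D)

/-- The thick edges of all the graphs defining a family of generated paired tensors. -/
abbrev GlueVertex : Type := Σ l : L, Fin (G l).n

/-- The slots of generated paired tensors as edges of the underlying graphs. -/
def slotEmb : (Σ l, (G l).Slot) ↪ Σ _ : GlueVertex G, Fin D where
  toFun e := ⟨⟨e.1, e.2.1.1⟩, e.2.1.2⟩
  inj' := by
    rintro ⟨l, ⟨⟨s, c⟩, h⟩⟩ ⟨l', ⟨⟨s', c'⟩, h'⟩⟩ he
    simp only [Sigma.mk.injEq] at he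
    obtain ⟨⟨rfl, hs⟩, hc⟩ := he
    simp only [heq_eq_eq] at hs hc
    subst hs hc
    rfl

theorem slotEmb_mk (l : L) (s : Fin (G l).n) (c : Fin D) (h : (s, c) ∈ (G l).cut) :
    slotEmb G ⟨l, ⟨(s, c), h⟩⟩ = ⟨⟨l, s⟩, c⟩ := rfl

/-- The disjoint union of the graphs defining generated paired tensors. -/
def glueBase : Perm (Σ _ : GlueVertex G, Fin D) :=
  tupleGraphOn fun c => Perm.sigmaCongrRight fun l => (G l).σ c

/-- The graph of pure tensors obtained from a graph of generated paired tensors. -/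
def glue (τ : Perm (Σ l, (G l).Slot)) : Perm (Σ _ : GlueVertex G, Fin D) :=
  glueBase G * τ.viaEmbedding (slotEmb G)

theorem glueBase_apply (l : L) (s : Fin (G l).n) (c : Fin D) :
    glueBase G ⟨⟨l, s⟩, c⟩ = ⟨⟨l, (G l).σ c s⟩, c⟩ := rfl

theorem mem_range_slotEmb {l : L} {s : Fin (G l).n} {c : Fin D} :
    (⟨⟨l, s⟩, c⟩ : Σ _ : GlueVertex G, Fin D) ∈ Set.range (slotEmb G) ↔ (s, c) ∈ (G l).cut := by
  constructor
  · rintro ⟨⟨l', ⟨⟨s', c'⟩, h'⟩⟩, he⟩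
    rw [slotEmb_mk] at he
    simp only [Sigma.mk.injEq] at he
    obtain ⟨⟨rfl, hs⟩, hc⟩ := he
    simp only [heq_eq_eq] at hs hc
    subst hs hc
    exact h'
  · intro h
    exact ⟨⟨l, ⟨(s, c), h⟩⟩, rfl⟩

/-- A slot is recorded as the cut edge at its output; its input is the far end of that edge, given
by `glueBase`. So the output of `e` is rerouted to the input of `τ e`. -/
theorem glue_slotEmb (τ : Perm (Σ l, (G l).Slot)) (e : Σ l, (G l).Slot) :
    glue G τ (slotEmb G e) = glueBase G (slotEmb G (τ e)) := by
  rw [glue, Perm.mul_apply, Perm.viaEmbedding_apply]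

theorem glue_apply_of_notMem (τ : Perm (Σ l, (G l).Slot)) {x : Σ _ : GlueVertex G, Fin D}
    (hx : x ∉ Set.range (slotEmb G)) : glue G τ x = glueBase G x := by
  rw [glue, Perm.mul_apply, Perm.viaEmbedding_apply_of_notMem _ _ _ hx]

theorem glue_injective : Function.Injective (glue G) := by
  intro τ τ' h
  exact viaEmbedding_injective _ (mul_left_cancel h)

theorem glue_color {τ : Perm (Σ l, (G l).Slot)}
    (hτ : ColorPreserving (fun l => (G l).color) τ) (x : Σ _ : GlueVertex G, Fin D) :
    (glue G τ x).2 = x.2 := by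
  by_cases hx : x ∈ Set.range (slotEmb G)
  · obtain ⟨e, rfl⟩ := hx
    rw [glue_slotEmb]
    exact hτ e
  · rw [glue_apply_of_notMem G τ hx]
    rfl

theorem sameCycle_glueBase {l l' : L} {s : Fin (G l).n} {s' : Fin (G l').n} {c c' : Fin D}
    [Finite L] (h : (glueBase G).SameCycle ⟨⟨l, s⟩, c⟩ ⟨⟨l', s'⟩, c'⟩) :
    ∃ t : Fin (G l).n, ((G l).σ c).SameCycle s t ∧
      (⟨⟨l', s'⟩, c'⟩ : Σ _ : GlueVertex G, Fin D) = ⟨⟨l, t⟩, c⟩ := by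
  obtain ⟨k, hk⟩ := h
  rw [← hk]
  clear hk
  have h1 : ∀ k : ℕ, ∀ t, ((glueBase G) ^ k) ⟨⟨l, t⟩, c⟩ = ⟨⟨l, (((G l).σ c) ^ k) t⟩, c⟩ := by
    intro k
    induction k with
    | zero => intro t; rfl
    | succ k ih => intro t; rw [pow_succ, pow_succ, Perm.mul_apply, glueBase_apply, ih]; rfl
  have h2 : ∀ k : ℕ, ∀ t, ((glueBase G) ^ (-(k : ℤ))) ⟨⟨l, t⟩, c⟩ =
      ⟨⟨l, (((G l).σ c) ^ (-(k : ℤ))) t⟩, c⟩ := by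
    intro k t
    rw [zpow_neg, zpow_natCast, Perm.inv_eq_iff_eq, h1, zpow_neg, zpow_natCast]
    rw [← Perm.mul_apply, mul_inv_cancel, Perm.one_apply]
  refine ⟨(((G l).σ c) ^ k) s, ⟨k, rfl⟩, ?_⟩
  obtain ⟨m, rfl | rfl⟩ := Int.eq_nat_or_neg k
  · rw [zpow_natCast, zpow_natCast, h1]
  · exact h2 m s

variable [Fintype L] [DecidableEq L]

theorem glue_inv_mul (τ g : Perm (Σ l, (G l).Slot)) :
    (glue G τ)⁻¹ * glue G g = (τ⁻¹ * g).viaEmbedding (slotEmb G) := by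
  rw [glue, glue, ← viaEmbedding_inv_mul]
  group

/-- There is exactly one cut edge per cycle, so the extension of `τ` moves at most one point of each
cycle of `glueBase`. This additivity makes gluing compatible with the order and with forests. -/
theorem permLength_glue (τ : Perm (Σ l, (G l).Slot)) :
    permLength (glue G τ) = permLength (glueBase G) + permLength τ := by
  rw [glue, permLength_mul_of_transversal, permLength_viaEmbedding]
  intro x y hx hy hxy
  have hr : ∀ x, τ.viaEmbedding (slotEmb G) x ≠ x → x ∈ Set.range (slotEmb G) := by
    intro x hx
    by_contra h
    exact hx (Perm.viaEmbedding_apply_of_notMem _ _ _ h)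
  have hx' := hr x hx
  have hy' := hr y hy
  obtain ⟨⟨l, s⟩, c⟩ := x
  obtain ⟨⟨l', s'⟩, c'⟩ := y
  obtain ⟨t, h1, h2⟩ := sameCycle_glueBase G hxy
  rw [h2, mem_range_slotEmb] at hy'
  rw [mem_range_slotEmb] at hx'
  rw [h2]
  obtain ⟨u, _, hu⟩ := (G l).cut_spec c s
  have e1 := hu s ⟨hx', Perm.SameCycle.refl _ _⟩
  have e2 := hu t ⟨hy', h1⟩
  rw [e2, ← e1]

theorem precedes_glue {τ g : Perm (Σ l, (G l).Slot)} :
    Precedes (glue G τ) (glue G g) ↔ Precedes τ g := by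
  rw [precedes_iff, precedes_iff, glue_inv_mul, permLength_viaEmbedding, permLength_glue,
    permLength_glue]
  omega

theorem moebius_glue (τ g : Perm (Σ l, (G l).Slot)) :
    moebius (glue G τ * (glue G g)⁻¹) = moebius (τ * g⁻¹) := by
  rw [moebius_mul_inv_eq, moebius_mul_inv_eq, glue_inv_mul, moebius_viaEmbedding]

theorem exists_glue_eq {g : Perm (Σ l, (G l).Slot)} {h : Perm (Σ _ : GlueVertex G, Fin D)}
    (hh : ∀ x ∉ Set.range (slotEmb G), h x = glue G g x) : ∃ τ, glue G τ = h := by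
  obtain ⟨τ, hτ⟩ := exists_viaEmbedding_eq (slotEmb G) ((glueBase G)⁻¹ * h) fun x hx => by
    rw [Perm.mul_apply, hh x hx, glue_apply_of_notMem G g hx, Perm.inv_eq_iff_eq]
  exact ⟨τ, by rw [glue, hτ, mul_inv_cancel_left]⟩

theorem glueBase_precedes_glue (τ : Perm (Σ l, (G l).Slot)) : Precedes (glueBase G) (glue G τ) := by
  rw [precedes_iff, permLength_glue, glue, inv_mul_cancel_left, permLength_viaEmbedding]

theorem graphSetoid_le_of_precedes {V : Type} {S : V → Type} [Fintype V] [DecidableEq V]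
    [∀ v, Fintype (S v)] [∀ v, DecidableEq (S v)] {τ γ : Perm (Σ v, S v)} (h : Precedes τ γ) :
    graphSetoid τ ≤ graphSetoid γ := by
  refine graphSetoid_le_iff.2 fun e => ?_
  have h1 := h.sameCycle (x := e) (y := τ e)
    (Perm.sameCycle_apply_right.2 (Perm.SameCycle.refl _ _))
  exact (sameCycle_comp_eq (a := fun x => (Quotient.mk (graphSetoid γ) x.1 : GraphComponent γ))
    (fun x => mk_apply_eq γ x) h1 |> Quotient.exact)

omit [Fintype L] [DecidableEq L] in
theorem GeneratedShape.permLength_add_one (H : GeneratedShape D) :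
    permLength (tupleGraph H.σ) + 1 = H.n := by
  obtain ⟨h1, h2⟩ := isMelonic_iff.1 H.melonic
  unfold IsForest at h1
  simp at h1
  omega

omit [Fintype L] [DecidableEq L] in
theorem GeneratedShape.related (H : GeneratedShape D) (s t : Fin H.n) :
    graphSetoid (tupleGraph H.σ) s t := by
  obtain ⟨_, h2⟩ := isMelonic_iff.1 H.melonic
  have := (Nat.card_eq_one_iff_unique.1 h2).1
  exact Quotient.exact (this.elim (Quotient.mk _ s) (Quotient.mk _ t))

theorem graphSetoid_glue_mk (τ : Perm (Σ l, (G l).Slot)) (l : L) (s t : Fin (G l).n) :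
    graphSetoid (glue G τ) ⟨l, s⟩ ⟨l, t⟩ := by
  refine graphSetoid_le_of_precedes (glueBase_precedes_glue G τ) ?_
  have h : graphSetoid (tupleGraph (G l).σ) ≤
      (graphSetoid (glueBase G)).comap (fun s => (⟨l, s⟩ : GlueVertex G)) :=
    graphSetoid_le_iff.2 fun e => graphSetoid_edge (glueBase G) ⟨⟨l, e.1⟩, e.2⟩
  exact h ((G l).related s t)

/-- The pure graph of each generated tensor is connected, and stays so after gluing because
`glueBase G ⪯ glue G τ`; contracting it to one thick edge therefore keeps the components. -/
theorem graphSetoid_glue_iff (τ : Perm (Σ l, (G l).Slot)) (u w : GlueVertex G) :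
    graphSetoid (glue G τ) u w ↔ graphSetoid τ u.1 w.1 := by
  constructor
  · have h : graphSetoid (glue G τ) ≤ (graphSetoid τ).comap Sigma.fst := by
      refine graphSetoid_le_iff.2 fun x => ?_
      by_cases hx : x ∈ Set.range (slotEmb G)
      · obtain ⟨e, rfl⟩ := hx
        rw [glue_slotEmb]
        exact graphSetoid_edge τ e
      · rw [glue_apply_of_notMem G τ hx]
        exact (graphSetoid τ).refl _
    exact fun huw => h huw
  · have hne : ∀ l, Nonempty (Fin (G l).n) := fun l =>
      ⟨⟨0, by have := (G l).permLength_add_one; omega⟩⟩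
    let f : L → GlueVertex G := fun l => ⟨l, (hne l).some⟩
    have h : graphSetoid τ ≤ (graphSetoid (glue G τ)).comap f := by
      refine graphSetoid_le_iff.2 fun e => ?_
      have h1 := graphSetoid_edge (glue G τ) (slotEmb G e)
      rw [glue_slotEmb] at h1
      exact (graphSetoid _).trans (graphSetoid_glue_mk G τ e.1 _ _)
        ((graphSetoid _).trans h1 (graphSetoid_glue_mk G τ _ _ _))
    intro huw
    exact (graphSetoid _).trans (graphSetoid_glue_mk G τ u.1 u.2 _)
      ((graphSetoid _).trans (h huw) (graphSetoid_glue_mk G τ w.1 _ w.2))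

/-- The components of a glued graph. -/
def glueComp (τ : Perm (Σ l, (G l).Slot)) : GraphComponent (glue G τ) → GraphComponent τ :=
  Quotient.map Sigma.fst fun u w => (graphSetoid_glue_iff G τ u w).1

theorem glueComp_bijective (τ : Perm (Σ l, (G l).Slot)) : Function.Bijective (glueComp G τ) := by
  constructor
  · rintro ⟨u⟩ ⟨w⟩ h
    exact Quotient.sound ((graphSetoid_glue_iff G τ u w).2 (Quotient.exact h))
  · rintro ⟨l⟩
    exact ⟨Quotient.mk _ ⟨l, ⟨0, by have := (G l).permLength_add_one; omega⟩⟩, rfl⟩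

theorem numComp_glue (τ : Perm (Σ l, (G l).Slot)) : numComp (glue G τ) = numComp τ :=
  Nat.card_eq_of_bijective _ (glueComp_bijective G τ)

/-- Each generating graph is a tree with one more thick edge than its length. Adding these equations
to that of `τ` gives the forest equation of the glued graph. -/
theorem isForest_glue {τ : Perm (Σ l, (G l).Slot)} (hτ : IsForest τ) : IsForest (glue G τ) := by
  rw [isForest_iff_le, numComp_glue, permLength_glue]
  have h1 : permLength (glueBase G) ≤ ∑ l, permLength (tupleGraph (G l).σ) := by
    rw [glueBase, permLength_tupleGraphOn]
    refine (Finset.sum_le_sum fun c _ => permLength_sigmaCongrRight_le _).trans ?_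
    rw [Finset.sum_comm]
    simp only [tupleGraph_eq, permLength_tupleGraphOn]
    exact le_rfl
  have h2 : Nat.card (GlueVertex G) = ∑ l, permLength (tupleGraph (G l).σ) + Nat.card L := by
    rw [Nat.card_sigma]
    simp only [Nat.card_eq_fintype_card, Fintype.card_fin, ← GeneratedShape.permLength_add_one]
    rw [Finset.sum_add_distrib]
    simp
  unfold IsForest at hτ
  omega

theorem glue_isRestriction {U : Type} {ι : U → L}
    {δ : Perm (Σ u, (G (ι u)).Slot)} {τ : Perm (Σ l, (G l).Slot)}
    (h : IsRestriction (S := fun l => (G l).Slot) ι δ τ) :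
    IsRestriction (S := fun _ : GlueVertex G => Fin D)
      (fun w : GlueVertex fun u => G (ι u) => (⟨ι w.1, w.2⟩ : GlueVertex G))
      (glue (fun u => G (ι u)) δ) (glue G τ) := by
  intro x
  by_cases hx : x ∈ Set.range (slotEmb fun u => G (ι u))
  · obtain ⟨e, rfl⟩ := hx
    rw [glue_slotEmb]
    have h1 := glue_slotEmb G τ (slotMap (S := fun l => (G l).Slot) ι e)
    rw [h e] at h1
    exact h1
  · rw [glue_apply_of_notMem _ δ hx]
    obtain ⟨⟨u, s⟩, c⟩ := x
    rw [mem_range_slotEmb] at hx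
    exact glue_apply_of_notMem G τ (x := ⟨⟨ι u, s⟩, c⟩) (by rwa [mem_range_slotEmb])

/-- The indices of the slots together with the summed indices of generated paired tensors. -/
def glueIndexEquiv (N : ℕ) :
    (((Σ l, (G l).Slot) → Fin N) × (∀ l, {e : Fin (G l).n × Fin D // e ∉ (G l).cut} → Fin N)) ≃
      ((Σ _ : GlueVertex G, Fin D) → Fin N) where
  toFun p x := if h : (x.1.2, x.2) ∈ (G x.1.1).cut then p.1 ⟨x.1.1, ⟨(x.1.2, x.2), h⟩⟩
    else p.2 x.1.1 ⟨(x.1.2, x.2), h⟩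
  invFun i := (fun e => i (slotEmb G e), fun l e => i ⟨⟨l, e.1.1⟩, e.1.2⟩)
  left_inv p := by
    refine Prod.ext ?_ ?_
    · funext ⟨l, ⟨⟨s, c⟩, h⟩⟩
      exact dif_pos h
    · funext l ⟨⟨s, c⟩, h⟩
      simp [h]
  right_inv i := by
    funext ⟨⟨l, s⟩, c⟩
    by_cases h : (s, c) ∈ (G l).cut
    · simp [h, slotEmb_mk]
    · simp [h]

/-- The indices joined by `g` and the internally summed ones are together the indices of all colored
edges of the glued graph. -/
theorem pairedTrace_glue {N : ℕ} (g : Perm (Σ l, (G l).Slot))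
    (X X' : L → (Fin D → Fin N) → ℂ) :
    pairedTrace g (fun l => (G l).tensor (X l) (X' l)) =
      pairedTrace (glue G g) (fun w i j => X w.1 i * X' w.1 j) := by
  unfold pairedTrace GeneratedShape.tensor
  simp only [Finset.prod_univ_sum, Fintype.piFinset_univ]
  rw [← Fintype.sum_prod_type']
  refine Fintype.sum_equiv (glueIndexEquiv G N) _ _ fun p => ?_
  rw [Finset.prod_mul_distrib, Finset.prod_mul_distrib, Fintype.prod_sigma, Fintype.prod_sigma]
  congr 1
  refine Finset.prod_congr rfl fun l _ => Finset.prod_congr rfl fun t _ => ?_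
  congr 1
  funext c
  have hsymm : (glue G g).symm ⟨⟨l, t⟩, c⟩ =
      if h : (((G l).σ c).symm t, c) ∈ (G l).cut then
        slotEmb G (g.symm ⟨l, ⟨(((G l).σ c).symm t, c), h⟩⟩)
      else ⟨⟨l, ((G l).σ c).symm t⟩, c⟩ := by
    rw [Equiv.symm_apply_eq]
    split_ifs with h
    · rw [glue_slotEmb, Equiv.apply_symm_apply]
      rw [slotEmb_mk, glueBase_apply, Equiv.apply_symm_apply]
    · rw [glue_apply_of_notMem G g (by rwa [mem_range_slotEmb]), glueBase_apply,
        Equiv.apply_symm_apply]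
  rw [hsymm]
  split_ifs with h
  · exact (congrFun (congrArg Prod.fst ((glueIndexEquiv G N).symm_apply_apply p)) _).symm
  · simp [glueIndexEquiv, h]

end Glue

end TensorFreeness

end

noncomputable section

namespace TensorFreeness

/-! ### Moments and free cumulants of generated paired tensors -/

namespace PureTensorFamily

variable {D : ℕ} {I : Type*} (F : PureTensorFamily D I) {L : Type} [Fintype L]
  (G : L → GeneratedShape D) (a : L → I)

theorem pairedTrace_generated [DecidableEq L] (g : Perm (Σ l, (G l).Slot)) (N : ℕ) (ω : F.Ω N) :
    pairedTrace g (fun l => F.generated (G l) (a l) N ω) =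
      pairedTrace (glue G g) (fun w => F.basic (a w.1) (a w.1) N ω) :=
  pairedTrace_glue G g (fun l => F.T (a l) N ω) (fun l => F.Tbar (a l) N ω)

theorem pairedMoment_generated (g : Perm (Σ l, (G l).Slot)) :
    F.pairedMoment g (fun l => F.generated (G l) (a l)) =
      F.pairedMoment (glue G g) (fun w => F.basic (a w.1) (a w.1)) := by
  classical
  unfold pairedMoment
  congr 1
  funext N
  unfold rescaledPairedMoment
  congr 2
  funext ω
  have := F.pairedTrace_generated G a g N ω
  convert this

theorem pairedMomentMul_generated (τ : Perm (Σ l, (G l).Slot)) :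
    F.pairedMomentMul τ (fun l => F.generated (G l) (a l)) =
      F.pairedMomentMul (glue G τ) (fun w => F.basic (a w.1) (a w.1)) := by
  classical
  unfold pairedMomentMul
  refine (Fintype.prod_bijective _ (glueComp_bijective G τ) _ _ fun C => ?_).symm
  have h1 := glue_isRestriction G (graphRestrict_isRestriction τ (glueComp G τ C))
  set ι : (GlueVertex fun u : Thick τ (glueComp G τ C) => G u.1) → GlueVertex G :=
    fun w => (⟨w.1.1, w.2⟩ : GlueVertex G) with hι
  have hinj : Function.Injective ι := by
    rintro ⟨⟨l, hl⟩, s⟩ ⟨⟨l', hl'⟩, s'⟩ h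
    simp only [ι, Sigma.mk.injEq] at h
    obtain ⟨rfl, h2⟩ := h
    rw [eq_of_heq h2]
  have hc : numComp (glue (fun u : Thick τ (glueComp G τ C) => G u.1)
      (graphRestrict τ (glueComp G τ C))) = 1 := by
    rw [numComp_glue, numComp_graphRestrict]
  obtain ⟨h2, ⟨B⟩⟩ := Nat.card_eq_one_iff_unique.1 hc
  have hB : h1.compMap hinj B = C := by
    apply (glueComp_bijective G τ).1
    revert B
    rintro ⟨w⟩
    exact w.1.2
  have h3 := F.pairedMoment_generated (fun u : Thick τ (glueComp G τ C) => G u.1)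
    (fun u => a u.1) (graphRestrict τ (glueComp G τ C))
  rw [h3, ← F.pairedMomentMul_of_connected hc]
  have h4 := F.pairedMomentMul_eq_prod hinj h1 (fun w => F.basic (a w.1) (a w.1))
  have : Unique (GraphComponent (glue (fun u : Thick τ (glueComp G τ C) => G u.1)
      (graphRestrict τ (glueComp G τ C)))) := ⟨⟨B⟩, fun x => h2.elim _ _⟩
  rw [Fintype.prod_unique, h2.elim default B, hB] at h4
  exact h4.symm

variable {F} in
theorem HasGaussianScaling.tendsto_generated [DecidableEq L] (hD : 2 ≤ D)
    (hF : F.HasGaussianScaling) {τ : Perm (Σ l, (G l).Slot)}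
    (hτ : ColorPreserving (fun l => (G l).color) τ) (hf : IsForest τ) :
    Tendsto (fun N : ℕ =>
      (∫ ω, pairedTrace τ (fun l => F.generated (G l) (a l) N ω) ∂(F.P N)) / (N : ℂ) ^ numComp τ)
      atTop (𝓝 (F.pairedMomentMul τ (fun l => F.generated (G l) (a l)))) := by
  have h := HasGaussianScaling.tendsto_pairedMomentMul hD hF (glue G τ) (glue_color G hτ)
    (isForest_glue G hf) (fun w => a w.1) (fun w => a w.1)
  rw [numComp_glue, ← pairedMomentMul_generated] at h
  refine h.congr fun N => ?_
  congr 2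
  funext ω
  exact (F.pairedTrace_generated G a τ N ω).symm

/-- Gluing embeds the order and the Möbius weights, and its image consists of the graphs that agree
off the cut edges. The result has the form evaluated by `sum_agree_eq_moebiusTransform`. -/
theorem pairedCumulant_generated [DecidableEq L] (g : Perm (Σ l, (G l).Slot))
    [DecidablePred fun h : Perm (Σ _ : GlueVertex G, Fin D) =>
      Precedes h (glue G g) ∧ ∀ x ∉ Set.range (slotEmb G), h x = glue G g x] :
    F.pairedCumulant g (fun l => F.generated (G l) (a l)) =
      ∑ h : Perm (Σ _ : GlueVertex G, Fin D) with
        Precedes h (glue G g) ∧ ∀ x ∉ Set.range (slotEmb G), h x = glue G g x,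
        F.pairedMomentMul h (fun w => F.basic (a w.1) (a w.1)) * moebius (h * (glue G g)⁻¹) := by
  classical
  rw [pairedCumulant_eq_moebiusTransform]
  unfold moebiusTransform
  refine Finset.sum_bij (fun τ _ => glue G τ) ?_ ?_ ?_ ?_
  · intro τ hτ
    simp only [Finset.mem_filter, Finset.mem_univ, true_and] at hτ ⊢
    refine ⟨(precedes_glue G).2 hτ, fun x hx => ?_⟩
    rw [glue_apply_of_notMem G τ hx, glue_apply_of_notMem G g hx]
  · intro τ _ τ' _ h
    exact glue_injective G h
  · intro h hh
    simp only [Finset.mem_filter, Finset.mem_univ, true_and] at hh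
    obtain ⟨τ, rfl⟩ := exists_glue_eq G hh.2
    refine ⟨τ, ?_, rfl⟩
    simp only [Finset.mem_filter, Finset.mem_univ, true_and]
    exact (precedes_glue G).1 hh.1
  · intro τ _
    rw [moebius_glue, ← F.pairedMomentMul_generated]

/-- The free cumulant of generated paired tensors agrees with the one of the underlying graph as
soon as the free cumulants of smaller graphs mixing different labels vanish. -/
theorem pairedCumulant_generated_eq [DecidableEq L] (g : Perm (Σ l, (G l).Slot))
    (hg : ∃ x, a (g x).1 ≠ a x.1)
    (hK : ∀ k : Perm (Σ _ : GlueVertex G, Fin D), Precedes k (glue G g) → k ≠ glue G g →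
      (∃ x, a (k x).1.1 ≠ a x.1.1) →
      F.pairedCumulant k (fun w => F.basic (a w.1) (a w.1)) = 0) :
    F.pairedCumulant g (fun l => F.generated (G l) (a l)) =
      F.pairedCumulant (glue G g) (fun w => F.basic (a w.1) (a w.1)) := by
  classical
  rw [F.pairedCumulant_generated, pairedCumulant_eq_moebiusTransform]
  have key := sum_agree_eq_moebiusTransform (fun x : Σ _ : GlueVertex G, Fin D => a x.1.1)
    (fun τ => F.pairedMomentMul τ (fun w => F.basic (a w.1) (a w.1))) (glue G g)
    (Finset.univ.filter fun x => x ∉ Set.range (slotEmb G)) ?_ ?_ ?_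
  · rw [← key]
    refine Finset.sum_congr ?_ fun _ _ => rfl
    ext h
    simp
  · intro x hx
    simp only [Finset.mem_filter, Finset.mem_univ, true_and] at hx
    rw [glue_apply_of_notMem G g hx]
    rfl
  · obtain ⟨e, he⟩ := hg
    refine ⟨slotEmb G e, ?_⟩
    rw [glue_slotEmb]
    exact he
  · intro k h1 h2 h3
    rw [← pairedCumulant_eq_moebiusTransform]
    exact hK k h1 h2 h3

end PureTensorFamily

end TensorFreeness

end

noncomputable section

namespace TensorFreeness

/-! ### Trace-invariants with identity tensors -/

section Identity

variable {V : Type} {S : V → Type} [Fintype V] [DecidableEq V] [∀ v, Fintype (S v)]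
  [∀ v, DecidableEq (S v)]

/-- In `δ`, the identity tensor equates the index entering `e` with the one leaving it; taking `e`
out of its cycle turns it into a free loop, worth a factor `N`. -/
theorem pairedTrace_swap_apply_mul {N : ℕ} (δ : Perm (Σ v, S v)) (e : Σ v, S v) (he : δ e ≠ e)
    (P : ∀ v, (S v → Fin N) → (S v → Fin N) → ℂ) (hP : P e.1 = fun i j => if i = j then 1 else 0) :
    pairedTrace (swap e (δ e) * δ) P = N * pairedTrace δ P := by
  set δ' := swap e (δ e) * δ with hδ'
  set f := δ.symm e with hf
  have hfe : f ≠ e := by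
    intro h
    apply he
    rw [hf, Equiv.symm_apply_eq] at h
    exact h.symm
  have h1 : δ'.symm e = e := by
    rw [Equiv.symm_apply_eq, hδ', Perm.mul_apply, swap_apply_right]
  have h2 : δ'.symm (δ e) = f := by
    rw [Equiv.symm_apply_eq, hδ', Perm.mul_apply, hf, Equiv.apply_symm_apply, swap_apply_left]
  have h3 : ∀ x, x ≠ e → x ≠ δ e → δ'.symm x = δ.symm x := by
    intro x hx hx'
    rw [Equiv.symm_apply_eq, hδ', Perm.mul_apply, Equiv.apply_symm_apply,
      swap_apply_of_ne_of_ne hx hx']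
  have h4 : ∀ x, x ≠ e → δ'.symm x ≠ e := by
    intro x hx h
    rw [← h1] at h
    exact hx (δ'.symm.injective h)
  set T : Perm (Σ v, S v) → ((Σ v, S v) → Fin N) → ℂ := fun γ i =>
    ∏ v, P v (fun s => i ⟨v, s⟩) (fun s => i (γ.symm ⟨v, s⟩)) with hT
  have hTδ : ∀ i, T δ i = if i e = i f then T δ' i else 0 := by
    intro i
    split_ifs with h
    · have : ∀ x, i (δ.symm x) = i (δ'.symm x) := by
        intro x
        by_cases hx : x = e
        · rw [hx, h1, ← hf, h]
        · by_cases hx' : x = δ e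
          · rw [hx', h2, Equiv.symm_apply_apply, h]
          · rw [h3 x hx hx']
      simp only [hT, this]
    · refine Finset.prod_eq_zero (Finset.mem_univ e.1) ?_
      rw [hP]
      refine if_neg fun h' => h ?_
      exact congrFun h' e.2
  have hTu : ∀ i x, T δ' (Function.update i e x) = T δ' i := by
    intro i x
    refine Finset.prod_congr rfl fun v _ => ?_
    have key : ∀ y, y ≠ e → Function.update i e x y = i y := fun y hy =>
      Function.update_of_ne hy _ _
    by_cases hv : v = e.1
    · subst hv
      rw [hP]
      simp only
      refine if_congr ?_ rfl rfl
      rw [funext_iff, funext_iff]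
      refine forall_congr' fun s => ?_
      by_cases hs : (⟨e.1, s⟩ : Σ v, S v) = e
      · rw [hs, h1]; simp
      · rw [key _ hs, key _ (h4 _ hs)]
    · have hs : ∀ s : S v, (⟨v, s⟩ : Σ v, S v) ≠ e := fun s h => hv (congrArg Sigma.fst h)
      simp only [key _ (hs _), key _ (h4 _ (hs _))]
  -- Realize the factor `N` as an extra free index and exchange it with the index at `e`, on which
  -- the summand for `δ'` does not depend. The constraint then bears on the extra index alone, and
  -- summing over it removes the constraint.
  let Φ : ((Σ v, S v) → Fin N) × Fin N → ((Σ v, S v) → Fin N) × Fin N :=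
    fun p => (Function.update p.1 e p.2, p.1 e)
  have hΦ : Function.Involutive Φ := by
    rintro ⟨i, x⟩
    simp [Φ]
  change ∑ i, T δ' i = N * ∑ i, T δ i
  simp only [hTδ]
  have e1 : (N : ℂ) * ∑ i, (if i e = i f then T δ' i else 0) =
      ∑ p : ((Σ v, S v) → Fin N) × Fin N, if p.1 e = p.1 f then T δ' p.1 else 0 := by
    rw [Fintype.sum_prod_type_right]
    simp
  rw [e1, ← Equiv.sum_comp (hΦ.toPerm Φ)]
  have e2 : ∀ p, (if ((hΦ.toPerm Φ) p).1 e = ((hΦ.toPerm Φ) p).1 f then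
      T δ' ((hΦ.toPerm Φ) p).1 else 0) = if p.2 = p.1 f then T δ' p.1 else 0 := by
    intro p
    change (if Function.update p.1 e p.2 e = Function.update p.1 e p.2 f then
      T δ' (Function.update p.1 e p.2) else 0) = _
    rw [hTu, Function.update_self, Function.update_of_ne hfe]
  simp only [e2, Fintype.sum_prod_type]
  simp

theorem pairedTrace_split {N : ℕ} {p : V → Prop} [Fintype {v // p v}] [Fintype {v // ¬ p v}]
    {δ₁ : Perm (Σ v : {v // p v}, S v.1)} {δ₂ : Perm (Σ v : {v // ¬ p v}, S v.1)}
    {γ : Perm (Σ v, S v)}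
    (h₁ : IsRestriction Subtype.val δ₁ γ) (h₂ : IsRestriction Subtype.val δ₂ γ)
    (P : ∀ v, (S v → Fin N) → (S v → Fin N) → ℂ) :
    pairedTrace γ P = pairedTrace δ₁ (fun v => P v.1) * pairedTrace δ₂ (fun v => P v.1) := by
  classical
  rw [prod_pairedTrace_graphRestrict Subtype.val_injective h₁ P,
    prod_pairedTrace_graphRestrict Subtype.val_injective h₂ P, ← Fintype.prod_sumElim,
    pairedTrace_eq_prod]
  refine (Fintype.prod_bijective _ (numComp_split h₁ h₂) _ _ fun x => ?_).symm
  rcases x with x | x <;> rfl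

/-- The slots of the thick edges in `A` can be removed from a graph. -/
theorem exists_remove_vertices (g : Perm (Σ v, S v)) (A : Finset V) :
    ∃ δ : Perm (Σ v, S v), Precedes δ g ∧
      (∀ τ, Precedes τ g → (Precedes τ δ ↔ ∀ e : Σ v, S v, e.1 ∈ A → τ e = e)) ∧
      ∀ (N : ℕ) (P : ∀ v, (S v → Fin N) → (S v → Fin N) → ℂ),
        (∀ v ∈ A, P v = fun i j => if i = j then 1 else 0) →
        (N : ℂ) ^ permLength g * pairedTrace g P = (N : ℂ) ^ permLength δ * pairedTrace δ P := by
  let Q : Perm (Σ v, S v) → Prop := fun δ =>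
    ∀ (N : ℕ) (P : ∀ v, (S v → Fin N) → (S v → Fin N) → ℂ),
      (∀ v ∈ A, P v = fun i j => if i = j then 1 else 0) →
      (N : ℂ) ^ permLength g * pairedTrace g P = (N : ℂ) ^ permLength δ * pairedTrace δ P
  have hstep : ∀ δ e, e ∈ Finset.univ.filter (fun e : Σ v, S v => e.1 ∈ A) → Q δ → δ e ≠ e →
      Q (swap e (δ e) * δ) := by
    intro δ e he hQ hne N P hP
    simp only [Finset.mem_filter, Finset.mem_univ, true_and] at he
    rw [hQ N P hP, pairedTrace_swap_apply_mul δ e hne P (hP _ he), ← exists_swap_mul hne,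
      pow_succ, mul_assoc]
  obtain ⟨δ, h1, h2, h3⟩ := exists_remove g _ Q (fun _ _ _ => rfl) hstep
  refine ⟨δ, h2, fun τ hτ => ?_, h1⟩
  rw [h3 τ hτ]
  simp

omit [DecidableEq V] [∀ v, DecidableEq (S v)] in
theorem pairedTrace_one_id [DecidableEq V] [∀ v, DecidableEq (S v)] (N : ℕ) :
    pairedTrace (1 : Perm (Σ v, S v)) (fun v (i j : S v → Fin N) => if i = j then (1 : ℂ) else 0) =
      (N : ℂ) ^ ∑ v, Fintype.card (S v) := by
  unfold pairedTrace
  have : ∀ x : Σ v, S v, (1 : Perm (Σ v, S v)).symm x = x := fun x => rfl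
  simp [this]

end Identity

theorem integrable_prod_of_memLp {Ω : Type*} [MeasurableSpace Ω] {μ : Measure Ω}
    [IsFiniteMeasure μ] {κ : Type*} [Fintype κ] (f : κ → Ω → ℂ)
    (hf : ∀ k (p : ℕ), MemLp (f k) p μ) : Integrable (fun ω => ∏ k, f k ω) μ := by
  refine (MemLp.prod' (s := Finset.univ) (f := f) (p := fun _ => (Fintype.card κ : ENNReal))
    fun k _ => hf k _).integrable ?_
  rw [ENNReal.one_le_inv, Finset.sum_const, Finset.card_univ, nsmul_eq_mul]
  exact ENNReal.mul_inv_le_one _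

namespace PureTensorFamily

variable {D : ℕ} {I : Type*} (F : PureTensorFamily D I)

theorem integrable_pairedTrace_basic {V : Type} [Fintype V] [DecidableEq V]
    (γ : Perm (Σ _ : V, Fin D)) (x x' : V → I) (N : ℕ) :
    Integrable (fun ω => pairedTrace γ (fun v => F.basic (x v) (x' v) N ω)) (F.P N) := by
  unfold pairedTrace
  refine integrable_finsetSum _ fun i _ => ?_
  have := integrable_prod_of_memLp (μ := F.P N) (κ := V ⊕ V) (Sum.elim
    (fun v ω => F.T (x v) N ω (fun s => i ⟨v, s⟩))
    (fun v ω => F.Tbar (x' v) N ω (fun s => i (γ.symm ⟨v, s⟩)))) ?_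
  · refine this.congr (Eventually.of_forall fun ω => ?_)
    simp only [Fintype.prod_sum_type, Sum.elim_inl, Sum.elim_inr]
    rw [← Finset.prod_mul_distrib]
    rfl
  · rintro (v | v) p
    · exact F.memLp_T _ _ _ _
    · exact F.memLp_Tbar _ _ _ _

theorem integrable_pairedTrace_generated {L : Type} [Fintype L] [DecidableEq L]
    (G : L → GeneratedShape D) (a : L → I) (τ : Perm (Σ l, (G l).Slot)) (N : ℕ) :
    Integrable (fun ω => pairedTrace τ (fun l => F.generated (G l) (a l) N ω)) (F.P N) :=
  (F.integrable_pairedTrace_basic (glue G τ) (fun w => a w.1) (fun w => a w.1) N).congr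
    (Eventually.of_forall fun ω => (F.pairedTrace_generated G a τ N ω).symm)

theorem pairedMomentMul_one {V : Type} {S : V → Type} [Fintype V] [∀ v, Fintype (S v)]
    (H : ∀ v, F.RandomPaired (S v)) :
    F.pairedMomentMul (1 : Perm (Σ v, S v)) H = ∏ v, F.phi (H v) := by
  classical
  have h0 : graphSetoid (1 : Perm (Σ v, S v)) = ⊥ := by
    refine le_bot_iff.1 (graphSetoid_le_iff.2 fun e => rfl)
  have hb : Function.Bijective
      (fun v => (Quotient.mk _ v : GraphComponent (1 : Perm (Σ v, S v)))) := by
    refine ⟨fun v w h => ?_, fun C => Quotient.exists_rep C⟩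
    have := Quotient.exact h
    change graphSetoid (1 : Perm (Σ v, S v)) v w at this
    rw [h0] at this
    exact this
  refine (Fintype.prod_bijective _ hb _ _ fun v => ?_).symm
  have hι : Function.Injective (fun _ : Unit => v) := fun _ _ _ => rfl
  have h1 : IsRestriction (S := S) (fun _ : Unit => v) 1 1 := fun e => rfl
  have h2 := F.pairedMomentMul_eq_prod hι h1 H
  have h3 : numComp (1 : Perm (Σ _ : Unit, S v)) = 1 := by rw [numComp_one]; simp
  rw [F.pairedMomentMul_of_connected h3] at h2
  obtain ⟨h4, ⟨B⟩⟩ := Nat.card_eq_one_iff_unique.1 h3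
  have : Unique (GraphComponent (1 : Perm (Σ _ : Unit, S v))) := ⟨⟨B⟩, fun x => h4.elim _ _⟩
  rw [Fintype.prod_unique] at h2
  refine h2.trans ?_
  have h5 : ∀ B : GraphComponent (1 : Perm (Σ _ : Unit, S v)),
      F.pairedMoment (graphRestrict 1 (h1.compMap hι B)) (fun w => H w.1) =
        F.pairedMoment (graphRestrict 1 (Quotient.mk _ v)) (fun w => H w.1) := by
    rintro ⟨⟨⟩⟩
    rfl
  exact h5 _

end PureTensorFamily

end TensorFreeness

end

noncomputable section

namespace TensorFreeness

/-! ### Moments of centered paired tensors -/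

section Expand

variable {V : Type} {S : V → Type} [Fintype V] [DecidableEq V] [∀ v, Fintype (S v)]
  [∀ v, DecidableEq (S v)]

theorem pairedTrace_sub {N : ℕ} (γ : Perm (Σ v, S v))
    (P Q : ∀ v, (S v → Fin N) → (S v → Fin N) → ℂ) (c : V → ℂ) :
    pairedTrace γ (fun v i j => P v i j - c v * Q v i j) =
      ∑ A : Finset V, (∏ v ∈ A, -c v) * pairedTrace γ (fun v => if v ∈ A then Q v else P v) := by
  unfold pairedTrace
  simp only [Finset.mul_sum]
  rw [Finset.sum_comm]
  refine Finset.sum_congr rfl fun i _ => ?_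
  have h1 : ∀ v, P v (fun s => i ⟨v, s⟩) (fun s => i (γ.symm ⟨v, s⟩)) -
      c v * Q v (fun s => i ⟨v, s⟩) (fun s => i (γ.symm ⟨v, s⟩)) =
      -c v * Q v (fun s => i ⟨v, s⟩) (fun s => i (γ.symm ⟨v, s⟩)) +
      P v (fun s => i ⟨v, s⟩) (fun s => i (γ.symm ⟨v, s⟩)) := fun v => by ring
  simp only [h1]
  rw [Finset.prod_add, Finset.powerset_univ]
  refine Finset.sum_congr rfl fun A _ => ?_
  rw [Finset.prod_mul_distrib, mul_assoc]
  congr 1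
  rw [← Finset.prod_mul_prod_compl A, ← Finset.compl_eq_univ_sdiff]
  congr 1
  · exact Finset.prod_congr rfl fun v hv => by rw [if_pos hv]
  · exact Finset.prod_congr rfl fun v hv => by rw [if_neg (Finset.mem_compl.1 hv)]

/-- Inclusion-exclusion: for fixed `τ`, the admissible `A` are the subsets of the set of thick edges
isolated by `τ`, and their alternating sum vanishes unless that set is empty. -/
theorem sum_neg_one_pow_card_mul {g : Perm (Σ v, S v)} (K : Perm (Σ v, S v) → ℂ)
    [DecidablePred fun τ : Perm (Σ v, S v) =>
      Precedes τ g ∧ ∀ v, ∃ s, τ ⟨v, s⟩ ≠ ⟨v, s⟩]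
    [∀ A : Finset V, DecidablePred fun τ : Perm (Σ v, S v) =>
      Precedes τ g ∧ ∀ e : Σ v, S v, e.1 ∈ A → τ e = e] :
    ∑ A : Finset V, (-1 : ℂ) ^ A.card *
        ∑ τ with Precedes τ g ∧ ∀ e : Σ v, S v, e.1 ∈ A → τ e = e, K τ =
      ∑ τ with Precedes τ g ∧ ∀ v, ∃ s, τ ⟨v, s⟩ ≠ ⟨v, s⟩, K τ := by
  classical
  simp only [Finset.mul_sum, Finset.sum_filter]
  rw [Finset.sum_comm]
  refine Finset.sum_congr rfl fun τ _ => ?_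
  by_cases hτ : Precedes τ g
  · simp only [hτ, true_and]
    set B : Finset V := Finset.univ.filter fun v => ∀ s, τ ⟨v, s⟩ = ⟨v, s⟩ with hB
    have h1 : ∀ A : Finset V, (∀ e : Σ v, S v, e.1 ∈ A → τ e = e) ↔ A ∈ B.powerset := by
      intro A
      rw [Finset.mem_powerset]
      constructor
      · intro h v hv
        simp only [hB, Finset.mem_filter, Finset.mem_univ, true_and]
        exact fun s => h ⟨v, s⟩ hv
      · rintro h ⟨v, s⟩ hv
        have := h hv
        simp only [hB, Finset.mem_filter, Finset.mem_univ, true_and] at this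
        exact this s
    simp only [h1]
    simp only [mul_ite, mul_zero]
    rw [Finset.sum_ite_mem, Finset.univ_inter, ← Finset.sum_mul]
    have h2 := Finset.sum_powerset_neg_one_pow_card (x := B)
    have h3 : (∑ A ∈ B.powerset, (-1 : ℂ) ^ A.card) = if B = ∅ then 1 else 0 := by
      have := congrArg (Int.cast : ℤ → ℂ) h2
      push_cast at this
      exact this
    rw [h3]
    have h4 : B = ∅ ↔ ∀ v, ∃ s, τ ⟨v, s⟩ ≠ ⟨v, s⟩ := by
      rw [Finset.eq_empty_iff_forall_notMem]
      simp [hB]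
    simp only [h4, ite_mul, one_mul, zero_mul]
  · simp [hτ]

end Expand

/-- Ensures that the natural number subtraction in the normalization of `centered` is exact. -/
theorem GeneratedShape.card_slot_pos {D : ℕ} (hD : 1 ≤ D) (G : GeneratedShape D) :
    0 < Fintype.card G.Slot := by
  have h := G.permLength_add_one
  obtain ⟨t, ht, _⟩ := G.cut_spec ⟨0, hD⟩ ⟨0, by omega⟩
  exact Fintype.card_pos_iff.2 ⟨⟨_, ht.1⟩⟩

namespace PureTensorFamily

variable {D : ℕ} {I : Type*} {F : PureTensorFamily D I} {L : Type} [Fintype L]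
  (G : L → GeneratedShape D) (a : L → I)

/-- The contribution of the identity tensors put on the thick edges in `A` to the moments of
centered paired tensors. -/
theorem HasGaussianScaling.exists_centered_term [DecidableEq L] (hD : 2 ≤ D)
    (hF : F.HasGaussianScaling) {g : Perm (Σ l, (G l).Slot)}
    (hg : ColorPreserving (fun l => (G l).color) g) (hm : IsMelonic g) (A : Finset L) :
    ∃ (δ : Perm (Σ l, (G l).Slot)) (X : ∀ N, F.Ω N → ℂ), Precedes δ g ∧
      (∀ τ, Precedes τ g → (Precedes τ δ ↔ ∀ e : Σ l, (G l).Slot, e.1 ∈ A → τ e = e)) ∧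
      (∀ N, Integrable (X N) (F.P N)) ∧
      (∀ N ω, 1 ≤ N → X N ω = (∏ l ∈ A, -(F.phi (F.generated (G l) (a l)) /
          (N : ℂ) ^ (Fintype.card (G l).Slot - 1))) *
        pairedTrace g (fun l => if l ∈ A then fun i j => if i = j then 1 else 0
          else F.generated (G l) (a l) N ω)) ∧
      Tendsto (fun N : ℕ => (∫ ω, X N ω ∂(F.P N)) / N) atTop
        (𝓝 ((-1) ^ A.card * F.pairedMomentMul δ (fun l => F.generated (G l) (a l)))) := by
  classical
  obtain ⟨δ, h1, h2, h3⟩ := exists_remove_vertices g A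
  have hfix := (h2 δ h1).1 (Precedes.refl δ)
  obtain ⟨hgf, hg1⟩ := isMelonic_iff.1 hm
  have hδf := (hgf.of_precedes h1).1
  have hδc : ColorPreserving (fun l => (G l).color) δ :=
    h1.comp_eq (a := fun e : Σ l, (G l).Slot => (G e.1).color e.2) hg
  have r1 : IsRestriction (S := fun l => (G l).Slot) (Subtype.val : {l // l ∈ A} → L) 1 δ :=
    fun e => hfix _ e.1.2
  obtain ⟨δ₂, r2⟩ := exists_isRestriction δ (fun l => ¬ l ∈ A) (fun e => by
    by_cases he : e.1 ∈ A
    · rw [hfix e he]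
    · have h4 : (δ e).1 ∉ A := fun h4 => by
        have h5 := δ.injective (hfix (δ e) h4)
        rw [h5] at h4
        exact he h4
      simp [he, h4])
  have hδ₂f : IsForest δ₂ := hδf.restriction r2
  have hδ₂c : ColorPreserving (fun l : {l // ¬ l ∈ A} => (G l.1).color) δ₂ := by
    intro e
    have h4 := hδc (slotMap Subtype.val e)
    rw [r2 e] at h4
    exact h4
  set H : ∀ l, F.RandomPaired (G l).Slot := fun l => F.generated (G l) (a l) with hH
  set C : ℂ := (-1) ^ A.card * ∏ l ∈ A, F.phi (H l) with hC
  set a₀ := ∑ l ∈ A, (Fintype.card (G l).Slot - 1) with ha₀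
  -- Compare the forest equations of `g`, which is connected, and of `δ`, whose components are the
  -- `|A|` isolated thick edges and those of `δ₂`. This balances the powers of `N`: a factor `N / N
  -- ^ numComp δ₂` remains in front of the trace of `δ₂`.
  have hcount : permLength g + 1 = A.card + numComp δ₂ + permLength δ := by
    have e1 := Nat.card_eq_of_bijective _ (numComp_split r1 r2)
    rw [Nat.card_sum] at e1
    have e2 := numComp_one (V := {l // l ∈ A}) (S := fun l => (G l.1).Slot)
    have e3 : Nat.card {l // l ∈ A} = A.card := by simp
    unfold IsForest at hgf hδf
    unfold numComp at *
    omega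
  have hcard : ∑ l : {l // l ∈ A}, Fintype.card (G l.1).Slot = a₀ + A.card := by
    rw [Finset.sum_coe_sort A (fun l => Fintype.card (G l).Slot), ha₀, Finset.card_eq_sum_ones,
      ← Finset.sum_add_distrib]
    refine Finset.sum_congr rfl fun l _ => ?_
    have := (G l).card_slot_pos (by omega)
    omega
  have htend := HasGaussianScaling.tendsto_generated (fun l : {l // ¬ l ∈ A} => G l.1)
    (fun l => a l.1) hD hF hδ₂c hδ₂f
  have hint := F.integrable_pairedTrace_generated (fun l : {l // ¬ l ∈ A} => G l.1)
    (fun l => a l.1) δ₂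
  refine ⟨δ, fun N ω => C * ((N : ℂ) / (N : ℂ) ^ numComp δ₂) *
    pairedTrace δ₂ (fun l => F.generated (G l.1) (a l.1) N ω), h1, h2,
    fun N => (hint N).const_mul _, ?_, ?_⟩
  · intro N ω hN
    have hN0 : (N : ℂ) ≠ 0 := by exact_mod_cast (by omega : N ≠ 0)
    have e1 := h3 N (fun l => if l ∈ A then fun i j => if i = j then 1 else 0 else H l N ω)
      (fun l hl => by simp only [hl, if_true])
    rw [pairedTrace_split r1 r2] at e1
    have e2 : pairedTrace (1 : Perm (Σ l : {l // l ∈ A}, (G l.1).Slot)) (fun l => if l.1 ∈ A then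
        fun (i j : (G l.1).Slot → Fin N) => if i = j then (1 : ℂ) else 0 else H l.1 N ω) =
        (N : ℂ) ^ (a₀ + A.card) := by
      rw [← hcard, ← pairedTrace_one_id]
      congr 1
      funext l
      rw [if_pos l.2]
    have e3 : pairedTrace δ₂ (fun l => if l.1 ∈ A then
        fun (i j : (G l.1).Slot → Fin N) => if i = j then (1 : ℂ) else 0 else H l.1 N ω) =
        pairedTrace δ₂ (fun l => H l.1 N ω) := by
      congr 1
      funext l
      rw [if_neg l.2]
    have e4 : (∏ l ∈ A, -(F.phi (H l) / (N : ℂ) ^ (Fintype.card (G l).Slot - 1))) =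
        C / (N : ℂ) ^ a₀ := by
      rw [Finset.prod_neg, Finset.prod_div_distrib, Finset.prod_pow_eq_pow_sum, hC, ha₀,
        mul_div_assoc]
    rw [e4]
    set Y := pairedTrace δ₂ (fun l => H l.1 N ω) with hY
    set Z := pairedTrace g (fun l => if l ∈ A then fun i j => if i = j then 1 else 0
      else H l N ω) with hZ
    have e5 : (N : ℂ) ^ permLength g * Z =
        (N : ℂ) ^ permLength δ * ((N : ℂ) ^ (a₀ + A.card) * Y) := by
      rw [e1]
      congr 2
    have e6 : (N : ℂ) * Y * (N : ℂ) ^ a₀ = Z * (N : ℂ) ^ numComp δ₂ := by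
      apply mul_left_cancel₀ (pow_ne_zero (permLength g) hN0)
      have e7 : (N : ℂ) ^ permLength g * (Z * (N : ℂ) ^ numComp δ₂) =
          (N : ℂ) ^ (A.card + numComp δ₂ + permLength δ) * (N : ℂ) ^ a₀ * Y := by
        rw [← mul_assoc, e5]; ring
      rw [e7, ← hcount]
      ring
    change C * ((N : ℂ) / (N : ℂ) ^ numComp δ₂) * Y = C / (N : ℂ) ^ a₀ * Z
    field_simp
    linear_combination C * e6
  · have e1 : (-1 : ℂ) ^ A.card * F.pairedMomentMul δ H =
        C * F.pairedMomentMul δ₂ (fun l => F.generated (G l.1) (a l.1)) := by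
      rw [F.pairedMomentMul_split r1 r2 H, F.pairedMomentMul_one,
        Finset.prod_coe_sort A (fun l => F.phi (H l)), hC, mul_assoc]
    rw [e1]
    refine (htend.const_mul C).congr' ?_
    filter_upwards [eventually_ge_atTop 1] with N hN
    have hN0 : (N : ℂ) ≠ 0 := by exact_mod_cast (by omega : N ≠ 0)
    rw [integral_const_mul]
    field_simp

/-- The asymptotic moments of centered paired tensors in terms of free cumulants. -/
theorem HasGaussianScaling.tendsto_centered [DecidableEq L] (hD : 2 ≤ D)
    (hF : F.HasGaussianScaling) {g : Perm (Σ l, (G l).Slot)}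
    (hg : ColorPreserving (fun l => (G l).color) g) (hm : IsMelonic g)
    [DecidablePred fun τ : Perm (Σ l, (G l).Slot) =>
      Precedes τ g ∧ ∀ l, ∃ s, τ ⟨l, s⟩ ≠ ⟨l, s⟩] :
    Tendsto (F.rescaledPairedMoment g (fun l => F.centered (F.generated (G l) (a l)))) atTop
      (𝓝 (∑ τ with Precedes τ g ∧ ∀ l, ∃ s, τ ⟨l, s⟩ ≠ ⟨l, s⟩,
        F.pairedCumulant τ (fun l => F.generated (G l) (a l)))) := by
  classical
  choose δ X h1 h2 h3 h4 h5 using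
    HasGaussianScaling.exists_centered_term G a hD hF hg hm
  have h6 := tendsto_finsetSum Finset.univ fun A _ => h5 A
  -- By Möbius inversion the moment of `δ A` is a sum of cumulants over `τ ⪯ δ A`, that is, over the
  -- `τ ⪯ g` fixing all slots in `A`; this makes inclusion-exclusion over `A` available.
  have e1 : ∀ A, F.pairedMomentMul (δ A) (fun l => F.generated (G l) (a l)) =
      ∑ τ with Precedes τ g ∧ ∀ e : Σ l, (G l).Slot, e.1 ∈ A → τ e = e,
        F.pairedCumulant τ (fun l => F.generated (G l) (a l)) := by
    intro A
    rw [← sum_moebiusTransform (fun τ => F.pairedMomentMul τ fun l => F.generated (G l) (a l))]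
    refine Finset.sum_congr ?_ fun τ _ => (F.pairedCumulant_eq_moebiusTransform τ _).symm
    ext τ
    simp only [Finset.mem_filter, Finset.mem_univ, true_and]
    constructor
    · intro h
      exact ⟨h.trans (h1 A), (h2 A τ (h.trans (h1 A))).1 h⟩
    · rintro ⟨h, h'⟩
      exact (h2 A τ h).2 h'
  simp only [e1] at h6
  rw [sum_neg_one_pow_card_mul] at h6
  refine h6.congr' ?_
  filter_upwards [eventually_ge_atTop 1] with N hN
  unfold rescaledPairedMoment
  rw [← Finset.sum_div, ← integral_finsetSum _ fun A _ => h3 A N]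
  congr 2
  funext ω
  simp only [fun A => h4 A N ω hN]
  rw [← pairedTrace_sub]
  unfold pairedTrace
  refine Finset.sum_congr ?_ fun i _ => ?_
  · ext; simp
  refine Finset.prod_congr rfl fun l _ => ?_
  unfold centered
  beta_reduce
  rw [div_mul_eq_mul_div, mul_div_assoc]

end PureTensorFamily

end TensorFreeness

end

noncomputable section

namespace TensorFreeness

/-! ### Cutting graphs of pure tensors into generated paired tensors -/

theorem sameCycle_iff_of_semiconj {α β : Type} {σ : Perm β} {ρ : Perm α} {m : α → β}
    (hm : Function.Injective m) (h : ∀ s, σ (m s) = m (ρ s)) (s t : α) :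
    ρ.SameCycle s t ↔ σ.SameCycle (m s) (m t) := by
  have h1 : ∀ k : ℕ, ∀ s, (σ ^ k) (m s) = m ((ρ ^ k) s) := by
    intro k
    induction k with
    | zero => intro s; rfl
    | succ k ih => intro s; rw [pow_succ, pow_succ, Perm.mul_apply, h, ih]; rfl
  have h2 : ∀ k : ℤ, ∀ s, (σ ^ k) (m s) = m ((ρ ^ k) s) := by
    intro k s
    obtain ⟨k, rfl | rfl⟩ := Int.eq_nat_or_neg k
    · rw [zpow_natCast, zpow_natCast, h1]
    · rw [zpow_neg, zpow_natCast, Perm.inv_eq_iff_eq, h1, zpow_neg, zpow_natCast,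
        ← Perm.mul_apply, mul_inv_cancel, Perm.one_apply]
  exact exists_congr fun k => by rw [h2, hm.eq_iff]

section Cutting

variable {D : ℕ} {V : Type} {I : Type*}

/-- The graph `γ` is obtained by joining the cycles of the label preserving graph `σ` at the
edges in `T`. -/
structure IsCutting (γ : Perm (Σ _ : V, Fin D)) (y : V → I) (σ : Perm (Σ _ : V, Fin D))
    (T : Finset (Σ _ : V, Fin D)) : Prop where
  agree : ∀ e ∉ T, σ e = γ e
  label : ∀ e, y (σ e).1 = y e.1
  existsUnique : ∀ e, ∃! t, t ∈ T ∧ σ.SameCycle e t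

theorem IsCutting.eq_of_sameCycle {γ : Perm (Σ _ : V, Fin D)} {y : V → I}
    {σ : Perm (Σ _ : V, Fin D)} {T : Finset (Σ _ : V, Fin D)} (h : IsCutting γ y σ T)
    {e f : Σ _ : V, Fin D} (he : e ∈ T) (hf : f ∈ T) (hef : σ.SameCycle e f) : e = f := by
  obtain ⟨u, _, hu⟩ := h.existsUnique e
  rw [hu e ⟨he, Perm.SameCycle.refl _ _⟩, hu f ⟨hf, hef⟩]

variable [Fintype V] [DecidableEq V]

theorem isCutting_one (γ : Perm (Σ _ : V, Fin D)) (y : V → I) :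
    IsCutting γ y 1 Finset.univ where
  agree e he := absurd (Finset.mem_univ e) he
  label _ := rfl
  existsUnique e := ⟨e, ⟨Finset.mem_univ e, Perm.SameCycle.refl _ _⟩, fun t ht => by
    have := ht.2
    rw [Perm.sameCycle_one] at this
    exact this.symm⟩

/-- The condition `σ f = γ e` says that the edge of `γ` leaving `e` arrives at the input of the slot
`f`. Multiplying by the transposition restores this edge, merges the two cycles, and leaves `f` as
the cut edge of the merged cycle. -/
theorem IsCutting.merge {γ : Perm (Σ _ : V, Fin D)} {y : V → I}
    {σ : Perm (Σ _ : V, Fin D)} {T : Finset (Σ _ : V, Fin D)} (h : IsCutting γ y σ T)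
    {e f : Σ _ : V, Fin D} (he : e ∈ T) (hf : f ∈ T) (hσ : σ f = γ e) (hne : e ≠ f)
    (hy : y e.1 = y f.1) : IsCutting γ y (σ * swap e f) (T.erase e) := by
  classical
  have hef : ¬ σ.SameCycle e f := fun h' => hne (h.eq_of_sameCycle he hf h')
  have hle : Precedes σ (σ * swap e f) := by
    rw [precedes_iff, inv_mul_cancel_left]
    have h1 := permLength_mul_swap_of_not_sameCycle hef
    have h2 : permLength (swap e f) = 1 := by
      have h3 := exists_swap_mul (τ := swap e f) (e := e) (by simpa using hne.symm)
      rw [swap_apply_left, swap_mul_self, permLength_one] at h3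
      omega
    omega
  constructor
  · intro x hx
    by_cases hxe : x = e
    · rw [hxe, Perm.mul_apply, swap_apply_left, hσ]
    · have hxT : x ∉ T := fun hT => hx (Finset.mem_erase.2 ⟨hxe, hT⟩)
      have hxf : x ≠ f := fun hxf => hxT (hxf ▸ hf)
      rw [Perm.mul_apply, swap_apply_of_ne_of_ne hxe hxf, h.agree x hxT]
  · intro x
    rw [Perm.mul_apply, h.label]
    by_cases hxe : x = e
    · rw [hxe, swap_apply_left, hy]
    · by_cases hxf : x = f
      · rw [hxf, swap_apply_right, hy]
      · rw [swap_apply_of_ne_of_ne hxe hxf]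
  · intro x
    let r := Perm.SameCycle.setoid σ
    -- This map identifies the `σ`-cycle of `e` with that of `f`. It is constant on the merged
    -- cycles and separates the points of `T.erase e`, which gives uniqueness.
    let a : (Σ _ : V, Fin D) → Quotient r := fun x =>
      if σ.SameCycle x e then Quotient.mk r f else Quotient.mk r x
    have hfe : ¬ σ.SameCycle f e := fun h' => hef h'.symm
    have hax : ∀ x, a (σ x) = a x := by
      intro x
      simp only [a, Perm.sameCycle_apply_left]
      split_ifs
      · rfl
      · exact Quotient.sound (Perm.sameCycle_apply_left.2 (Perm.SameCycle.refl _ _))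
    have ha : ∀ x, a ((σ * swap e f) x) = a x := by
      intro x
      rw [Perm.mul_apply, hax]
      have hae : a e = a f := by
        simp only [a, hfe, if_false, Perm.SameCycle.refl, if_true]
      by_cases hxe : x = e
      · rw [hxe, swap_apply_left, hae]
      · by_cases hxf : x = f
        · rw [hxf, swap_apply_right, hae]
        · rw [swap_apply_of_ne_of_ne hxe hxf]
    obtain ⟨t, ⟨htT, hxt⟩, htu⟩ := h.existsUnique x
    have hex : ∃ t, t ∈ T.erase e ∧ (σ * swap e f).SameCycle x t := by
      by_cases hte : t = e
      · refine ⟨f, Finset.mem_erase.2 ⟨hne.symm, hf⟩, (hle.sameCycle hxt).trans ?_⟩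
        rw [hte]
        exact sameCycle_mul_swap_of_not hef
      · exact ⟨t, Finset.mem_erase.2 ⟨hte, htT⟩, hle.sameCycle hxt⟩
    have hval : ∀ t ∈ T.erase e, a t = Quotient.mk r t := by
      intro t ht
      refine if_neg fun h' => (Finset.mem_erase.1 ht).1 ?_
      exact h.eq_of_sameCycle (Finset.mem_erase.1 ht).2 he h'
    refine existsUnique_of_exists_of_unique hex fun t₁ t₂ h₁ h₂ => ?_
    have h3 := sameCycle_comp_eq ha (h₁.2.symm.trans h₂.2)
    rw [hval t₁ h₁.1, hval t₂ h₂.1] at h3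
    exact h.eq_of_sameCycle (Finset.mem_erase.1 h₁.1).2 (Finset.mem_erase.1 h₂.1).2
      (Quotient.exact h3)

/-- Every graph has a cutting such that no edge links two different components with the same
label. -/
theorem exists_alternating_cutting (γ : Perm (Σ _ : V, Fin D)) (y : V → I) :
    ∃ σ T, IsCutting γ y σ T ∧
      ∀ e ∈ T, ∀ f ∈ T, σ f = γ e → e ≠ f → y e.1 ≠ y f.1 := by
  classical
  have key : ∀ n, ∀ σ T, IsCutting γ y σ T → T.card = n → ∃ σ T, IsCutting γ y σ T ∧
      ∀ e ∈ T, ∀ f ∈ T, σ f = γ e → e ≠ f → y e.1 ≠ y f.1 := by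
    intro n
    induction n with
    | zero =>
      intro σ T h hT
      rw [Finset.card_eq_zero] at hT
      subst hT
      exact ⟨σ, ∅, h, by simp⟩
    | succ n ih =>
      intro σ T h hT
      by_cases hgood : ∀ e ∈ T, ∀ f ∈ T, σ f = γ e → e ≠ f → y e.1 ≠ y f.1
      · exact ⟨σ, T, h, hgood⟩
      · push Not at hgood
        obtain ⟨e, he, f, hf, h1, h2, h3⟩ := hgood
        exact ih _ _ (h.merge he hf h1 h2 h3) (by rw [Finset.card_erase_of_mem he, hT]; rfl)
  exact key _ _ _ (isCutting_one γ y) rfl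

/-- The permutation `σ⁻¹ * γ` only moves points of `T`, of which there is one per cycle of `σ`, so
lengths add. -/
theorem IsCutting.precedes {γ : Perm (Σ _ : V, Fin D)} {y : V → I}
    {σ : Perm (Σ _ : V, Fin D)} {T : Finset (Σ _ : V, Fin D)} (h : IsCutting γ y σ T) :
    Precedes σ γ := by
  have hT : ∀ x, (σ⁻¹ * γ) x ≠ x → x ∈ T := by
    intro x hx
    by_contra hxT
    exact hx (by rw [Perm.mul_apply, ← h.agree x hxT]; exact Equiv.symm_apply_apply σ x)
  have h1 := permLength_mul_of_transversal σ (σ⁻¹ * γ) fun x y hx hy hxy =>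
    h.eq_of_sameCycle (hT x hx) (hT y hy) hxy
  rw [mul_inv_cancel_left] at h1
  rw [precedes_iff, h1]

/-- `glueBase` is the gluing of the trivial graph, so it has one component per element of `L`; its
Euler bound is subtracted from the forest equation of the glued graph. -/
theorem isForest_of_glue {L : Type} [Fintype L] [DecidableEq L] (G : L → GeneratedShape D)
    {τ : Perm (Σ l, (G l).Slot)} (h : IsForest (glue G τ)) : IsForest τ := by
  have h1 := card_le_numComp_add (glueBase G)
  have h2 : numComp (glueBase G) = Nat.card L := by
    rw [← numComp_one (S := fun l => (G l).Slot), ← numComp_glue]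
    congr 1
    rw [glue]
    have : (1 : Perm (Σ l, (G l).Slot)).viaEmbedding (slotEmb G) = 1 := by
      rw [← Perm.viaEmbeddingHom_apply, map_one]
    rw [this, mul_one]
  have h3 := permLength_glue G τ
  rw [isForest_iff_le]
  unfold IsForest at h
  rw [numComp_glue] at h
  omega

/-- A cutting of a melonic graph presents it as a melonic graph of generated paired tensors. -/
theorem IsCutting.exists_glue {γ : Perm (Σ _ : V, Fin D)} {y : V → I}
    {σ : Perm (Σ _ : V, Fin D)} {T : Finset (Σ _ : V, Fin D)} (h : IsCutting γ y σ T)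
    (hγc : ∀ e, (γ e).2 = e.2) (hγm : IsMelonic γ) :
    ∃ (q : ℕ) (a : Fin q → I) (G : Fin q → GeneratedShape D) (g : Perm (Σ l, (G l).Slot))
      (ι : GlueVertex G → V), Function.Bijective ι ∧
      IsRestriction (S := fun _ => Fin D) ι (glue G g) γ ∧ (∀ w, y (ι w) = a w.1) ∧
      ColorPreserving (fun l => (G l).color) g ∧ IsMelonic g ∧
      (∀ x, x ∈ Set.range (slotEmb G) ↔ slotMap (S := fun _ => Fin D) ι x ∈ T) ∧
      IsRestriction (S := fun _ => Fin D) ι (glueBase G) σ := by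
  classical
  obtain ⟨hγf, hγ1⟩ := isMelonic_iff.1 hγm
  have hσf := (hγf.of_precedes h.precedes).1
  have hσc := h.precedes.color_preserving hγc
  let E := (Fintype.equivFin (GraphComponent σ)).symm
  let ec : ∀ l, Fin (Fintype.card (Thick σ (E l))) ≃ Thick σ (E l) :=
    fun l => (Fintype.equivFin _).symm
  have hres : ∀ l, ∃ ρ : Fin D → Perm (Fin (Fintype.card (Thick σ (E l)))),
      IsRestriction (S := fun _ : Thick σ (E l) => Fin D) (ec l) (tupleGraph ρ)
        (graphRestrict σ (E l)) := fun l =>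
    exists_tupleGraph_isRestriction (ec l) (graphRestrict σ (E l)) fun e => hσc _
  choose ρ hρ using hres
  have hmel : ∀ l, IsMelonicTuple (ρ l) := by
    intro l
    refine (isMelonic_iff_of_isRestriction (ec l).bijective (hρ l)).2 (isMelonic_iff.2 ⟨?_, ?_⟩)
    · have h1 := hσf.restriction (graphRestrict_isRestriction σ (E l))
      convert h1
    · exact numComp_graphRestrict _ _
  have hρσ : ∀ l c s, σ ⟨(ec l s).1, c⟩ = ⟨(ec l (ρ l c s)).1, c⟩ := by
    intro l c s
    exact congrArg (slotMap (S := fun _ : V => Fin D) Subtype.val) (hρ l ⟨s, c⟩)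
  have hinj : ∀ l c, Function.Injective fun s => (⟨(ec l s).1, c⟩ : Σ _ : V, Fin D) := by
    intro l c s t hst
    exact (ec l).injective (Subtype.ext (congrArg Sigma.fst hst))
  -- One generated tensor per component of `σ`: each component is melonic because `σ ⪯ γ`, and `T`
  -- supplies exactly one cut edge per cycle.
  let G : Fin (Fintype.card (GraphComponent σ)) → GeneratedShape D := fun l =>
    { n := Fintype.card (Thick σ (E l))
      σ := ρ l
      melonic := hmel l
      cut := Finset.univ.filter fun p => (⟨(ec l p.1).1, p.2⟩ : Σ _ : V, Fin D) ∈ T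
      cut_spec := by
        intro c s
        obtain ⟨⟨v, c'⟩, ⟨h1, h2⟩, h3⟩ := h.existsUnique ⟨(ec l s).1, c⟩
        have h4 : c = c' := sameCycle_comp_eq (a := fun e : Σ _ : V, Fin D => e.2) hσc h2
        subst h4
        have h5 := sameCycle_comp_eq
          (a := fun x => (Quotient.mk (graphSetoid σ) x.1 : GraphComponent σ))
          (fun x => mk_apply_eq σ x) h2
        have h6 : (Quotient.mk (graphSetoid σ) v : GraphComponent σ) = E l :=
          h5.symm.trans (ec l s).2
        refine ⟨(ec l).symm ⟨v, h6⟩, ⟨?_, ?_⟩, ?_⟩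
        · simpa using h1
        · rw [sameCycle_iff_of_semiconj (hinj l c) (hρσ l c)]
          simpa using h2
        · rintro t ⟨h7, h8⟩
          simp only [Finset.mem_filter, Finset.mem_univ, true_and] at h7
          rw [sameCycle_iff_of_semiconj (hinj l c) (hρσ l c)] at h8
          have h9 := h3 _ ⟨h7, h8⟩
          rw [Equiv.eq_symm_apply]
          exact Subtype.ext (congrArg Sigma.fst h9) }
  let ι : GlueVertex G → V := fun w => (ec w.1 w.2).1
  have hι : Function.Bijective ι := by
    constructor
    · rintro ⟨l, s⟩ ⟨l', s'⟩ hw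
      have h1 : l = l' := by
        apply E.injective
        rw [← (ec l s).2, ← (ec l' s').2]
        exact congrArg _ hw
      subst h1
      exact congrArg (Sigma.mk l) ((ec l).injective (Subtype.ext hw))
    · intro v
      have h1 : (Quotient.mk (graphSetoid σ) v : GraphComponent σ) =
          E (E.symm (Quotient.mk _ v)) := (E.apply_symm_apply _).symm
      refine ⟨⟨E.symm (Quotient.mk _ v), (ec _).symm ⟨v, h1⟩⟩, ?_⟩
      exact congrArg Subtype.val ((ec _).apply_symm_apply ⟨v, h1⟩)
  have hbase : IsRestriction (S := fun _ => Fin D) ι (glueBase G) σ := by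
    rintro ⟨⟨l, s⟩, c⟩
    exact hρσ l c s
  have hrange : ∀ x : Σ _ : GlueVertex G, Fin D, x ∈ Set.range (slotEmb G) ↔
      slotMap (S := fun _ => Fin D) ι x ∈ T := by
    rintro ⟨⟨l, s⟩, c⟩
    rw [mem_range_slotEmb]
    simp only [G, Finset.mem_filter, Finset.mem_univ, true_and]
    rfl
  have hperm := isRestriction_permCongr (S := fun _ : V => Fin D) hι
    ((Equiv.ofBijective _ (slotMap_bijective (S := fun _ : V => Fin D) hι)).permCongr.symm γ)
  rw [Equiv.apply_symm_apply] at hperm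
  set k := (Equiv.ofBijective _ (slotMap_bijective (S := fun _ : V => Fin D) hι)).permCongr.symm γ
    with hk
  -- Off the cut edges `γ` agrees with `σ`, that is, with the disjoint union of the pieces, so it
  -- arises by gluing along some `g`.
  obtain ⟨g, hg⟩ := exists_glue_eq G (g := 1) (h := k) fun x hx => by
    apply slotMap_injective (S := fun _ : V => Fin D) hι.1
    rw [glue_apply_of_notMem G 1 hx, ← hbase x, h.agree _ (fun h' => hx ((hrange x).2 h'))]
    exact (hperm x).symm
  rw [← hg] at hperm
  have hy : ∀ v w, graphSetoid σ v w → y v = y w := by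
    have : graphSetoid σ ≤ Setoid.ker y := graphSetoid_le_iff.2 fun e => (h.label e).symm
    exact fun v w hvw => this hvw
  refine ⟨_, fun l => y (E l).out, G, g, ι, hι, hperm, ?_, ?_, ?_, hrange, hbase⟩
  · intro w
    apply hy
    exact Quotient.exact (((ec w.1 w.2).2).trans (Quotient.out_eq _).symm)
  · intro e
    have h1 := congrArg Sigma.snd (hperm (slotEmb G e))
    rw [glue_slotEmb] at h1
    exact (h1.symm.trans (hγc _))
  · have h1 := (isMelonic_iff_of_isRestriction hι hperm).2 hγm
    obtain ⟨h2, h3⟩ := isMelonic_iff.1 h1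
    rw [numComp_glue] at h3
    exact isMelonic_iff.2 ⟨isForest_of_glue G h2, h3⟩

/-- Every melonic graph of labeled pure tensors comes from an alternating melonic graph of
generated paired tensors. -/
theorem exists_alternating_glue {γ : Perm (Σ _ : V, Fin D)} (y : V → I)
    (hγc : ∀ e, (γ e).2 = e.2) (hγm : IsMelonic γ) :
    ∃ (q : ℕ) (a : Fin q → I) (G : Fin q → GeneratedShape D) (g : Perm (Σ l, (G l).Slot))
      (ι : GlueVertex G → V), Function.Bijective ι ∧
      IsRestriction (S := fun _ => Fin D) ι (glue G g) γ ∧ (∀ w, y (ι w) = a w.1) ∧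
      ColorPreserving (fun l => (G l).color) g ∧ IsMelonic g ∧
      (∀ e : Σ l, (G l).Slot, e.1 ≠ (g e).1 → a e.1 ≠ a (g e).1) := by
  obtain ⟨σ, T, h, halt⟩ := exists_alternating_cutting γ y
  obtain ⟨q, a, G, g, ι, hι, h1, h2, h3, h4, h5, h6⟩ := h.exists_glue hγc hγm
  refine ⟨q, a, G, g, ι, hι, h1, h2, h3, h4, fun e he => ?_⟩
  have h7 := halt _ ((h5 _).1 ⟨e, rfl⟩) _ ((h5 _).1 ⟨g e, rfl⟩) ?_ ?_
  · have e1 := h2 (slotEmb G e).1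
    have e2 := h2 (slotEmb G (g e)).1
    change y (ι (slotEmb G e).1) ≠ y (ι (slotEmb G (g e)).1) at h7
    rw [e1, e2] at h7
    exact h7
  · rw [h6, h1, glue_slotEmb]
  · intro h8
    have h9 := (slotEmb G).injective (slotMap_injective (S := fun _ : V => Fin D) hι.1 h8)
    exact he (congrArg Sigma.fst h9)

/-- Every melonic graph of labeled pure tensors is a melonic graph of the elementary paired
tensors. -/
theorem exists_trivial_glue {γ : Perm (Σ _ : V, Fin D)} (y : V → I)
    (hγc : ∀ e, (γ e).2 = e.2) (hγm : IsMelonic γ) :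
    ∃ (q : ℕ) (a : Fin q → I) (G : Fin q → GeneratedShape D) (g : Perm (Σ l, (G l).Slot))
      (ι : GlueVertex G → V), Function.Bijective ι ∧
      IsRestriction (S := fun _ => Fin D) ι (glue G g) γ ∧ (∀ w, y (ι w) = a w.1) ∧
      ColorPreserving (fun l => (G l).color) g ∧ IsMelonic g ∧
      (∀ x, x ∈ Set.range (slotEmb G)) := by
  obtain ⟨q, a, G, g, ι, hι, h1, h2, h3, h4, h5, _⟩ := (isCutting_one γ y).exists_glue hγc hγm
  exact ⟨q, a, G, g, ι, hι, h1, h2, h3, h4, fun x => (h5 x).2 (Finset.mem_univ _)⟩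

end Cutting

end TensorFreeness

end

noncomputable section

namespace TensorFreeness

/-! ### Vanishing of mixed free cumulants -/

section Connected

variable {V : Type} {S : V → Type}

theorem eq_of_label_preserving {I : Type*} {γ : Perm (Σ v, S v)} {a : V → I}
    (h : ∀ e, a (γ e).1 = a e.1) {v w : V} (hvw : graphSetoid γ v w) : a v = a w := by
  have : graphSetoid γ ≤ Setoid.ker a := graphSetoid_le_iff.2 fun e => (h e).symm
  exact this hvw

theorem exists_label_ne {I : Type*} {γ : Perm (Σ v, S v)} (hγ : numComp γ = 1) {a : V → I}
    {v w : V} (h : a v ≠ a w) : ∃ e, a (γ e).1 ≠ a e.1 := by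
  by_contra! h'
  have h1 := (Nat.card_eq_one_iff_unique.1 hγ).1
  exact h (eq_of_label_preserving h' (Quotient.exact (h1.elim (Quotient.mk _ v) (Quotient.mk _ w))))

variable [Fintype V] [DecidableEq V] [∀ v, Fintype (S v)] [∀ v, DecidableEq (S v)]

theorem exists_apply_ne {γ : Perm (Σ v, S v)} (hγ : numComp γ = 1) (hV : 2 ≤ Nat.card V) (v : V) :
    ∃ s, γ ⟨v, s⟩ ≠ ⟨v, s⟩ := by
  by_contra! h
  have h1 := (Nat.card_eq_one_iff_unique.1 hγ).1
  obtain ⟨w, hw⟩ : ∃ w, w ≠ v := by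
    have : Nontrivial V := Finite.one_lt_card_iff_nontrivial.1 (by omega)
    exact exists_ne v
  exact hw (graphSetoid_eq_of_fixed h
    (Quotient.exact (h1.elim (Quotient.mk _ v) (Quotient.mk _ w))))

/-- A proper geodesic subgraph of a connected forest has `1 + |τ⁻¹ * γ| ≥ 2` components; this lets
arguments by the number of thick edges run over components. -/
theorem card_thick_lt {τ γ : Perm (Σ v, S v)} (hγ : IsForest γ) (hγ1 : numComp γ = 1)
    (h : Precedes τ γ) (hne : τ ≠ γ) (C : GraphComponent τ) :
    Fintype.card (Thick τ C) < Fintype.card V := by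
  have h1 := (hγ.of_precedes h).2
  have h2 : permLength (τ⁻¹ * γ) ≠ 0 := fun h2 =>
    hne (inv_mul_eq_one.1 (permLength_eq_zero h2))
  have : Nontrivial (GraphComponent τ) := by
    refine Finite.one_lt_card_iff_nontrivial.1 ?_
    unfold numComp at *
    omega
  obtain ⟨C', hC'⟩ := exists_ne C
  have h3 : ¬ (Quotient.mk (graphSetoid τ) C'.out : GraphComponent τ) = C := by
    rw [Quotient.out_eq]; exact hC'
  exact Fintype.card_subtype_lt h3

end Connected

namespace PureTensorFamily

variable {D : ℕ} {I : Type*} (F : PureTensorFamily D I)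

/-- Melonic graphs on an arbitrary set of thick edges are relabelings of melonic tuples. -/
theorem exists_tuple {V : Type} [Fintype V] [DecidableEq V] (hD : 2 ≤ D)
    {γ : Perm (Σ _ : V, Fin D)} (hγ : ∀ e, (γ e).2 = e.2) (hm : IsMelonic γ) :
    ∃ (n : ℕ) (e : Fin n ≃ V) (σ : Fin D → Perm (Fin n)), 1 ≤ n ∧ IsMelonicTuple σ ∧
      ∀ x x' : V → I,
        F.freeCumulant σ (fun i => x (e i)) (fun i => x' (e i)) =
          F.pairedCumulant γ (fun v => F.basic (x v) (x' v)) ∧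
        F.asympMoment σ (fun i => x (e i)) (fun i => x' (e i)) =
          F.pairedMoment γ (fun v => F.basic (x v) (x' v)) := by
  have hne : Nonempty V := by
    obtain ⟨C⟩ := (Nat.card_eq_one_iff_unique.1 (isMelonic_iff.1 hm).2).2
    exact ⟨C.out⟩
  obtain ⟨σ, hσ⟩ := exists_tupleGraph_isRestriction (Fintype.equivFin V).symm γ hγ
  have hb := (Fintype.equivFin V).symm.bijective
  have hσm : IsMelonicTuple σ := (isMelonic_iff_of_isRestriction hb hσ).2 hm
  refine ⟨_, (Fintype.equivFin V).symm, σ, Fintype.card_pos, hσm, fun x x' => ⟨?_, ?_⟩⟩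
  · rw [F.freeCumulant_eq_pairedCumulant hD σ hσm]
    exact F.pairedCumulant_eq_of_isRestriction hb hσ (fun v => F.basic (x v) (x' v))
  · rw [F.asympMoment_eq_pairedMoment hD σ hσm]
    exact F.pairedMoment_eq_of_isRestriction hb hσ (fun v => F.basic (x v) (x' v))

theorem pairedMoment_eq_sum {V : Type} {S : V → Type} [Fintype V] [DecidableEq V]
    [∀ v, Fintype (S v)] [∀ v, DecidableEq (S v)] {γ : Perm (Σ v, S v)} (hγ : numComp γ = 1)
    (H : ∀ v, F.RandomPaired (S v)) [DecidablePred fun τ => Precedes τ γ] :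
    F.pairedMoment γ H = ∑ τ with Precedes τ γ, F.pairedCumulant τ H := by
  rw [← F.pairedMomentMul_of_connected hγ,
    ← sum_moebiusTransform (fun τ => F.pairedMomentMul τ H) γ]
  refine Finset.sum_congr ?_ fun τ _ => (F.pairedCumulant_eq_moebiusTransform τ H).symm
  ext τ
  simp

/-- The labels of the pure tensors are not all equal. -/
def IsMixed {V : Type} (x x' : V → I) : Prop :=
  ∃ v w, x v ≠ x w ∨ x' v ≠ x' w ∨ x v ≠ x' w

/-- The free cumulants of the melonic graphs with mixed labels and fewer than `n` thick edges
vanish. -/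
def MixedCumulantsVanish (n : ℕ) : Prop :=
  ∀ (V : Type) [Fintype V] [DecidableEq V] (γ : Perm (Σ _ : V, Fin D)), (∀ e, (γ e).2 = e.2) →
    IsMelonic γ → Fintype.card V < n → ∀ x x' : V → I, IsMixed x x' →
      F.pairedCumulant γ (fun v => F.basic (x v) (x' v)) = 0

variable {F}

theorem MixedCumulantsVanish.eq_zero_of_component {n : ℕ} (h : F.MixedCumulantsVanish n)
    {V : Type} [Fintype V] [DecidableEq V] {γ : Perm (Σ _ : V, Fin D)} (hγ : ∀ e, (γ e).2 = e.2)
    (hf : IsForest γ) {x x' : V → I} (C : GraphComponent γ)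
    (hC : Fintype.card (Thick γ C) < n)
    (hx : IsMixed (fun v : Thick γ C => x v.1) (fun v : Thick γ C => x' v.1)) :
    F.pairedCumulant γ (fun v => F.basic (x v) (x' v)) = 0 := by
  classical
  refine F.pairedCumulant_eq_zero γ _ C ?_
  refine h (Thick γ C) (graphRestrict γ C) (fun e => hγ _) (isMelonic_iff.2 ⟨?_, ?_⟩) hC
    (fun v => x v.1) (fun v => x' v.1) hx
  · have h1 := hf.restriction (graphRestrict_isRestriction γ C)
    convert h1
  · exact numComp_graphRestrict _ _

omit F in
theorem isMixed_of_edge {V : Type} {γ : Perm (Σ _ : V, Fin D)} (x x' : V → I)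
    {e : Σ _ : V, Fin D} (he : x (γ e).1 ≠ x e.1) :
    IsMixed (fun v : Thick γ (Quotient.mk _ e.1) => x v.1)
      (fun v : Thick γ (Quotient.mk _ e.1) => x' v.1) :=
  ⟨⟨(γ e).1, mk_apply_eq γ e⟩, ⟨e.1, rfl⟩, Or.inl he⟩

omit F in
theorem isMixed_of_vertex {V : Type} (γ : Perm (Σ _ : V, Fin D)) {x x' : V → I}
    {v : V} (hv : x v ≠ x' v) :
    IsMixed (fun w : Thick γ (Quotient.mk _ v) => x w.1)
      (fun w : Thick γ (Quotient.mk _ v) => x' w.1) :=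
  ⟨⟨v, rfl⟩, ⟨v, rfl⟩, Or.inr (Or.inr hv)⟩

/-! ### Generated tensors when smaller mixed cumulants vanish -/

section Generated

variable {L : Type} [Fintype L] [DecidableEq L] {G : L → GeneratedShape D} {a : L → I}

/-- If the free cumulants of the proper subgraphs of `glue G τ` with mixed labels vanish, then the
free cumulant of generated paired tensors is the one of the underlying graph. -/
theorem MixedCumulantsVanish.pairedCumulant_generated
    (h : F.MixedCumulantsVanish (Fintype.card (GlueVertex G))) {g τ : Perm (Σ l, (G l).Slot)}
    (hg : ColorPreserving (fun l => (G l).color) g) (hm : IsMelonic g) (hτ : Precedes τ g)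
    {e : Σ l, (G l).Slot} (he : a (τ e).1 ≠ a e.1) :
    F.pairedCumulant τ (fun l => F.generated (G l) (a l)) =
      F.pairedCumulant (glue G τ) (fun w => F.basic (a w.1) (a w.1)) ∧
    (τ ≠ g → F.pairedCumulant τ (fun l => F.generated (G l) (a l)) = 0) := by
  obtain ⟨hf, h1⟩ := isMelonic_iff.1 hm
  have hGf := isForest_glue G hf
  have hG1 : numComp (glue G g) = 1 := by rw [numComp_glue, h1]
  have hGc := glue_color G hg
  have key : ∀ k : Perm (Σ _ : GlueVertex G, Fin D), Precedes k (glue G g) → k ≠ glue G g →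
      (∃ x, a (k x).1.1 ≠ a x.1.1) →
      F.pairedCumulant k (fun w => F.basic (a w.1) (a w.1)) = 0 := by
    rintro k hk hne ⟨x, hx⟩
    exact h.eq_zero_of_component (x := fun w : GlueVertex G => a w.1)
      (x' := fun w : GlueVertex G => a w.1) (hk.color_preserving hGc) (hGf.of_precedes hk).1
      (Quotient.mk _ x.1) (card_thick_lt hGf hG1 hk hne _) (isMixed_of_edge (fun w : GlueVertex G => a w.1)
        (fun w : GlueVertex G => a w.1) hx)
  have hτG := (precedes_glue G).2 hτ
  have h2 := F.pairedCumulant_generated_eq G a τ ⟨e, he⟩ fun k hk hne => key k (hk.trans hτG)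
    fun hkg => hne (hk.antisymm (hkg ▸ hτG))
  refine ⟨h2, fun hne => ?_⟩
  rw [h2]
  refine key _ hτG (fun h' => hne (glue_injective G h')) ⟨slotEmb G e, ?_⟩
  rw [glue_slotEmb]
  exact he

/-- The asymptotic moment of an almost alternating graph of centered paired tensors is the free
cumulant of the underlying graph of pure tensors. -/
theorem MixedCumulantsVanish.pairedMoment_centered (hD : 2 ≤ D) (hF : F.HasGaussianScaling)
    (h : F.MixedCumulantsVanish (Fintype.card (GlueVertex G))) {g : Perm (Σ l, (G l).Slot)}
    (hg : ColorPreserving (fun l => (G l).color) g) (hm : IsMelonic g)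
    (ha : AlmostAlternating a g) :
    F.pairedMoment g (fun l => F.centered (F.generated (G l) (a l))) =
      F.pairedCumulant (glue G g) (fun w => F.basic (a w.1) (a w.1)) := by
  classical
  obtain ⟨⟨e, he⟩, hsub⟩ := ha
  obtain ⟨hf, h1⟩ := isMelonic_iff.1 hm
  have hcard : 2 ≤ Nat.card L := by
    have : Nontrivial L := ⟨⟨e.1, (g e).1, fun h' => he (congrArg a h')⟩⟩
    exact Finite.one_lt_card
  unfold pairedMoment
  have h0 := HasGaussianScaling.tendsto_centered G a hD hF hg hm
  rw [h0.limUnder_eq, Finset.sum_eq_single g]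
  · exact (h.pairedCumulant_generated hg hm (Precedes.refl g) (e := e) he.symm).1
  · intro τ hτ hne
    simp only [Finset.mem_filter, Finset.mem_univ, true_and] at hτ
    -- A `τ ≠ g` mixing labels has zero cumulant by the hypothesis on smaller graphs. One preserving
    -- labels shares two same-label edges with `g`, which almost alternation forbids.
    by_cases hlab : ∃ e, a (τ e).1 ≠ a e.1
    · obtain ⟨e', he'⟩ := hlab
      exact (h.pairedCumulant_generated hg hm hτ.1 he').2 hne
    · push Not at hlab
      obtain ⟨e₁, e₂, hne', h2, h3⟩ := exists_two_monochromatic_edges a hf h1 hcard hτ.1 hτ.2 hlab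
      exact absurd (hsub h2 h3) hne'
  · intro hng
    refine absurd ?_ hng
    simp only [Finset.mem_filter, Finset.mem_univ, true_and]
    exact ⟨Precedes.refl g, exists_apply_ne h1 hcard⟩

end Generated

/-! ### Implications between the three vanishing conditions -/

theorem mixedCumulantsVanish_of_freeCumulant (hD : 2 ≤ D)
    (h : ∀ n : ℕ, 1 ≤ n → ∀ σ : Fin D → Perm (Fin n), IsMelonicTuple σ →
      ∀ x x' : Fin n → I, (∃ i j, x i ≠ x j ∨ x' i ≠ x' j ∨ x i ≠ x' j) →
        F.freeCumulant σ x x' = 0) (n : ℕ) : F.MixedCumulantsVanish n := by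
  intro V _ _ γ hγ hm _ x x' ⟨v, w, hx⟩
  obtain ⟨n, e, σ, hn, hσ, h1⟩ := F.exists_tuple hD hγ hm
  rw [← (h1 x x').1]
  exact h n hn σ hσ _ _ ⟨e.symm v, e.symm w, by simpa using hx⟩

theorem freeCumulant_eq_zero_of_mixedCumulantsVanish (hD : 2 ≤ D)
    (h : ∀ n, F.MixedCumulantsVanish n) {n : ℕ} {σ : Fin D → Perm (Fin n)} (hσ : IsMelonicTuple σ)
    {x x' : Fin n → I} (hx : ∃ i j, x i ≠ x j ∨ x' i ≠ x' j ∨ x i ≠ x' j) :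
    F.freeCumulant σ x x' = 0 := by
  rw [F.freeCumulant_eq_pairedCumulant hD σ hσ]
  exact h (n + 1) (Fin n) (tupleGraph σ) (fun _ => rfl) hσ (by simp) x x' hx

/-- In the expansion of the moment over `τ ⪯ σ`, the component of the canonical pair `i` always
carries both labels `x i` and `x' i`, so every term vanishes. -/
theorem asympMoment_eq_zero (hD : 2 ≤ D) (h : ∀ n, F.MixedCumulantsVanish n) {n : ℕ}
    {σ : Fin D → Perm (Fin n)} (hσ : IsMelonicTuple σ) {x x' : Fin n → I} {i : Fin n}
    (hi : x i ≠ x' i) : F.asympMoment σ x x' = 0 := by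
  classical
  obtain ⟨hf, hc⟩ := isMelonic_iff.1 hσ
  rw [F.asympMoment_eq_pairedMoment hD σ hσ, F.pairedMoment_eq_sum hc]
  refine Finset.sum_eq_zero fun τ hτ => ?_
  simp only [Finset.mem_filter, Finset.mem_univ, true_and] at hτ
  have h5 : IsMixed (fun w : Thick τ (Quotient.mk _ i) => x w.1)
      (fun w : Thick τ (Quotient.mk _ i) => x' w.1) := isMixed_of_vertex τ hi
  exact (h _).eq_zero_of_component (x := x) (x' := x') (hτ.color_preserving fun _ => rfl)
    (hf.of_precedes hτ).1 (Quotient.mk _ i) (Nat.lt_succ_self _) h5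

/-- Induction on the number of thick edges. If `x v ≠ x' v`, the moment vanishes and every term of
its cumulant expansion except that of `γ` has a smaller mixed component. If `x = x'`, an alternating
gluing presents `γ`, and its vanishing centered moment equals the cumulant of `γ` by the induction
hypothesis. -/
theorem mixedCumulantsVanish_of_moments (hD : 2 ≤ D) (hF : F.HasGaussianScaling)
    (h₁ : ∀ n : ℕ, 1 ≤ n → ∀ σ : Fin D → Perm (Fin n), IsMelonicTuple σ →
      ∀ x x' : Fin n → I, (∃ i, x i ≠ x' i) → F.asympMoment σ x x' = 0)
    (h₂ : ∀ q : ℕ, 2 ≤ q → ∀ (a : Fin q → I) (G : Fin q → GeneratedShape D)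
      (g : Perm (Σ l : Fin q, (G l).Slot)), ColorPreserving (fun l => (G l).color) g →
        IsMelonic g → AlmostAlternating a g →
          F.pairedMoment g (fun l => F.centered (F.generated (G l) (a l))) = 0) (n : ℕ) :
    F.MixedCumulantsVanish n := by
  classical
  induction n with
  | zero => intro V _ _ γ _ _ hV; omega
  | succ n ih =>
    intro V _ _ γ hγ hm hV x x' hx
    obtain ⟨hf, hc⟩ := isMelonic_iff.1 hm
    have ih' : F.MixedCumulantsVanish (Fintype.card V) := fun U _ _ δ hδ hδm hU =>
      ih U δ hδ hδm (by omega)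
    by_cases hxx : ∃ v, x v ≠ x' v
    · obtain ⟨v, hv⟩ := hxx
      obtain ⟨m, e, σ, hn, hσ, h3⟩ := F.exists_tuple hD hγ hm
      have h4 := (h3 x x').2
      rw [h₁ m hn σ hσ _ _ ⟨e.symm v, by simpa using hv⟩, F.pairedMoment_eq_sum hc,
        Finset.sum_eq_single γ] at h4
      · exact h4.symm
      · intro τ hτ hne
        simp only [Finset.mem_filter, Finset.mem_univ, true_and] at hτ
        have h5 : IsMixed (fun w : Thick τ (Quotient.mk _ v) => x w.1)
            (fun w : Thick τ (Quotient.mk _ v) => x' w.1) := isMixed_of_vertex τ hv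
        have h6 := card_thick_lt hf hc hτ hne (Quotient.mk _ v)
        exact ih'.eq_zero_of_component (x := x) (x' := x') (hτ.color_preserving hγ)
          (hf.of_precedes hτ).1 (Quotient.mk _ v) h6 h5
      · intro hng
        refine absurd ?_ hng
        simp only [Finset.mem_filter, Finset.mem_univ, true_and]
        exact Precedes.refl γ
    · push Not at hxx
      obtain rfl : x = x' := funext hxx
      obtain ⟨v, w, hvw⟩ := hx
      have hvw : x v ≠ x w := by tauto
      obtain ⟨q, a, G, g, ι, hι, r, hy, hg, hgm, halt⟩ := exists_alternating_glue x hγ hm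
      obtain ⟨v, rfl⟩ := hι.2 v
      obtain ⟨w, rfl⟩ := hι.2 w
      rw [hy, hy] at hvw
      have hq : 2 ≤ q := by
        have : Nontrivial (Fin q) := ⟨⟨v.1, w.1, fun h => hvw (congrArg a h)⟩⟩
        exact Fin.nontrivial_iff_two_le.1 this
      obtain ⟨e, he⟩ := exists_label_ne (isMelonic_iff.1 hgm).2 hvw
      have haa : AlmostAlternating a g :=
        ⟨⟨e, he.symm⟩, fun e₁ h1 => absurd h1.2 (halt e₁ h1.1)⟩
      have hcard : Fintype.card (GlueVertex G) = Fintype.card V := Fintype.card_of_bijective hι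
      have h5 := MixedCumulantsVanish.pairedMoment_centered hD hF (hcard ▸ ih') hg hgm haa
      rw [h₂ q hq a G g hg hgm haa] at h5
      rw [← F.pairedCumulant_eq_of_isRestriction hι r (fun v => F.basic (x v) (x v))]
      simp only [hy]
      exact h5.symm

/-- Cut every edge: the agreement condition in `pairedCumulant_generated` becomes void, and the
cumulant of the generated tensors is that of `σ` itself. -/
theorem freeCumulant_eq_zero_of_generated (hD : 2 ≤ D)
    (h : ∀ q : ℕ, 2 ≤ q → ∀ (a : Fin q → I) (G : Fin q → GeneratedShape D)
      (g : Perm (Σ l : Fin q, (G l).Slot)), ColorPreserving (fun l => (G l).color) g →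
        IsMelonic g → (∃ l l', l < l' ∧ a l ≠ a l') →
          F.pairedCumulant g (fun l => F.generated (G l) (a l)) = 0)
    {n : ℕ} {σ : Fin D → Perm (Fin n)} (hσ : IsMelonicTuple σ) {x : Fin n → I} {i j : Fin n}
    (hx : x i ≠ x j) : F.freeCumulant σ x x = 0 := by
  classical
  rw [F.freeCumulant_eq_pairedCumulant hD σ hσ]
  obtain ⟨q, a, G, g, ι, hι, r, hy, hg, hgm, hr⟩ := exists_trivial_glue x (γ := tupleGraph σ)
    (fun _ => rfl) hσ
  obtain ⟨i, rfl⟩ := hι.2 i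
  obtain ⟨j, rfl⟩ := hι.2 j
  rw [hy, hy] at hx
  obtain ⟨l, l', hl, hll⟩ : ∃ l l', l < l' ∧ a l ≠ a l' := by
    rcases lt_trichotomy i.1 j.1 with hij | hij | hij
    · exact ⟨_, _, hij, hx⟩
    · exact absurd (congrArg a hij) hx
    · exact ⟨_, _, hij, hx.symm⟩
  have h1 := h q (by omega) a G g hg hgm ⟨l, l', hl, hll⟩
  rw [F.pairedCumulant_generated] at h1
  rw [← F.pairedCumulant_eq_of_isRestriction hι r (fun v => F.basic (x v) (x v))]
  simp only [hy]
  rw [pairedCumulant_eq_moebiusTransform, ← h1]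
  unfold moebiusTransform
  refine Finset.sum_congr ?_ fun _ _ => rfl
  ext k
  simp only [Finset.mem_filter, Finset.mem_univ, true_and]
  exact ⟨fun hk => ⟨hk, fun x hx => absurd (hr x) hx⟩, fun hk => hk.1⟩

end PureTensorFamily

end TensorFreeness

end

theorem mainTheorem6 {D : ℕ} (hD : 3 ≤ D) {I : Type*}
    (F : TensorFreeness.PureTensorFamily D I) (hF : F.HasGaussianScaling) :
    -- the limits defining the asymptotic moments of generated paired tensors and of their
    -- centerings exist
    (∀ (q : ℕ) (a : Fin q → I) (G : Fin q → TensorFreeness.GeneratedShape D)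
      (g : Equiv.Perm (Σ l : Fin q, (G l).Slot)),
      TensorFreeness.ColorPreserving (fun l => (G l).color) g → TensorFreeness.IsMelonic g →
        (∃ z : ℂ, Tendsto (F.rescaledPairedMoment g (fun l => F.generated (G l) (a l)))
          atTop (𝓝 z)) ∧
        (∃ z : ℂ, Tendsto (F.rescaledPairedMoment g
          (fun l => F.centered (F.generated (G l) (a l)))) atTop (𝓝 z))) ∧
    List.TFAE [
      -- vanishing of all the first order free cumulants involving different labels
      ∀ n : ℕ, 1 ≤ n → ∀ σ : Fin D → Equiv.Perm (Fin n), TensorFreeness.IsMelonicTuple σ →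
        ∀ x x' : Fin n → I, (∃ i j, x i ≠ x j ∨ x' i ≠ x' j ∨ x i ≠ x' j) →
          F.freeCumulant σ x x' = 0,
      -- formulation by the free cumulants of paired tensors
      (∀ n : ℕ, 1 ≤ n → ∀ σ : Fin D → Equiv.Perm (Fin n), TensorFreeness.IsMelonicTuple σ →
        ∀ x x' : Fin n → I, (∃ i, x i ≠ x' i) → F.freeCumulant σ x x' = 0) ∧
      (∀ q : ℕ, 2 ≤ q → ∀ (a : Fin q → I) (G : Fin q → TensorFreeness.GeneratedShape D)
        (g : Equiv.Perm (Σ l : Fin q, (G l).Slot)),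
        TensorFreeness.ColorPreserving (fun l => (G l).color) g → TensorFreeness.IsMelonic g →
          (∃ l l', l < l' ∧ a l ≠ a l') →
            F.pairedCumulant g (fun l => F.generated (G l) (a l)) = 0),
      -- formulation by the asymptotic moments
      (∀ n : ℕ, 1 ≤ n → ∀ σ : Fin D → Equiv.Perm (Fin n), TensorFreeness.IsMelonicTuple σ →
        ∀ x x' : Fin n → I, (∃ i, x i ≠ x' i) → F.asympMoment σ x x' = 0) ∧
      (∀ q : ℕ, 2 ≤ q → ∀ (a : Fin q → I) (G : Fin q → TensorFreeness.GeneratedShape D)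
        (g : Equiv.Perm (Σ l : Fin q, (G l).Slot)),
        TensorFreeness.ColorPreserving (fun l => (G l).color) g → TensorFreeness.IsMelonic g →
          TensorFreeness.AlmostAlternating a g →
            F.pairedMoment g (fun l => F.centered (F.generated (G l) (a l))) = 0)] := by
  have hD2 : 2 ≤ D := by omega
  refine ⟨?_, ?_⟩
  · classical
    intro q a G g hg hm
    have h1 := (TensorFreeness.isMelonic_iff.1 hm).2
    refine ⟨⟨F.pairedMomentMul g (fun l => F.generated (G l) (a l)), ?_⟩, ⟨_,
      TensorFreeness.PureTensorFamily.HasGaussianScaling.tendsto_centered G a hD2 hF hg hm⟩⟩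
    · have h2 := TensorFreeness.PureTensorFamily.HasGaussianScaling.tendsto_generated G a hD2 hF
        hg (TensorFreeness.isMelonic_iff.1 hm).1
      rw [h1] at h2
      refine h2.congr fun N => ?_
      simp only [TensorFreeness.PureTensorFamily.rescaledPairedMoment, pow_one]
      congr 2
      funext ω
      convert rfl
  tfae_have 1 → 2 := by
    intro h
    refine ⟨fun n hn σ hσ x x' ⟨i, hi⟩ => h n hn σ hσ x x' ⟨i, i, Or.inr (Or.inr hi)⟩, ?_⟩
    rintro q _ a G g hg hm ⟨l, l', _, hl⟩
    have hv := TensorFreeness.PureTensorFamily.mixedCumulantsVanish_of_freeCumulant hD2 h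
    obtain ⟨hf, h1⟩ := TensorFreeness.isMelonic_iff.1 hm
    -- Two different labels in a connected graph force an edge along which the label changes; it
    -- makes the glued graph mixed.
    obtain ⟨e, he⟩ := TensorFreeness.exists_label_ne h1 hl
    have h2 := ((hv _).pairedCumulant_generated hg hm (TensorFreeness.Precedes.refl g) he).1
    rw [h2]
    refine hv (Fintype.card (TensorFreeness.GlueVertex G) + 1) _ (TensorFreeness.glue G g)
      (TensorFreeness.glue_color G hg) (TensorFreeness.isMelonic_iff.2
        ⟨TensorFreeness.isForest_glue G hf, by rw [TensorFreeness.numComp_glue, h1]⟩)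
      (Nat.lt_succ_self _) (fun w => a w.1) (fun w => a w.1) ?_
    exact ⟨(TensorFreeness.slotEmb G (g e)).1, (TensorFreeness.slotEmb G e).1, Or.inl he⟩
  tfae_have 2 → 1 := by
    rintro ⟨h1, h2⟩ n hn σ hσ x x' hx
    by_cases hxx : ∃ i, x i ≠ x' i
    · exact h1 n hn σ hσ x x' hxx
    · push Not at hxx
      obtain rfl : x = x' := funext hxx
      obtain ⟨i, j, hij⟩ := hx
      exact TensorFreeness.PureTensorFamily.freeCumulant_eq_zero_of_generated hD2 h2 hσ
        (i := i) (j := j) (by tauto)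
  tfae_have 1 → 3 := by
    intro h
    have hv := TensorFreeness.PureTensorFamily.mixedCumulantsVanish_of_freeCumulant hD2 h
    refine ⟨?_, ?_⟩
    · rintro n hn σ hσ x x' ⟨i, hi⟩
      exact TensorFreeness.PureTensorFamily.asympMoment_eq_zero hD2 hv hσ hi
    · intro q _ a G g hg hm haa
      rw [TensorFreeness.PureTensorFamily.MixedCumulantsVanish.pairedMoment_centered hD2 hF (hv _)
        hg hm haa]
      obtain ⟨hf, h1⟩ := TensorFreeness.isMelonic_iff.1 hm
      obtain ⟨⟨e, he⟩, _⟩ := haa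
      refine hv (Fintype.card (TensorFreeness.GlueVertex G) + 1) _ (TensorFreeness.glue G g)
        (TensorFreeness.glue_color G hg) (TensorFreeness.isMelonic_iff.2
          ⟨TensorFreeness.isForest_glue G hf, by rw [TensorFreeness.numComp_glue, h1]⟩)
        (Nat.lt_succ_self _) (fun w => a w.1) (fun w => a w.1) ?_
      exact ⟨(TensorFreeness.slotEmb G e).1, (TensorFreeness.slotEmb G (g e)).1, Or.inl he⟩
  tfae_have 3 → 1 := by
    rintro ⟨h1, h2⟩ n _ σ hσ x x' hx
    exact TensorFreeness.PureTensorFamily.freeCumulant_eq_zero_of_mixedCumulantsVanish hD2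
      (TensorFreeness.PureTensorFamily.mixedCumulantsVanish_of_moments hD2 hF h1 h2) hσ hx
  tfae_finish
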